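/- Let $x_1,x_2,\dots$ be i.i.d. and let $g(x,\theta)\in\mathbb R^m$, $\theta\in\mathbb R^p$, satisfy $E[g(x_i,\theta^*)]=0$. On an open neighbourhood $N$ of $\theta^*$ let $g(x,\cdot)$ be $C^4$, with all derivatives of order $0,\dots,4$ bounded by $b(x)$, where $E[b(x_i)^6]<\infty$. Write $\dot g=g(x_i,\theta)$, $\dot G=\partial g(x_i,\theta)/\partial\theta'$, $G=E[\dot G]$ and $\Omega=E[\dot g\dot g']$ at $\theta=\theta^*$, and assume that $\Omega$ is nonsingular and that $G$ has rank $p$. Let $\Sigma=(G'\Omega^{-1}G)^{-1}$, $H=\Sigma G'\Omega^{-1}$, $P=\Omega^{-1}-\Omega^{-1}G\Sigma G'\Omega^{-1}$ and $\bar g=n^{-1/2}\sum_{i\le n} g(x_i,\theta^*)$. Let $\beta=(\tau,\kappa,\lambda,\theta)\in\mathbb R^{1+m+m+p}$, $\beta^*=(1,0,0,\theta^*)$, $\dot\tau=\exp(\lambda'\dot g)$, $\dot\varepsilon=(1-\kappa'\dot g)^{-1}$, $$\dot\phi^{ETEL}=\begin{pmatrix}\dot\tau-\tau\\ \dot\tau\dot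 g\\ (\tau-\dot\tau)\dot g+\dot\tau\dot g\dot g'\kappa\\ \dot\tau\dot G'\kappa+\dot\tau\dot G'\lambda\,\dot g'\kappa-\dot\tau\dot G'\lambda+\tau\dot G'\lambda\end{pmatrix},\qquad \dot\phi^{EL}=\begin{pmatrix}\dot\tau-\tau\\ \dot\tau\dot g\\ \dot\varepsilon\dot g-\dot\tau\dot g\\ \dot\varepsilon\dot G'\kappa\end{pmatrix}.$$ The ETEL and EL estimators $\hat\beta$ are $\sqrt n$-consistent solutions, with probability approaching one, of $n^{-1}\sum_i\dot\phi=0$ for the respective $\dot\phi$. For each $\dot\phi$, with derivatives taken at $\beta^*$, let $\Phi_{l,j},\Phi_{l,jk},\Phi_{l,jkh}$ be the expectations of the first, second and third partial derivatives of $\dot\phi_l$, let $\bar\Phi_l=n^{-1/2}\sum_i\dot\phi_l$, and let $\bar\Phi_{l,j},\bar\Phi_{l,jk}$ be $n^{-1/2}$ times the sums over $i$ of the centred derivatives. Write $\Psi$ with given bars and indices for $-(\Phi_{\cdot,\cdot})^{-1}$ applied to the corresponding $\Phi$ (in its first index). Put, summing over repeated indices, $$\bar Q_l=\bar\Psi_{l,j}\bar\Psi_j+\tfrac12\Psi_{l,jk}\bar\Psi_j\bar\Psi_k,\qquad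 \bar R_l=\bar\Psi_{l,j}\bar Q_j+\Psi_{l,jk}\bar Q_j\bar\Psi_k+\tfrac12\bar\Psi_{l,jk}\bar\Psi_j\bar\Psi_k+\tfrac16\Psi_{l,jkh}\bar\Psi_j\bar\Psi_k\bar\Psi_h .$$ Then: 1. $\bar\Psi^{ETEL}=\bar\Psi^{EL}=(0,-P\bar g,-P\bar g,-H\bar g)=:\bar\Psi$ and $\bar Q^{ETEL}=\bar Q^{EL}=:\bar Q$, for every $n$ and every sample. 2. In general $\bar R^{ETEL}\ne\bar R^{EL}$: there are such a model and a coordinate $l$ of $\theta$ with $\Pr(\bar R^{ETEL}_{\theta,l}\ne\bar R^{EL}_{\theta,l})>0$ for all $n\ge1$. But for all coordinates $l,c$ of $\theta$ the contribution to the variance satisfies $n^{-2}E[(\bar R^{ETEL}_{\theta,l}-\bar R^{EL}_{\theta,l})\bar\Psi_{\theta,c}]=o(n^{-2})$; indeed $E[(\bar R^{ETEL}_{\theta,l}-\bar R^{EL}_{\theta,l})\bar\Psi_{\theta,c}]=O(n^{-1})$. In detail, (a) $(\bar\Psi^{ETEL}_{\theta_l,j}-\bar\Psi^{EL}_{\theta_l,j})\bar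 Q_j=\frac12(H\bar g)_l\,\bar g'P\bar g$; (b) $(\Psi^{ETEL}_{\theta_l,jk}-\Psi^{EL}_{\theta_l,jk})\bar\Psi_k\bar Q_j=-\frac12(H\bar g)_l\,\bar g'P\bar g-\Xi_{7,l}$ with $n^{-2}E[\Xi_{7,l}\bar\Psi_{\theta,c}]=o(n^{-2})$; (c) $(\bar\Psi^{ETEL}_{l,jk}-\bar\Psi^{EL}_{l,jk})\bar\Psi_j\bar\Psi_k=0$ for every coordinate $l$ of $\beta$; (d) $(\Psi^{ETEL}_{\theta_l,jkh}-\Psi^{EL}_{\theta_l,jkh})\bar\Psi_j\bar\Psi_k\bar\Psi_h=\Xi_{8,l}$ with $n^{-2}E[\Xi_{8,l}\bar\Psi_{\theta,c}]=o(n^{-2})$. 3. The ETEL and EL estimators of $\theta$ have the same variance up to order $n^{-2}$, in the following sense. Let $V_n=n^{-1}\mathrm{Var}(\bar\Psi)+n^{-3/2}[\mathrm{Cov}(\bar\Psi,\bar Q)+\mathrm{Cov}(\bar Q,\bar\Psi)]+n^{-2}[\mathrm{Var}(\bar Q)+\mathrm{Cov}(\bar R,\bar\Psi)+\mathrm{Cov}(\bar\Psi,\bar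 R)]$. The $\theta$-blocks of $V_n^{ETEL}$ and $V_n^{EL}$ differ by $o(n^{-2})$. If $E[b(x_i)^{12}]<\infty$, then for each of the two estimators the expansion $S_n=n^{-1/2}\bar\Psi+n^{-1}\bar Q+n^{-3/2}\bar R$ is square integrable and $\mathrm{Var}(S_n)=V_n+o(n^{-2})$; so the variances of the $\theta$-blocks of $S_n^{ETEL}$ and $S_n^{EL}$ differ by $o(n^{-2})$. 4. If $E[b(x_i)^8]<\infty$, then $\hat\beta-\beta^*=n^{-1/2}\bar\Psi+n^{-1}\bar Q+n^{-3/2}\bar R+O_p(n^{-2})$ for both estimators. If $E[b(x_i)^{12}]<\infty$ and the $\theta$-blocks of the remainders of both expansions are square integrable for large $n$ and of order $o(n^{-3/2})$ in mean square, then $\mathrm{Var}(\hat\theta^{ETEL})-\mathrm{Var}(\hat\theta^{EL})=o(n^{-2})$. -/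

import Mathlib

open MeasureTheory ProbabilityTheory Filter Topology Asymptotics Matrix

namespace ETEL

noncomputable section

/-! ### Partial derivatives, sample sums, stochastic order -/

/-- The partial derivative `∂f/∂v_j` as a function of `v`. -/
def pd {ι : Type*} [Fintype ι] [DecidableEq ι] (j : ι) (f : (ι → ℝ) → ℝ) : (ι → ℝ) → ℝ :=
  fun v => lineDeriv ℝ f v (Pi.single j 1)

/-- Population mean `E[f(x_i)]` for an identically distributed sample `X 0, X 1, …`. -/
def mean {Ω 𝒳 : Type*} [MeasurableSpace Ω] (μ : Measure Ω) (X : ℕ → Ω → 𝒳) (f : 𝒳 → ℝ) : ℝ :=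
  ∫ ω, f (X 0 ω) ∂μ

/-- `n^{-1/2} ∑_{i < n} f(x_i)`. -/
def nsum {Ω 𝒳 : Type*} (X : ℕ → Ω → 𝒳) (n : ℕ) (f : 𝒳 → ℝ) (ω : Ω) : ℝ :=
  (√(n : ℝ))⁻¹ * ∑ i ∈ Finset.range n, f (X i ω)

/-- `Y n = O_p(a n)`. -/
def IsBigOp {Ω E : Type*} [MeasurableSpace Ω] [Norm E] (μ : Measure Ω) (Y : ℕ → Ω → E)
    (a : ℕ → ℝ) : Prop :=
  ∀ ε : ℝ, 0 < ε → ∃ C : ℝ, ∃ n₀ : ℕ, ∀ n ≥ n₀,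
    μ {ω | C * a n < ‖Y n ω‖} ≤ ENNReal.ofReal ε

/-! ### Stochastic expansion of a just-identified moment estimator

`φ x β` is the vector of moment functions, one for each coordinate of the parameter `β`,
and `βs` is the true value of the parameter. -/

section Expansion

variable {Ω 𝒳 ι : Type*} [MeasurableSpace Ω] [Fintype ι] [DecidableEq ι]
  (μ : Measure Ω) (X : ℕ → Ω → 𝒳) (φ : 𝒳 → (ι → ℝ) → ι → ℝ) (βs : ι → ℝ)

/-- `∂φ_l/∂β_j` at the true value. -/
def d1 (l j : ι) (x : 𝒳) : ℝ := pd j (fun β => φ x β l) βs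

/-- `∂²φ_l/∂β_j∂β_k` at the true value. -/
def d2 (l j k : ι) (x : 𝒳) : ℝ := pd j (pd k fun β => φ x β l) βs

/-- `∂³φ_l/∂β_j∂β_k∂β_h` at the true value. -/
def d3 (l j k h : ι) (x : 𝒳) : ℝ := pd j (pd k (pd h fun β => φ x β l)) βs

/-- `Φ_{l,j}` -/
def Phi1 : Matrix ι ι ℝ := Matrix.of fun l j => mean μ X (d1 φ βs l j)

/-- `Φ_{l,jk}` -/
def Phi2 (l j k : ι) : ℝ := mean μ X (d2 φ βs l j k)

/-- `Φ_{l,jkh}` -/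
def Phi3 (l j k h : ι) : ℝ := mean μ X (d3 φ βs l j k h)

/-- `Φ̄_l` -/
def PhiBar (n : ℕ) (ω : Ω) (l : ι) : ℝ := nsum X n (fun x => φ x βs l) ω

/-- `Φ̄_{l,j}` -/
def PhiBar1 (n : ℕ) (ω : Ω) (l j : ι) : ℝ :=
  nsum X n (fun x => d1 φ βs l j x - Phi1 μ X φ βs l j) ω

/-- `Φ̄_{l,jk}` -/
def PhiBar2 (n : ℕ) (ω : Ω) (l j k : ι) : ℝ :=
  nsum X n (fun x => d2 φ βs l j k x - Phi2 μ X φ βs l j k) ω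

/-- `Ψ_{l,jk}` -/
def Psi2 (l j k : ι) : ℝ := -∑ h, (Phi1 μ X φ βs)⁻¹ l h * Phi2 μ X φ βs h j k

/-- `Ψ_{l,jkh}` -/
def Psi3 (l j k h : ι) : ℝ := -∑ q, (Phi1 μ X φ βs)⁻¹ l q * Phi3 μ X φ βs q j k h

/-- `Ψ̄_l` -/
def PsiBar (n : ℕ) (ω : Ω) (l : ι) : ℝ :=
  -∑ h, (Phi1 μ X φ βs)⁻¹ l h * PhiBar X φ βs n ω h

/-- `Ψ̄_{l,j}` -/
def PsiBar1 (n : ℕ) (ω : Ω) (l j : ι) : ℝ :=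
  -∑ h, (Phi1 μ X φ βs)⁻¹ l h * PhiBar1 μ X φ βs n ω h j

/-- `Ψ̄_{l,jk}` -/
def PsiBar2 (n : ℕ) (ω : Ω) (l j k : ι) : ℝ :=
  -∑ h, (Phi1 μ X φ βs)⁻¹ l h * PhiBar2 μ X φ βs n ω h j k

/-- `Q̄_l` -/
def QBar (n : ℕ) (ω : Ω) (l : ι) : ℝ :=
  ∑ j, PsiBar1 μ X φ βs n ω l j * PsiBar μ X φ βs n ω j
    + 1 / 2 * ∑ j, ∑ k, Psi2 μ X φ βs l j k * PsiBar μ X φ βs n ω j * PsiBar μ X φ βs n ω k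

/-- `R̄_l` -/
def RBar (n : ℕ) (ω : Ω) (l : ι) : ℝ :=
  ∑ j, PsiBar1 μ X φ βs n ω l j * QBar μ X φ βs n ω j
    + ∑ j, ∑ k, Psi2 μ X φ βs l j k * QBar μ X φ βs n ω j * PsiBar μ X φ βs n ω k
    + 1 / 2 * ∑ j, ∑ k,
        PsiBar2 μ X φ βs n ω l j k * PsiBar μ X φ βs n ω j * PsiBar μ X φ βs n ω k
    + 1 / 6 * ∑ j, ∑ k, ∑ h, Psi3 μ X φ βs l j k h * PsiBar μ X φ βs n ω j
        * PsiBar μ X φ βs n ω k * PsiBar μ X φ βs n ω h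

/-- The third-order stochastic expansion `n^{-1/2} Ψ̄ + n^{-1} Q̄ + n^{-3/2} R̄`. -/
def expansion (n : ℕ) (ω : Ω) (l : ι) : ℝ :=
  (√(n : ℝ))⁻¹ * PsiBar μ X φ βs n ω l + (n : ℝ)⁻¹ * QBar μ X φ βs n ω l
    + (√(n : ℝ))⁻¹ ^ 3 * RBar μ X φ βs n ω l

/-- The `(l, m)` entry of the variance of the expansion, without the terms `n^{-5/2} Cov(Q̄, R̄)`
and `n^{-3} Var(R̄)`. -/
def secondOrderVar (n : ℕ) (l m : ι) : ℝ :=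
  (n : ℝ)⁻¹ * cov[fun ω => PsiBar μ X φ βs n ω l, fun ω => PsiBar μ X φ βs n ω m; μ]
    + (√(n : ℝ))⁻¹ ^ 3 *
      (cov[fun ω => PsiBar μ X φ βs n ω l, fun ω => QBar μ X φ βs n ω m; μ]
        + cov[fun ω => QBar μ X φ βs n ω l, fun ω => PsiBar μ X φ βs n ω m; μ])
    + ((n : ℝ) ^ 2)⁻¹ *
      (cov[fun ω => QBar μ X φ βs n ω l, fun ω => QBar μ X φ βs n ω m; μ]
        + cov[fun ω => RBar μ X φ βs n ω l, fun ω => PsiBar μ X φ βs n ω m; μ]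
        + cov[fun ω => PsiBar μ X φ βs n ω l, fun ω => RBar μ X φ βs n ω m; μ])

/-- `βh n` solves `n^{-1} ∑_{i < n} φ(x_i, β) = 0` with probability approaching one, and is
`√n`-consistent for `βs`. -/
structure IsMomentEstimator (βh : ℕ → Ω → ι → ℝ) : Prop where
  solves : Tendsto
    (fun n : ℕ => μ {ω | ¬ ∀ l, (n : ℝ)⁻¹ * ∑ i ∈ Finset.range n, φ (X i ω) (βh n ω) l = 0})
    atTop (𝓝 0)
  rootn : IsBigOp μ (fun n ω => βh n ω - βs) fun n => (√(n : ℝ))⁻¹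

/-- `β̂ - β* - n^{-1/2} Ψ̄ - n^{-1} Q̄ - n^{-3/2} R̄`. -/
def remainder (βh : ℕ → Ω → ι → ℝ) (n : ℕ) (ω : Ω) : ι → ℝ :=
  fun l => βh n ω l - βs l - expansion μ X φ βs n ω l

end Expansion

/-! ### The augmented moment conditions of ETEL and EL -/

/-- Coordinates of `β = (τ, κ, λ, θ)`. -/
abbrev Idx (m p : ℕ) : Type := Unit ⊕ Fin m ⊕ Fin m ⊕ Fin p

/-- Coordinates of `τ`. -/
abbrev iτ {m p : ℕ} : Idx m p := Sum.inl ()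
/-- Coordinates of `κ`. -/
abbrev iκ {m p : ℕ} (a : Fin m) : Idx m p := Sum.inr (Sum.inl a)
/-- Coordinates of `λ`. -/
abbrev iΛ {m p : ℕ} (a : Fin m) : Idx m p := Sum.inr (Sum.inr (Sum.inl a))
/-- Coordinates of `θ`. -/
abbrev iθ {m p : ℕ} (c : Fin p) : Idx m p := Sum.inr (Sum.inr (Sum.inr c))

/-- The vector `(τ, κ, λ, θ)`. -/
def mk {m p : ℕ} (t : ℝ) (k l : Fin m → ℝ) (θ : Fin p → ℝ) : Idx m p → ℝ :=
  Sum.elim (fun _ => t) (Sum.elim k (Sum.elim l θ))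

/-- `β* = (1, 0, 0, θ*)`. -/
def betaStar {m p : ℕ} (θs : Fin p → ℝ) : Idx m p → ℝ := mk 1 0 0 θs

section Moments

variable {Ω 𝒳 : Type*} [MeasurableSpace Ω] {m p : ℕ} (g : 𝒳 → (Fin p → ℝ) → Fin m → ℝ)

/-- The Jacobian `∂g(x, θ)/∂θ'`. -/
def jac (x : 𝒳) (θ : Fin p → ℝ) : Matrix (Fin m) (Fin p) ℝ :=
  Matrix.of fun a c => pd c (fun θ' => g x θ' a) θ

/-- The ETEL moment functions. -/
def phiETEL (x : 𝒳) (β : Idx m p → ℝ) : Idx m p → ℝ :=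
  let t : ℝ := β iτ
  let k : Fin m → ℝ := fun a => β (iκ a)
  let l : Fin m → ℝ := fun a => β (iΛ a)
  let θ : Fin p → ℝ := fun c => β (iθ c)
  let gx : Fin m → ℝ := g x θ
  let Gx : Matrix (Fin m) (Fin p) ℝ := jac g x θ
  let td : ℝ := Real.exp (l ⬝ᵥ gx)
  mk (td - t) (td • gx) ((t - td) • gx + (td * (gx ⬝ᵥ k)) • gx)
    (td • (Gxᵀ *ᵥ k) + (td * (gx ⬝ᵥ k)) • (Gxᵀ *ᵥ l) - td • (Gxᵀ *ᵥ l) + t • (Gxᵀ *ᵥ l))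

/-- The augmented EL moment functions. -/
def phiEL (x : 𝒳) (β : Idx m p → ℝ) : Idx m p → ℝ :=
  let t : ℝ := β iτ
  let k : Fin m → ℝ := fun a => β (iκ a)
  let l : Fin m → ℝ := fun a => β (iΛ a)
  let θ : Fin p → ℝ := fun c => β (iθ c)
  let gx : Fin m → ℝ := g x θ
  let Gx : Matrix (Fin m) (Fin p) ℝ := jac g x θ
  let td : ℝ := Real.exp (l ⬝ᵥ gx)
  let ed : ℝ := (1 - k ⬝ᵥ gx)⁻¹
  mk (td - t) (td • gx) (ed • gx - td • gx) (ed • (Gxᵀ *ᵥ k))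

variable (μ : Measure Ω) (X : ℕ → Ω → 𝒳) (θs : Fin p → ℝ)

/-- `G = E[∂g(x_i, θ*)/∂θ']`. -/
def GMat : Matrix (Fin m) (Fin p) ℝ := Matrix.of fun a c => mean μ X fun x => jac g x θs a c

/-- `Ω = E[g(x_i, θ*) g(x_i, θ*)']`. -/
def OmegaMat : Matrix (Fin m) (Fin m) ℝ :=
  Matrix.of fun a c => mean μ X fun x => g x θs a * g x θs c

/-- `Σ = (G' Ω⁻¹ G)⁻¹`. -/
def SigmaMat : Matrix (Fin p) (Fin p) ℝ :=
  ((GMat g μ X θs)ᵀ * (OmegaMat g μ X θs)⁻¹ * GMat g μ X θs)⁻¹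

/-- `H = Σ G' Ω⁻¹`. -/
def HMat : Matrix (Fin p) (Fin m) ℝ :=
  SigmaMat g μ X θs * (GMat g μ X θs)ᵀ * (OmegaMat g μ X θs)⁻¹

/-- `P = Ω⁻¹ - Ω⁻¹ G Σ G' Ω⁻¹`. -/
def PMat : Matrix (Fin m) (Fin m) ℝ :=
  (OmegaMat g μ X θs)⁻¹ -
    (OmegaMat g μ X θs)⁻¹ * GMat g μ X θs * SigmaMat g μ X θs * (GMat g μ X θs)ᵀ *
      (OmegaMat g μ X θs)⁻¹

/-- `ḡ = n^{-1/2} ∑ g(x_i, θ*)`. -/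
def gBar (n : ℕ) (ω : Ω) : Fin m → ℝ := fun a => nsum X n (fun x => g x θs a) ω

end Moments

/-- The moment condition model: an i.i.d. sample with `E[g(x_i, θ*)] = 0`, nonsingular `Ω`, `G` of
full column rank, and `g(x, ·)` four times continuously differentiable on an open neighbourhood `N`
of `θ*`, with all derivatives of order at most four bounded by `b(x)`, where `E[b(x_i)^6] < ∞`. -/
structure IsRegularModel {Ω 𝒳 : Type*} [MeasurableSpace Ω] [MeasurableSpace 𝒳] {m p : ℕ}
    (μ : Measure Ω) (X : ℕ → Ω → 𝒳) (g : 𝒳 → (Fin p → ℝ) → Fin m → ℝ) (θs : Fin p → ℝ)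
    (N : Set (Fin p → ℝ)) (b : 𝒳 → ℝ) : Prop where
  measurable_X : ∀ i, Measurable (X i)
  indep : iIndepFun X μ
  ident : ∀ i, IdentDistrib (X i) (X 0) μ μ
  isOpen_N : IsOpen N
  mem_N : θs ∈ N
  measurable_g : ∀ θ ∈ N, Measurable fun x => g x θ
  smooth : ∀ x, ContDiffOn ℝ 4 (g x) N
  bound : ∀ x, ∀ θ ∈ N, ∀ j ≤ 4, ‖iteratedFDeriv ℝ j (g x) θ‖ ≤ b x
  moment_b : MemLp b 6 (μ.map (X 0))
  mean_zero : ∀ a, mean μ X (fun x => g x θs a) = 0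
  omega_nonsingular : IsUnit (OmegaMat g μ X θs)
  full_rank : (GMat g μ X θs).rank = p

end

end ETEL

open ETEL

set_option linter.unusedSectionVars false

namespace ETEL

/-! ### Partial derivatives and derivatives along lines -/

section PartialDerivatives

variable {ι : Type*} [Fintype ι] [DecidableEq ι] {F : (ι → ℝ) → ℝ} {z v : ι → ℝ}

/-! The expansion up to n^{-3/2} sees the moment functions only through their first three derivative
arrays at β*, contracted with Ψ̄ and Q̄. The proof compares these contractions rather than single
entries: the moment functions are restricted to lines through β*, differentiated as functions of one
variable (`HasJet`), and mixed contractions are recovered by polarization.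

The mean Jacobians of ETEL and EL coincide: the first derivatives differ only in the τ-derivative of
the λ-block, which is g for ETEL and 0 for EL, and E g = 0. Hence Ψ̄ is common to both; its τ-part
is zero and its κ- and λ-parts are both -Pḡ. In such a direction put u = κ'g = λ'g. The θ-blocks are
then G'κ times 1 + u e^u for ETEL and times (1 - u)⁻¹ for EL, and the λ-blocks are g times the same
factors minus e^u g. The two factors agree to second order and differ by -u³/2 + O(u⁴). So Q̄ is
common as well (`QBar_phiEL`), the centred second derivatives contribute nothing to the difference
of the R̄, and the third derivatives contribute a cubic form in Pḡ.

Q̄ leaves this class of directions: Q̄_τ = -½ ḡ'Pḡ and Q̄_λ - Q̄_κ = ½ Ω⁻¹ E[g (g'Pḡ)²]. The two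
contributions of Q̄_τ to the difference of the R̄_θ are ±½ Hḡ · ḡ'Pḡ and cancel, by HG = 1 and G'P =
0. What remains (`RBar_sub`) is a cubic polynomial in Pḡ with nonrandom coefficients. Since PΩH' =
0, Pg and Hg are uncorrelated. In the mean of a product of three normalized sums of Pg and one of Hg
every pairing therefore vanishes; only the n terms with four equal indices survive, and the mean is
O(n⁻¹) (`integral_mul_psiVec_of_mem_cubicSpan`).

For the variances, Ψ̄, Q̄ and R̄ are polynomials in centred normalized sums, of degree 1, 3 and 5
when degree counts powers of 1 + b (`polySpan`). Such polynomials have bounded means as soon as b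
has as many moments as the degree, so Cov(R̄, Ψ̄) needs six moments and Var(R̄) ten.

For the estimators, derivatives of order j are dominated by (1 + b)^{j+1} and the cubic Taylor
remainder by (1 + b)^5 ‖δ‖⁴ (`HasEnvelope`). The sample equation becomes a fixed-point equation for
δ = β̂ - β* (`fixedPoint_eq`), and substituting it into itself yields the expansion
(`hasOrder_four_of_fixedPoint`), uniformly on events of probability close to one. A mean-square
remainder o(n^{-3/2}) changes covariances by o(n⁻²) only, because the variance of the expansion is
O(n⁻¹). That the R̄ differ in general is seen in a four-point location model, where the cubic term
is explicit. -/

theorem pd_eq_fderiv (h : DifferentiableAt ℝ F z) (j : ι) :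
    pd j F z = fderiv ℝ F z (Pi.single j 1) :=
  h.lineDeriv_eq_fderiv

theorem fderiv_apply_eq_sum_pd (h : DifferentiableAt ℝ F z) (v : ι → ℝ) :
    fderiv ℝ F z v = ∑ j, v j * pd j F z := by
  rw [← ContinuousLinearMap.coe_coe, LinearMap.pi_apply_eq_sum_univ]
  refine Finset.sum_congr rfl fun j _ => ?_
  rw [pd_eq_fderiv h, smul_eq_mul]
  have : (fun i => if j = i then (1 : ℝ) else 0) = Pi.single j 1 := by
    ext i
    simp [Pi.single_apply, eq_comm]
  rw [this]
  rfl

theorem contDiffAt_pd {n : ℕ} (h : ContDiffAt ℝ ((n + 1 : ℕ) : WithTop ℕ∞) F z) (j : ι) :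
    ContDiffAt ℝ (n : WithTop ℕ∞) (pd j F) z := by
  have h1 : ContDiffAt ℝ (n : WithTop ℕ∞) (fun y => fderiv ℝ F y (Pi.single j 1)) z :=
    (h.fderiv_right (m := n) (by norm_cast)).clm_apply contDiffAt_const
  refine h1.congr_of_eventuallyEq ?_
  filter_upwards [h.eventually (by simp)] with y hy
  exact pd_eq_fderiv (hy.differentiableAt (by norm_cast)) j

theorem hasDerivAt_line {c v : ι → ℝ} {s : ℝ} (h : DifferentiableAt ℝ F (c + s • v)) :
    HasDerivAt (fun s : ℝ => F (c + s • v)) (∑ j, v j * pd j F (c + s • v)) s := by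
  rw [← fderiv_apply_eq_sum_pd h]
  have h1 : HasDerivAt (fun s : ℝ => c + s • v) v s := by
    simpa using ((hasDerivAt_id s).smul_const v).const_add c
  exact h.hasFDerivAt.comp_hasDerivAt s h1

theorem contDiff_line (c v : ι → ℝ) {n : WithTop ℕ∞} :
    ContDiff ℝ n (fun s : ℝ => c + s • v) := by fun_prop

theorem contDiffAt_comp_line {n : WithTop ℕ∞} {c v : ι → ℝ} {s : ℝ}
    (h : ContDiffAt ℝ n F (c + s • v)) : ContDiffAt ℝ n (fun s : ℝ => F (c + s • v)) s :=
  h.comp s (contDiff_line c v).contDiffAt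

/-- The bridge between one-variable derivatives along a line, in which everything is computed, and
the nested `pd` of the definitions. The identity for the first derivative must hold on a
neighbourhood of the base point before it can be differentiated again. -/
theorem iteratedDeriv_succ_line {n : ℕ} {c : ι → ℝ}
    (h : ContDiffAt ℝ ((n + 1 : ℕ) : WithTop ℕ∞) F c) (v : ι → ℝ) :
    iteratedDeriv (n + 1) (fun s : ℝ => F (c + s • v)) 0 =
      ∑ j, v j * iteratedDeriv n (fun s : ℝ => pd j F (c + s • v)) 0 := by
  have hc : Tendsto (fun s : ℝ => c + s • v) (𝓝 0) (𝓝 c) := by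
    have := (contDiff_line c v (n := 0)).continuous.tendsto 0
    simpa using this
  have h1 : deriv (fun s : ℝ => F (c + s • v)) =ᶠ[𝓝 0]
      fun s => ∑ j, v j * pd j F (c + s • v) := by
    filter_upwards [hc.eventually (h.eventually (by simp))] with s hs
    exact (hasDerivAt_line (hs.differentiableAt (by norm_cast))).deriv
  have h2 : ∀ j, ContDiffAt ℝ (n : WithTop ℕ∞) (fun s : ℝ => pd j F (c + s • v)) 0 := fun j =>
    contDiffAt_comp_line (by simpa using contDiffAt_pd h j)
  rw [iteratedDeriv_succ', h1.iteratedDeriv_eq n,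
    iteratedDeriv_fun_sum fun j _ => contDiffAt_const.mul (h2 j)]
  exact Finset.sum_congr rfl fun j _ => iteratedDeriv_const_mul _ (h2 j)

theorem iteratedDeriv_one_line {c : ι → ℝ} (h : ContDiffAt ℝ 1 F c) (v : ι → ℝ) :
    iteratedDeriv 1 (fun s : ℝ => F (c + s • v)) 0 = ∑ j, v j * pd j F c := by
  rw [iteratedDeriv_succ_line (n := 0) (by simpa using h)]
  simp

theorem iteratedDeriv_two_line {c : ι → ℝ} (h : ContDiffAt ℝ 2 F c) (v : ι → ℝ) :
    iteratedDeriv 2 (fun s : ℝ => F (c + s • v)) 0 =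
      ∑ j, ∑ k, v j * v k * pd j (pd k F) c := by
  rw [iteratedDeriv_succ_line (n := 1) (by exact_mod_cast h), Finset.sum_comm]
  refine Finset.sum_congr rfl fun k _ => ?_
  rw [iteratedDeriv_one_line (by exact_mod_cast contDiffAt_pd (n := 1) (by exact_mod_cast h) k),
    Finset.mul_sum]
  exact Finset.sum_congr rfl fun j _ => by ring

theorem iteratedDeriv_three_line {c : ι → ℝ} (h : ContDiffAt ℝ 3 F c) (v : ι → ℝ) :
    iteratedDeriv 3 (fun s : ℝ => F (c + s • v)) 0 =
      ∑ j, ∑ k, ∑ i, v j * v k * v i * pd j (pd k (pd i F)) c := by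
  have h' : ∀ i, ContDiffAt ℝ 2 (pd i F) c := fun i => by
    exact_mod_cast contDiffAt_pd (n := 2) (by exact_mod_cast h) i
  rw [iteratedDeriv_succ_line (n := 2) (by exact_mod_cast h)]
  simp_rw [iteratedDeriv_two_line (h' _), Finset.mul_sum]
  rw [Finset.sum_comm]
  refine Finset.sum_congr rfl fun j _ => ?_
  rw [Finset.sum_comm]
  exact Finset.sum_congr rfl fun k _ => Finset.sum_congr rfl fun i _ => by ring

/-- Nested line derivatives are symmetric because they are values of the second Fréchet derivative.
Polarization relies on this symmetry. -/
theorem pd_comm (h : ContDiffAt ℝ 2 F z) (j k : ι) : pd j (pd k F) z = pd k (pd j F) z := by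
  have hsym : IsSymmSndFDerivAt ℝ F z := h.isSymmSndFDerivAt (by simp)
  have hd : DifferentiableAt ℝ (fderiv ℝ F) z :=
    (h.fderiv_right (m := 1) (by norm_num)).differentiableAt (by norm_num)
  have key : ∀ j k : ι, pd j (pd k F) z =
      fderiv ℝ (fderiv ℝ F) z (Pi.single j 1) (Pi.single k 1) := fun j k => by
    have h1 : pd k F =ᶠ[𝓝 z] fun y => fderiv ℝ F y (Pi.single k 1) := by
      filter_upwards [h.eventually (by simp)] with y hy
      exact pd_eq_fderiv (hy.differentiableAt (by norm_num)) k
    have h2 : DifferentiableAt ℝ (fun y => fderiv ℝ F y (Pi.single k 1)) z :=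
      hd.clm_apply (differentiableAt_const _)
    rw [pd_eq_fderiv (h2.congr_of_eventuallyEq h1), h1.fderiv_eq,
      fderiv_clm_apply hd (differentiableAt_const _)]
    simp
  rw [key, key]
  exact hsym _ _

theorem pd_comm_left (h : ContDiffAt ℝ 3 F z) (j k i : ι) :
    pd j (pd k (pd i F)) z = pd k (pd j (pd i F)) z :=
  pd_comm (by exact_mod_cast contDiffAt_pd (n := 2) (by exact_mod_cast h) i) j k

theorem pd_comm_right (h : ContDiffAt ℝ 3 F z) (j k i : ι) :
    pd j (pd k (pd i F)) z = pd j (pd i (pd k F)) z := by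
  -- The swap takes place under the outer derivative, so it is needed at all nearby points, not only
  -- at `z`.
  have h1 : pd k (pd i F) =ᶠ[𝓝 z] pd i (pd k F) := by
    filter_upwards [h.eventually (by simp)] with y hy
    exact pd_comm (hy.of_le (by norm_num)) k i
  exact h1.lineDeriv_eq

end PartialDerivatives

/-! ### Polarization -/

section Polarization

variable {ι : Type*} [Fintype ι] [DecidableEq ι]

/-- The quadratic form of a two-index array. -/
def quadForm (A : ι → ι → ℝ) (v : ι → ℝ) : ℝ := ∑ j, ∑ k, v j * v k * A j k

/-- The cubic form of a three-index array. -/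
def cubicForm (A : ι → ι → ι → ℝ) (v : ι → ℝ) : ℝ := ∑ j, ∑ k, ∑ h, v j * v k * v h * A j k h

/-- Derivatives along lines give only the diagonal values of a form. This recovers the contraction
of second derivatives with the two different vectors Q̄ and Ψ̄ in R̄. -/
theorem sum_sum_mul_mul_eq_polar {A : ι → ι → ℝ} (hA : ∀ j k, A j k = A k j) (v w : ι → ℝ) :
    ∑ j, ∑ k, v j * w k * A j k =
      1 / 2 * (quadForm A (v + w) - quadForm A v - quadForm A w) := by
  have h : ∑ j, ∑ k, v j * w k * A j k = ∑ j, ∑ k, w j * v k * A j k := by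
    rw [Finset.sum_comm]
    exact Finset.sum_congr rfl fun j _ => Finset.sum_congr rfl fun k _ => by
      rw [hA k j]; ring
  have h2 : quadForm A (v + w) = quadForm A v + (∑ j, ∑ k, v j * w k * A j k)
      + (∑ j, ∑ k, w j * v k * A j k) + quadForm A w := by
    simp only [quadForm, ← Finset.sum_add_distrib, Pi.add_apply]
    exact Finset.sum_congr rfl fun j _ => Finset.sum_congr rfl fun k _ => by ring
  rw [h2, ← h]; ring

theorem entry_eq_polar_quadForm {A : ι → ι → ℝ} (hA : ∀ j k, A j k = A k j) (j k : ι) :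
    A j k = 1 / 2 * (quadForm A (Pi.single j 1 + Pi.single k 1) - quadForm A (Pi.single j 1)
      - quadForm A (Pi.single k 1)) := by
  rw [← sum_sum_mul_mul_eq_polar hA]
  simp [Pi.single_apply]

/-- Inclusion–exclusion over the three directions. It transfers measurability and envelopes from
cubic forms along lines to single third partial derivatives. -/
theorem entry_eq_polar_cubicForm {A : ι → ι → ι → ℝ} (h₁ : ∀ j k h, A j k h = A k j h)
    (h₂ : ∀ j k h, A j k h = A j h k) (j k h : ι) :
    A j k h = 1 / 6 * (cubicForm A (Pi.single j 1 + Pi.single k 1 + Pi.single h 1)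
      - cubicForm A (Pi.single j 1 + Pi.single k 1)
      - cubicForm A (Pi.single j 1 + Pi.single h 1)
      - cubicForm A (Pi.single k 1 + Pi.single h 1)
      + cubicForm A (Pi.single j 1) + cubicForm A (Pi.single k 1)
      + cubicForm A (Pi.single h 1)) := by
  simp only [cubicForm, Pi.add_apply, Pi.single_apply, add_mul, mul_add, Finset.sum_add_distrib,
    ite_mul, mul_ite, one_mul, zero_mul, mul_one, mul_zero,
    Finset.sum_ite_eq', Finset.mem_univ, if_true]
  have e1 : A j h k = A j k h := (h₂ _ _ _).symm
  have e2 : A k j h = A j k h := (h₁ _ _ _).symm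
  have e3 : A k h j = A j k h := by rw [h₂, e2]
  have e4 : A h j k = A j k h := by rw [h₁, e1]
  have e5 : A h k j = A j k h := by rw [h₂, e4]
  rw [e1, e2, e3, e4, e5]
  ring

theorem quadForm_smul (A : ι → ι → ℝ) (c : ℝ) (v : ι → ℝ) :
    quadForm A (c • v) = c ^ 2 * quadForm A v := by
  simp only [quadForm, Finset.mul_sum, Pi.smul_apply, smul_eq_mul]
  exact Finset.sum_congr rfl fun j _ => Finset.sum_congr rfl fun k _ => by ring

theorem cubicForm_smul (A : ι → ι → ι → ℝ) (c : ℝ) (v : ι → ℝ) :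
    cubicForm A (c • v) = c ^ 3 * cubicForm A v := by
  simp only [cubicForm, Finset.mul_sum, Pi.smul_apply, smul_eq_mul]
  exact Finset.sum_congr rfl fun j _ => Finset.sum_congr rfl fun k _ =>
    Finset.sum_congr rfl fun h _ => by ring

end Polarization

/-! ### Taylor expansion and composition bounds in one variable -/

/-- Lagrange's remainder is taken one order lower, so three derivatives suffice: the remainder is
one sixth of the oscillation of the third derivative, which also covers functions without a fourth
derivative. -/
theorem taylor_three_remainder_le {h : ℝ → ℝ} {K : ℝ}
    (hh : ∀ s ∈ Set.Icc (0 : ℝ) 1, ContDiffAt ℝ 3 h s)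
    (hK : ∀ s ∈ Set.Icc (0 : ℝ) 1, |iteratedDeriv 3 h s - iteratedDeriv 3 h 0| ≤ K) :
    |h 1 - (h 0 + iteratedDeriv 1 h 0 + 1 / 2 * iteratedDeriv 2 h 0
      + 1 / 6 * iteratedDeriv 3 h 0)| ≤ K := by
  have h01 : Set.uIcc (0 : ℝ) 1 = Set.Icc 0 1 := Set.uIcc_of_le zero_le_one
  have hcd : ContDiffOn ℝ ((2 : ℕ) + 1 : WithTop ℕ∞) h (Set.uIcc 0 1) := by
    rw [h01]; intro s hs
    have := (hh s hs).contDiffWithinAt (s := Set.Icc (0 : ℝ) 1)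
    exact_mod_cast this
  obtain ⟨ξ, hξ, e⟩ := taylor_mean_remainder_lagrange_iteratedDeriv (n := 2) zero_ne_one hcd
  rw [h01, taylor_within_apply] at e
  have h0 : (0 : ℝ) ∈ Set.Icc (0 : ℝ) 1 := by simp
  have hit : ∀ k ≤ 3, iteratedDerivWithin k h (Set.Icc 0 1) 0 = iteratedDeriv k h 0 := fun k hk =>
    iteratedDerivWithin_eq_iteratedDeriv (uniqueDiffOn_Icc zero_lt_one)
      ((hh 0 h0).of_le (by exact_mod_cast hk)) h0
  simp only [Finset.sum_range_succ, Finset.sum_range_zero, hit 0 (by norm_num),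
    hit 1 (by norm_num), hit 2 (by norm_num)] at e
  have hξ' : ξ ∈ Set.Icc (0 : ℝ) 1 := by
    rw [Set.uIoo_of_le zero_le_one] at hξ; exact ⟨hξ.1.le, hξ.2.le⟩
  have hK' := hK ξ hξ'
  norm_num [Nat.factorial] at e
  have e2 : h 1 - (h 0 + iteratedDeriv 1 h 0 + 1 / 2 * iteratedDeriv 2 h 0
      + 1 / 6 * iteratedDeriv 3 h 0) = 1 / 6 * (iteratedDeriv 3 h ξ - iteratedDeriv 3 h 0) := by
    rw [iteratedDeriv_one]
    linarith
  rw [e2, abs_mul]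
  have : |(1 / 6 : ℝ)| = 1 / 6 := by norm_num
  rw [this]
  have := abs_nonneg (iteratedDeriv 3 h ξ - iteratedDeriv 3 h 0)
  linarith

/-- A pointwise version of the bound on the iterated derivatives of a composition. -/
theorem norm_iteratedFDeriv_comp_le_of_contDiffAt {E F G : Type*} [NormedAddCommGroup E]
    [NormedSpace ℝ E] [NormedAddCommGroup F] [NormedSpace ℝ F] [NormedAddCommGroup G]
    [NormedSpace ℝ G] {g : F → G} {f : E → F} {n : ℕ} {x : E}
    (hg : ContDiffAt ℝ n g (f x)) (hf : ContDiffAt ℝ n f x) {C D : ℝ}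
    (hC : ∀ i ≤ n, ‖iteratedFDeriv ℝ i g (f x)‖ ≤ C)
    (hD : ∀ i, 1 ≤ i → i ≤ n → ‖iteratedFDeriv ℝ i f x‖ ≤ D ^ i) :
    ‖iteratedFDeriv ℝ n (fun y => g (f y)) x‖ ≤ n.factorial * C * D ^ n := by
  obtain ⟨t, ht, htx, hgt⟩ := hg.eventually (by simp) |>.exists_mem |>.imp fun t h =>
    (⟨h.1, mem_of_mem_nhds h.1, h.2⟩ : t ∈ 𝓝 (f x) ∧ f x ∈ t ∧ ∀ y ∈ t, ContDiffAt ℝ n g y)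
  have hev : ∀ᶠ y in 𝓝 x, ContDiffAt ℝ n f y ∧ f y ∈ interior t :=
    (hf.eventually (by simp)).and
      (hf.continuousAt.eventually (isOpen_interior.mem_nhds (mem_interior_iff_mem_nhds.2 ht)))
  obtain ⟨s, hs, hso, hxs⟩ := eventually_nhds_iff.1 hev
  have key := norm_iteratedFDerivWithin_comp_le (𝕜 := ℝ) (n := n) (N := n) (g := g) (f := f)
    (t := interior t) (s := s) (x := x) (C := C) (D := D)
    (fun y hy => (hgt y (interior_subset hy)).contDiffWithinAt)
    (fun y hy => (hs y hy).1.contDiffWithinAt) le_rfl isOpen_interior.uniqueDiffOn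
    hso.uniqueDiffOn (fun y hy => (hs y hy).2) hxs
    (fun i hi => by
      rw [iteratedFDerivWithin_of_isOpen i isOpen_interior (hs x hxs).2]; exact hC i hi)
    (fun i h1 hi => by rw [iteratedFDerivWithin_of_isOpen i hso hxs]; exact hD i h1 hi)
  rwa [iteratedFDerivWithin_of_isOpen n hso hxs] at key

end ETEL

namespace ETEL

/-! ### Families of functions on `[0, 1]` with weighted derivative bounds -/

/-- The functions `f p`, `p ∈ E`, are `k` times continuously differentiable at the points of
`[0, 1]`, and their derivatives of order `j ≤ k` are bounded by a multiple of `A p * D p ^ j`. -/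
def WBound {α : Type*} (E : Set α) (D : α → ℝ) (k : ℕ) (A : α → ℝ) (f : α → ℝ → ℝ) : Prop :=
  ∃ C : ℝ, 0 ≤ C ∧ ∀ p ∈ E, ∀ s ∈ Set.Icc (0 : ℝ) 1, ContDiffAt ℝ k (f p) s ∧
    ∀ j ≤ k, |iteratedDeriv j (f p) s| ≤ C * A p * D p ^ j

namespace WBound

variable {α : Type*} {E : Set α} {D A A' : α → ℝ} {k : ℕ} {f f' : α → ℝ → ℝ}

theorem congr (h : WBound E D k A f) (he : f = f') : WBound E D k A f' := he ▸ h

theorem of_le {k' : ℕ} (h : WBound E D k A f) (hk : k' ≤ k) : WBound E D k' A f := by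
  obtain ⟨C, hC, H⟩ := h
  exact ⟨C, hC, fun p hp s hs => ⟨(H p hp s hs).1.of_le (by exact_mod_cast hk),
    fun j hj => (H p hp s hs).2 j (hj.trans hk)⟩⟩

theorem weaken (h : WBound E D k A f) (hD : ∀ p ∈ E, 0 ≤ D p) (hA : ∀ p ∈ E, A p ≤ A' p) :
    WBound E D k A' f := by
  obtain ⟨C, hC, H⟩ := h
  refine ⟨C, hC, fun p hp s hs => ⟨(H p hp s hs).1, fun j hj => ((H p hp s hs).2 j hj).trans ?_⟩⟩
  have := hD p hp
  have := hA p hp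
  gcongr

theorem add (hf : WBound E D k A f) (hf' : WBound E D k A f') :
    WBound E D k A (fun p s => f p s + f' p s) := by
  obtain ⟨C, hC, H⟩ := hf
  obtain ⟨C', hC', H'⟩ := hf'
  refine ⟨C + C', by positivity, fun p hp s hs => ⟨(H p hp s hs).1.add (H' p hp s hs).1,
    fun j hj => ?_⟩⟩
  rw [iteratedDeriv_fun_add ((H p hp s hs).1.of_le (by exact_mod_cast hj))
    ((H' p hp s hs).1.of_le (by exact_mod_cast hj))]
  calc _ ≤ _ := abs_add_le _ _
    _ ≤ _ := add_le_add ((H p hp s hs).2 j hj) ((H' p hp s hs).2 j hj)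
    _ = _ := by ring

theorem neg (hf : WBound E D k A f) : WBound E D k A (fun p s => -f p s) := by
  obtain ⟨C, hC, H⟩ := hf
  refine ⟨C, hC, fun p hp s hs => ⟨(H p hp s hs).1.neg, fun j hj => ?_⟩⟩
  rw [iteratedDeriv_fun_neg, abs_neg]
  exact (H p hp s hs).2 j hj

theorem sub (hf : WBound E D k A f) (hf' : WBound E D k A f') :
    WBound E D k A (fun p s => f p s - f' p s) :=
  (hf.add hf'.neg).congr (by simp only [sub_eq_add_neg])

theorem const {c : α → ℝ} (hc : ∀ p ∈ E, |c p| ≤ A p) (hD : ∀ p ∈ E, 0 ≤ D p) :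
    WBound E D k A (fun p _ => c p) := by
  refine ⟨1, zero_le_one, fun p hp s _ => ⟨contDiffAt_const, fun j _ => ?_⟩⟩
  have hA : 0 ≤ A p := (abs_nonneg _).trans (hc p hp)
  have := hD p hp
  rcases j with _ | j
  · simpa using hc p hp
  · rw [iteratedDeriv_const]
    simp only [Nat.add_eq_zero_iff, one_ne_zero, and_false, if_false, abs_zero]
    positivity

theorem sum {ι : Type*} {t : Finset ι} {F : ι → α → ℝ → ℝ} (hA : ∀ p ∈ E, 0 ≤ A p)
    (hD : ∀ p ∈ E, 0 ≤ D p) (h : ∀ i ∈ t, WBound E D k A (F i)) :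
    WBound E D k A (fun p s => ∑ i ∈ t, F i p s) := by
  classical
  induction t using Finset.induction_on with
  | empty => simpa using const (c := fun _ => 0) (by simpa using hA) hD
  | insert i t hi ih =>
    simp only [Finset.sum_insert hi]
    exact (h i (Finset.mem_insert_self i t)).add
      (ih fun j hj => h j (Finset.mem_insert_of_mem hj))

theorem mul (hf : WBound E D k A f) (hf' : WBound E D k A' f') :
    WBound E D k (fun p => A p * A' p) (fun p s => f p s * f' p s) := by
  obtain ⟨C, hC, H⟩ := hf
  obtain ⟨C', hC', H'⟩ := hf'
  refine ⟨C * C' * 2 ^ k, by positivity, fun p hp s hs =>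
    ⟨(H p hp s hs).1.mul (H' p hp s hs).1, fun j hj => ?_⟩⟩
  rw [iteratedDeriv_fun_mul ((H p hp s hs).1.of_le (by exact_mod_cast hj))
    ((H' p hp s hs).1.of_le (by exact_mod_cast hj))]
  have h0 : 0 ≤ C * A p := by
    have := (abs_nonneg _).trans ((H p hp s hs).2 0 (Nat.zero_le k)); simpa using this
  have h0' : 0 ≤ C' * A' p := by
    have := (abs_nonneg _).trans ((H' p hp s hs).2 0 (Nat.zero_le k)); simpa using this
  by_cases hj0 : j = 0
  · subst hj0
    have a1 := (H p hp s hs).2 0 (Nat.zero_le k)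
    have a2 := (H' p hp s hs).2 0 (Nat.zero_le k)
    simp only [iteratedDeriv_zero, pow_zero, mul_one] at a1 a2
    have h2 : (1 : ℝ) ≤ 2 ^ k := one_le_pow₀ (by norm_num)
    simp only [zero_add, Finset.sum_range_one, Nat.choose_self, Nat.cast_one, one_mul,
      iteratedDeriv_zero, pow_zero, mul_one, Nat.sub_self, abs_mul]
    calc |f p s| * |f' p s| ≤ (C * A p) * (C' * A' p) := by gcongr
      _ ≤ (C * A p) * (C' * A' p) * 2 ^ k := le_mul_of_one_le_right (by positivity) h2
      _ = _ := by ring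
  have term : ∀ i ∈ Finset.range (j + 1),
      |(j.choose i : ℝ) * iteratedDeriv i (f p) s * iteratedDeriv (j - i) (f' p) s| ≤
        (j.choose i : ℝ) * ((C * A p) * (C' * A' p) * D p ^ j) := fun i hi => by
    have hij : i ≤ j := Nat.lt_succ_iff.1 (Finset.mem_range.1 hi)
    have a1 := (H p hp s hs).2 i (hij.trans hj)
    have a2 := (H' p hp s hs).2 (j - i) ((Nat.sub_le j i).trans hj)
    rw [abs_mul, abs_mul, Nat.abs_cast, mul_assoc]
    refine mul_le_mul_of_nonneg_left ?_ (Nat.cast_nonneg _)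
    calc _ ≤ (C * A p * D p ^ i) * (C' * A' p * D p ^ (j - i)) :=
          mul_le_mul a1 a2 (abs_nonneg _) ((abs_nonneg _).trans a1)
      _ = (C * A p) * (C' * A' p) * (D p ^ i * D p ^ (j - i)) := by ring
      _ = _ := by rw [← pow_add, Nat.add_sub_cancel' hij]
  have hDj : 0 ≤ (C * A p) * (C' * A' p) * D p ^ j := by
    have a1 := (abs_nonneg _).trans ((H p hp s hs).2 j hj)
    calc (0 : ℝ) ≤ (C * A p * D p ^ j) * (C' * A' p) := mul_nonneg a1 h0'
      _ = _ := by ring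
  calc _ ≤ ∑ i ∈ Finset.range (j + 1), (j.choose i : ℝ) * ((C * A p) * (C' * A' p) * D p ^ j) :=
        (Finset.abs_sum_le_sum_abs _ _).trans (Finset.sum_le_sum term)
    _ = (2 : ℝ) ^ j * ((C * A p) * (C' * A' p) * D p ^ j) := by
        rw [← Finset.sum_mul]
        congr 1
        exact_mod_cast Nat.sum_range_choose j
    _ ≤ (2 : ℝ) ^ k * ((C * A p) * (C' * A' p) * D p ^ j) := by
        gcongr
        · norm_num
    _ = _ := by ring

/-- The value is at most A·D ≤ A, the first derivative is the constant A·D itself, and higher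
derivatives vanish; this is where scales `D` at most one are used. -/
theorem id_mul {c : α → ℝ} (hc : ∀ p ∈ E, |c p| ≤ A p * D p) (hD : ∀ p ∈ E, 0 ≤ D p)
    (hD1 : ∀ p ∈ E, D p ≤ 1) (hA : ∀ p ∈ E, 0 ≤ A p) :
    WBound E D k A (fun p s => s * c p) := by
  refine ⟨1, zero_le_one, fun p hp s hs => ⟨by fun_prop, fun j _ => ?_⟩⟩
  have h1 := hD p hp
  have h2 := hA p hp
  rcases j with _ | _ | j
  · simp only [iteratedDeriv_zero, pow_zero, mul_one, one_mul, abs_mul]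
    calc |s| * |c p| ≤ 1 * (A p * D p) := by
          refine mul_le_mul ?_ (hc p hp) (abs_nonneg _) zero_le_one
          rw [abs_of_nonneg hs.1]; exact hs.2
      _ ≤ A p := by nlinarith [hD1 p hp]
  · have : deriv (fun s : ℝ => s * c p) s = c p := by simp
    simpa [iteratedDeriv_one, this] using hc p hp
  · have : deriv (fun s : ℝ => s * c p) = fun _ => c p := by ext; simp
    rw [iteratedDeriv_succ', this, iteratedDeriv_const]
    simp only [Nat.add_eq_zero_iff, one_ne_zero, and_false, if_false, abs_zero]
    positivity

theorem comp {F : ℝ → ℝ} (hF : ∀ u ∈ Set.Icc (-1 / 2 : ℝ) (1 / 2), ContDiffAt ℝ k F u)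
    (hf : WBound E D k (fun _ => 1) f) (hD : ∀ p ∈ E, 0 ≤ D p)
    (hb : ∀ p ∈ E, ∀ s ∈ Set.Icc (0 : ℝ) 1, f p s ∈ Set.Icc (-1 / 2 : ℝ) (1 / 2)) :
    WBound E D k (fun _ => 1) (fun p s => F (f p s)) := by
  obtain ⟨C, hC, H⟩ := hf
  have hK : ∀ i : ℕ, ∃ K : ℝ, i ≤ k → ∀ u ∈ Set.Icc (-1 / 2 : ℝ) (1 / 2),
      ‖iteratedFDeriv ℝ i F u‖ ≤ K := fun i => by
    by_cases hi : i ≤ k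
    · have hcont : ContinuousOn (iteratedFDeriv ℝ i F) (Set.Icc (-1 / 2 : ℝ) (1 / 2)) :=
        fun u hu => by
          have h1 : ContDiffAt ℝ 0 (iteratedFDeriv ℝ i F) u :=
            (hF u hu).iteratedFDeriv_right (by rw [zero_add]; exact_mod_cast hi)
          exact h1.continuousAt.continuousWithinAt
      obtain ⟨K, hK⟩ := isCompact_Icc.exists_bound_of_continuousOn hcont
      exact ⟨K, fun _ => hK⟩
    · exact ⟨0, fun h => absurd h hi⟩
  choose K hK using hK
  set K' : ℝ := ∑ i ∈ Finset.range (k + 1), |K i| with hK'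
  have hKK : ∀ i ≤ k, ∀ u ∈ Set.Icc (-1 / 2 : ℝ) (1 / 2), ‖iteratedFDeriv ℝ i F u‖ ≤ K' :=
    fun i hi u hu => ((hK i hi u hu).trans (le_abs_self _)).trans
      (Finset.single_le_sum (f := fun i => |K i|) (fun _ _ => abs_nonneg _)
        (Finset.mem_range.2 (Nat.lt_succ_of_le hi)))
  have hK'0 : 0 ≤ K' := Finset.sum_nonneg fun _ _ => abs_nonneg _
  -- With `M ≥ 1` one has `C ≤ M ^ i` for `i ≥ 1`, so the inner bounds take the geometric form `(M *
  -- D p) ^ i` required by the composition estimate.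
  set M := max C 1 with hM
  have hM1 : 1 ≤ M := le_max_right _ _
  refine ⟨k.factorial * K' * M ^ k, by positivity, fun p hp s hs =>
    ⟨(hF _ (hb p hp s hs)).comp s (H p hp s hs).1, fun j hj => ?_⟩⟩
  have hDp := hD p hp
  have key := norm_iteratedFDeriv_comp_le_of_contDiffAt (n := j) (g := F) (f := f p) (x := s)
    (C := K') (D := M * D p)
    ((hF _ (hb p hp s hs)).of_le (by exact_mod_cast hj))
    ((H p hp s hs).1.of_le (by exact_mod_cast hj))
    (fun i hi => hKK i (hi.trans hj) _ (hb p hp s hs))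
    (fun i h1 hi => by
      rw [norm_iteratedFDeriv_eq_norm_iteratedDeriv, Real.norm_eq_abs]
      refine ((H p hp s hs).2 i (hi.trans hj)).trans ?_
      rw [mul_one, mul_pow]
      refine mul_le_mul_of_nonneg_right ?_ (by positivity)
      exact (le_max_left C 1).trans (le_self_pow₀ hM1 (by omega)))
  rw [norm_iteratedFDeriv_eq_norm_iteratedDeriv, Real.norm_eq_abs] at key
  refine key.trans ?_
  rw [mul_pow, mul_one, ← mul_assoc]
  have e1 : (j.factorial : ℝ) ≤ k.factorial := by exact_mod_cast Nat.factorial_le hj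
  have e2 : M ^ j ≤ M ^ k := pow_le_pow_right₀ hM1 hj
  gcongr

theorem iteratedDeriv_sub_le (h : WBound E D (k + 1) A f) :
    ∃ C : ℝ, 0 ≤ C ∧ ∀ p ∈ E, ∀ s ∈ Set.Icc (0 : ℝ) 1,
      |iteratedDeriv k (f p) s - iteratedDeriv k (f p) 0| ≤ C * A p * D p ^ (k + 1) := by
  obtain ⟨C, hC, H⟩ := h
  refine ⟨C, hC, fun p hp s hs => ?_⟩
  have hdiff : ∀ u ∈ Set.Icc (0 : ℝ) 1, DifferentiableAt ℝ (iteratedDeriv k (f p)) u :=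
    fun u hu => by
      have h1 : ContDiffAt ℝ 1 (iteratedFDeriv ℝ k (f p)) u :=
        (H p hp u hu).1.iteratedFDeriv_right (by rw [add_comm]; norm_cast)
      rw [iteratedDeriv_eq_equiv_comp]
      exact (LinearIsometryEquiv.differentiableAt _).comp u (h1.differentiableAt one_ne_zero)
  have key := (convex_Icc (0 : ℝ) 1).norm_image_sub_le_of_norm_deriv_le (x := 0) (y := s)
    (C := C * A p * D p ^ (k + 1)) hdiff
    (fun u hu => by
      rw [← iteratedDeriv_succ]; exact (H p hp u hu).2 (k + 1) le_rfl)
    (by simp) hs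
  rw [Real.norm_eq_abs] at key
  refine key.trans ?_
  have h0 : 0 ≤ C * A p * D p ^ (k + 1) :=
    (abs_nonneg _).trans ((H p hp s hs).2 (k + 1) le_rfl)
  rw [sub_zero, Real.norm_eq_abs, abs_of_nonneg hs.1]
  exact mul_le_of_le_one_right h0 hs.2

theorem taylor_three (h : WBound E D 4 A f) :
    ∃ C : ℝ, 0 ≤ C ∧ ∀ p ∈ E, |f p 1 - (f p 0 + iteratedDeriv 1 (f p) 0
      + 1 / 2 * iteratedDeriv 2 (f p) 0 + 1 / 6 * iteratedDeriv 3 (f p) 0)| ≤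
        C * A p * D p ^ 4 := by
  obtain ⟨C, hC, H⟩ := h.iteratedDeriv_sub_le
  obtain ⟨_, _, H'⟩ := h
  exact ⟨C, hC, fun p hp => taylor_three_remainder_le
    (fun s hs => (H' p hp s hs).1.of_le (by norm_num)) (H p hp)⟩

/-- A factor s makes up for a missing fourth derivative: the third derivative of s f(s) is s f''' +
3 f'', so its oscillation is bounded by f''' alone, which bounds the oscillation of f'' too. This
serves the θ-block, which contains the Jacobian of g and hence has only three derivatives at hand.
-/
theorem taylor_three_id_mul (h : WBound E D 3 A f) :
    ∃ C : ℝ, 0 ≤ C ∧ ∀ p ∈ E, |1 * f p 1 - (0 * f p 0 + iteratedDeriv 1 (fun s => s * f p s) 0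
      + 1 / 2 * iteratedDeriv 2 (fun s => s * f p s) 0
      + 1 / 6 * iteratedDeriv 3 (fun s => s * f p s) 0)| ≤ C * A p * D p ^ 3 := by
  obtain ⟨C, hC, H⟩ := h.iteratedDeriv_sub_le
  obtain ⟨C', hC', H'⟩ := h
  refine ⟨3 * C + C', by positivity, fun p hp => taylor_three_remainder_le
    (h := fun s => s * f p s)
    (fun s hs => contDiffAt_id.mul (H' p hp s hs).1) fun s hs => ?_⟩
  have e : ∀ s ∈ Set.Icc (0 : ℝ) 1, iteratedDeriv 3 (fun s => s * f p s) s =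
      s * iteratedDeriv 3 (f p) s + 3 * iteratedDeriv 2 (f p) s := fun s hs => by
    rw [iteratedDeriv_fun_mul (f := fun s => s) contDiffAt_id (H' p hp s hs).1]
    have i1 : iteratedDeriv 1 (fun s : ℝ => s) = fun _ => 1 := by
      rw [iteratedDeriv_one]; ext; simp
    have i2 : iteratedDeriv 2 (fun s : ℝ => s) = fun _ => 0 := by
      rw [iteratedDeriv_succ, i1]; ext; simp
    have i3 : iteratedDeriv 3 (fun s : ℝ => s) = fun _ => 0 := by
      rw [iteratedDeriv_succ, i2]; ext; simp
    simp [Finset.sum_range_succ, i1, i2, i3]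
  rw [e s hs, e 0 (by simp)]
  have a1 := H p hp s hs
  have a2 := (H' p hp s hs).2 3 le_rfl
  have a3 : |s * iteratedDeriv 3 (f p) s| ≤ C' * A p * D p ^ 3 := by
    rw [abs_mul, abs_of_nonneg hs.1]
    exact (mul_le_of_le_one_left (abs_nonneg _) hs.2).trans a2
  calc _ = |s * iteratedDeriv 3 (f p) s
        + 3 * (iteratedDeriv 2 (f p) s - iteratedDeriv 2 (f p) 0)| := by
        congr 1; ring
    _ ≤ C' * A p * D p ^ 3 + 3 * (C * A p * D p ^ (2 + 1)) := by
        refine (abs_add_le _ _).trans (add_le_add a3 ?_)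
        rw [abs_mul, abs_of_pos (by norm_num : (0 : ℝ) < 3)]
        gcongr
    _ = _ := by ring

end WBound

end ETEL

namespace ETEL

/-! ### The moment functions along lines through the true value -/

theorem abs_iteratedDeriv_line_le {ι : Type*} [Fintype ι] {F : (ι → ℝ) → ℝ} {c v : ι → ℝ}
    {s B : ℝ} {j : ℕ} (hF : ContDiffAt ℝ j F (c + s • v))
    (hB : ∀ i ≤ j, ‖iteratedFDeriv ℝ i F (c + s • v)‖ ≤ B) :
    |iteratedDeriv j (fun s : ℝ => F (c + s • v)) s| ≤ j.factorial * B * ‖v‖ ^ j := by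
  have hl : ∀ i, 1 ≤ i → ‖iteratedFDeriv ℝ i (fun s : ℝ => c + s • v) s‖ ≤ ‖v‖ ^ i := fun i hi => by
    have hd : deriv (fun s : ℝ => c + s • v) = fun _ => v := by
      ext1 s
      have : HasDerivAt (fun s : ℝ => c + s • v) v s := by
        simpa using ((hasDerivAt_id s).smul_const v).const_add c
      exact this.deriv
    rw [norm_iteratedFDeriv_eq_norm_iteratedDeriv]
    obtain ⟨i, rfl⟩ := Nat.exists_eq_add_of_le' hi
    rw [iteratedDeriv_succ', hd, iteratedDeriv_const]
    split_ifs with h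
    · simp [h]
    · simp only [norm_zero]; positivity
  have key := norm_iteratedFDeriv_comp_le_of_contDiffAt (n := j) (g := F)
    (f := fun s : ℝ => c + s • v) (x := s) (C := B) (D := ‖v‖) hF
    (by fun_prop) hB (fun i h1 _ => hl i h1)
  rwa [norm_iteratedFDeriv_eq_norm_iteratedDeriv, Real.norm_eq_abs] at key

section Lines

variable {Ω 𝒳 : Type*} [MeasurableSpace Ω] [MeasurableSpace 𝒳] {m p : ℕ} {μ : Measure Ω}
  {X : ℕ → Ω → 𝒳} {g : 𝒳 → (Fin p → ℝ) → Fin m → ℝ} {θs : Fin p → ℝ} {N : Set (Fin p → ℝ)}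
  {b : 𝒳 → ℝ}

/-- The `θ`-coordinates of `β`. -/
def thetaPart {m p : ℕ} (β : Idx m p → ℝ) : Fin p → ℝ := fun c => β (iθ c)

theorem norm_thetaPart_le (δ : Idx m p → ℝ) : ‖thetaPart δ‖ ≤ ‖δ‖ :=
  (pi_norm_le_iff_of_nonneg (norm_nonneg _)).2 fun c => norm_le_pi_norm δ (iθ c)

/-- Directions along which the moment functions are controlled by the envelope `b`. -/
def goodLines (m p : ℕ) (b : 𝒳 → ℝ) (r : ℝ) : Set (𝒳 × (Idx m p → ℝ)) :=
  {q | ‖q.2‖ ≤ r ∧ 2 * (m + 1) * ((1 + b q.1) * ‖q.2‖) ≤ 1}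

/-- The scale of a direction. -/
def lineScale (b : 𝒳 → ℝ) (q : 𝒳 × (Idx m p → ℝ)) : ℝ := (1 + b q.1) * ‖q.2‖

namespace IsRegularModel

theorem b_nonneg (hM : IsRegularModel μ X g θs N b) (x : 𝒳) : 0 ≤ b x :=
  (norm_nonneg _).trans (hM.bound x θs hM.mem_N 0 (by norm_num))

theorem contDiffAt (hM : IsRegularModel μ X g θs N b) (x : 𝒳) {θ : Fin p → ℝ} (hθ : θ ∈ N)
    (a : Fin m) : ContDiffAt ℝ 4 (fun θ => g x θ a) θ :=
  contDiffAt_pi.1 ((hM.smooth x).contDiffAt (hM.isOpen_N.mem_nhds hθ)) a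

theorem norm_iteratedFDeriv_le (hM : IsRegularModel μ X g θs N b) (x : 𝒳) {θ : Fin p → ℝ}
    (hθ : θ ∈ N) (a : Fin m) {j : ℕ} (hj : j ≤ 4) :
    ‖iteratedFDeriv ℝ j (fun θ => g x θ a) θ‖ ≤ b x := by
  have h1 := (ContinuousLinearMap.proj (R := ℝ) (φ := fun _ : Fin m => ℝ)
    a).norm_iteratedFDeriv_comp_left (n := j)
    ((hM.smooth x).contDiffAt (hM.isOpen_N.mem_nhds hθ)) (by exact_mod_cast hj)
  have h2 : ‖(ContinuousLinearMap.proj (R := ℝ) (φ := fun _ : Fin m => ℝ) a)‖ ≤ 1 :=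
    ContinuousLinearMap.opNorm_le_bound _ zero_le_one fun v => by
      simpa using norm_le_pi_norm v a
  refine h1.trans ((mul_le_of_le_one_left (norm_nonneg _) h2).trans (hM.bound x θ hθ j hj))

theorem contDiffAt_jac (hM : IsRegularModel μ X g θs N b) (x : 𝒳) {θ : Fin p → ℝ} (hθ : θ ∈ N)
    (a : Fin m) (c : Fin p) : ContDiffAt ℝ 3 (fun θ => jac g x θ a c) θ := by
  have h := contDiffAt_pd (n := 3) (F := fun θ => g x θ a) (z := θ)
    (by exact_mod_cast hM.contDiffAt x hθ a) c
  exact_mod_cast h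

theorem norm_iteratedFDeriv_jac_le (hM : IsRegularModel μ X g θs N b) (x : 𝒳) {θ : Fin p → ℝ}
    (hθ : θ ∈ N) (a : Fin m) (c : Fin p) {j : ℕ} (hj : j ≤ 3) :
    ‖iteratedFDeriv ℝ j (fun θ => jac g x θ a c) θ‖ ≤ b x := by
  have he : (fun θ => jac g x θ a c) =ᶠ[𝓝 θ]
      fun θ => fderiv ℝ (fun θ => g x θ a) θ (Pi.single c 1) := by
    filter_upwards [(hM.contDiffAt x hθ a).eventually (by simp)] with θ' h
    exact pd_eq_fderiv (h.differentiableAt (by norm_num)) c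
  rw [(he.iteratedFDeriv ℝ j).eq_of_nhds]
  have h1 : ContDiffAt ℝ 3 (fderiv ℝ (fun θ => g x θ a)) θ :=
    (hM.contDiffAt x hθ a).fderiv_right (by norm_num)
  refine (norm_iteratedFDeriv_clm_apply_const h1 (by exact_mod_cast hj)).trans ?_
  rw [norm_iteratedFDeriv_fderiv, Pi.norm_single, norm_one, one_mul]
  exact hM.norm_iteratedFDeriv_le x hθ a (by omega)

theorem exists_closedBall_subset (hM : IsRegularModel μ X g θs N b) :
    ∃ r : ℝ, 0 < r ∧ Metric.closedBall θs r ⊆ N :=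
  Metric.nhds_basis_closedBall.mem_iff.1 (hM.isOpen_N.mem_nhds hM.mem_N)

theorem mem_N_of_line {r : ℝ} (hr : Metric.closedBall θs r ⊆ N) {q : 𝒳 × (Idx m p → ℝ)}
    (hq : q ∈ goodLines m p b r) {s : ℝ} (hs : s ∈ Set.Icc (0 : ℝ) 1) :
    θs + s • thetaPart q.2 ∈ N := by
  apply hr
  rw [Metric.mem_closedBall, dist_eq_norm, add_sub_cancel_left, norm_smul, Real.norm_eq_abs,
    abs_of_nonneg hs.1]
  exact (mul_le_of_le_one_left (norm_nonneg _) hs.2).trans ((norm_thetaPart_le _).trans hq.1)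

section

variable (hM : IsRegularModel μ X g θs N b) {r : ℝ} (hr : Metric.closedBall θs r ⊆ N)
include hM

theorem lineScale_nonneg (q : 𝒳 × (Idx m p → ℝ)) : 0 ≤ lineScale b q :=
  mul_nonneg (by linarith [hM.b_nonneg q.1]) (norm_nonneg _)

theorem lineScale_le_one {q : 𝒳 × (Idx m p → ℝ)} (hq : q ∈ goodLines m p b r) :
    lineScale b q ≤ 1 := by
  have h1 := hM.lineScale_nonneg q
  have h2 : 2 * (m + 1) * lineScale b q ≤ 1 := hq.2
  have h3 : (0 : ℝ) ≤ m := Nat.cast_nonneg m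
  nlinarith

theorem norm_le_lineScale (q : 𝒳 × (Idx m p → ℝ)) : ‖q.2‖ ≤ lineScale b q :=
  le_mul_of_one_le_left (norm_nonneg _) (by linarith [hM.b_nonneg q.1])

include hr

theorem wbound_g (a : Fin m) :
    WBound (goodLines m p b r) (lineScale b) 4 (fun q => 1 + b q.1)
      (fun q s => g q.1 (θs + s • thetaPart q.2) a) := by
  refine ⟨(4).factorial, by positivity, fun q hq s hs => ?_⟩
  have hN := mem_N_of_line hr hq hs
  refine ⟨contDiffAt_comp_line (hM.contDiffAt q.1 hN a), fun j hj => ?_⟩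
  have hb := hM.b_nonneg q.1
  refine (abs_iteratedDeriv_line_le (F := fun θ => g q.1 θ a) (B := 1 + b q.1)
    ((hM.contDiffAt q.1 hN a).of_le (by exact_mod_cast hj))
    fun i hi => (hM.norm_iteratedFDeriv_le q.1 hN a (hi.trans hj)).trans (by linarith)).trans ?_
  have h1 : (j.factorial : ℝ) ≤ (4).factorial := by exact_mod_cast Nat.factorial_le hj
  have h2 := (norm_thetaPart_le q.2).trans (hM.norm_le_lineScale q)
  gcongr

theorem wbound_jac (a : Fin m) (c : Fin p) :
    WBound (goodLines m p b r) (lineScale b) 3 (fun q => 1 + b q.1)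
      (fun q s => jac g q.1 (θs + s • thetaPart q.2) a c) := by
  refine ⟨(3).factorial, by positivity, fun q hq s hs => ?_⟩
  have hN := mem_N_of_line hr hq hs
  refine ⟨contDiffAt_comp_line (hM.contDiffAt_jac q.1 hN a c), fun j hj => ?_⟩
  have hb := hM.b_nonneg q.1
  refine (abs_iteratedDeriv_line_le (F := fun θ => jac g q.1 θ a c) (B := 1 + b q.1)
    ((hM.contDiffAt_jac q.1 hN a c).of_le (by exact_mod_cast hj))
    fun i hi => (hM.norm_iteratedFDeriv_jac_le q.1 hN a c (hi.trans hj)).trans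
      (by linarith)).trans ?_
  have h1 : (j.factorial : ℝ) ≤ (3).factorial := by exact_mod_cast Nat.factorial_le hj
  have h2 := (norm_thetaPart_le q.2).trans (hM.norm_le_lineScale q)
  gcongr

omit hr in
-- The weight (1 + b)⁻¹ is chosen to cancel the weight 1 + b of g and of its Jacobian, so that
-- products such as λ'g have weight one.
theorem wbound_coord (i : Idx m p) (k : ℕ) :
    WBound (goodLines m p b r) (lineScale b) k (fun q => (1 + b q.1)⁻¹)
      (fun q s => s * q.2 i) := by
  have h1 : ∀ q : 𝒳 × (Idx m p → ℝ), 0 < 1 + b q.1 := fun q => by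
    linarith [hM.b_nonneg q.1]
  refine WBound.id_mul (fun q _ => ?_) (fun q _ => hM.lineScale_nonneg q)
    (fun q hq => hM.lineScale_le_one hq) (fun q _ => (inv_pos.2 (h1 q)).le)
  rw [lineScale, inv_mul_cancel_left₀ (h1 q).ne']
  exact norm_le_pi_norm q.2 i

theorem wbound_index (e : Fin m → Idx m p) :
    WBound (goodLines m p b r) (lineScale b) 4 (fun _ => 1)
      (fun q s => ∑ a, s * q.2 (e a) * g q.1 (θs + s • thetaPart q.2) a) := by
  refine WBound.sum (fun _ _ => zero_le_one) (fun q _ => hM.lineScale_nonneg q) fun a _ => ?_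
  refine ((hM.wbound_coord (r := r) (e a) 4).mul (hM.wbound_g hr a)).weaken
    (fun q _ => hM.lineScale_nonneg q) fun q _ => ?_
  rw [inv_mul_cancel₀ (by linarith [hM.b_nonneg q.1])]

/-- Each of the m summands is at most ‖δ‖ b, and the second condition in `goodLines` makes their sum
at most 1/2. This keeps 1 - κ'g away from zero and the argument of the exponential in a compact
interval. -/
theorem index_mem_Icc (e : Fin m → Idx m p) :
    ∀ q ∈ goodLines m p b r, ∀ s ∈ Set.Icc (0 : ℝ) 1,
      ∑ a, s * q.2 (e a) * g q.1 (θs + s • thetaPart q.2) a ∈ Set.Icc (-1 / 2 : ℝ) (1 / 2) := by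
  intro q hq s hs
  have hb := hM.b_nonneg q.1
  have h1 : |∑ a, s * q.2 (e a) * g q.1 (θs + s • thetaPart q.2) a| ≤ m * (‖q.2‖ * b q.1) := by
    refine (Finset.abs_sum_le_sum_abs _ _).trans ?_
    have : ∀ a ∈ Finset.univ, |s * q.2 (e a) * g q.1 (θs + s • thetaPart q.2) a| ≤
        ‖q.2‖ * b q.1 := fun a _ => by
      rw [abs_mul, abs_mul, abs_of_nonneg hs.1]
      have e1 : |q.2 (e a)| ≤ ‖q.2‖ := norm_le_pi_norm q.2 (e a)
      have e2 : |g q.1 (θs + s • thetaPart q.2) a| ≤ b q.1 := by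
        have := hM.norm_iteratedFDeriv_le q.1 (mem_N_of_line hr hq hs) a (Nat.zero_le 4)
        rwa [norm_iteratedFDeriv_zero] at this
      have e3 : s * |q.2 (e a)| ≤ ‖q.2‖ := (mul_le_of_le_one_left (abs_nonneg _) hs.2).trans e1
      gcongr
    calc _ ≤ ∑ _a : Fin m, ‖q.2‖ * b q.1 := Finset.sum_le_sum this
      _ = _ := by simp
  have h2 : 2 * (m + 1) * ((1 + b q.1) * ‖q.2‖) ≤ 1 := hq.2
  have h3 : (0 : ℝ) ≤ m := Nat.cast_nonneg m
  have h4 := norm_nonneg q.2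
  have h5 : m * (‖q.2‖ * b q.1) ≤ (m + 1) * ((1 + b q.1) * ‖q.2‖) := by
    have : ‖q.2‖ * b q.1 ≤ (1 + b q.1) * ‖q.2‖ := by nlinarith
    have h6 : 0 ≤ ‖q.2‖ * b q.1 := by positivity
    nlinarith
  have := abs_le.1 h1
  constructor <;> linarith

theorem wbound_exp :
    WBound (goodLines m p b r) (lineScale b) 4 (fun _ => 1)
      (fun q s => Real.exp (∑ a, s * q.2 (iΛ a) * g q.1 (θs + s • thetaPart q.2) a)) :=
  WBound.comp (fun _ _ => Real.contDiff_exp.contDiffAt) (hM.wbound_index hr _)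
    (fun q _ => hM.lineScale_nonneg q) (hM.index_mem_Icc hr _)

theorem wbound_inv :
    WBound (goodLines m p b r) (lineScale b) 4 (fun _ => 1)
      (fun q s => (1 - ∑ a, s * q.2 (iκ a) * g q.1 (θs + s • thetaPart q.2) a)⁻¹) :=
  WBound.comp (F := fun u => (1 - u)⁻¹)
    (fun u hu => (contDiffAt_const.sub contDiffAt_id).inv (by
      have := hu.2
      simp only [id, ne_eq]
      linarith))
    (hM.wbound_index hr _) (fun q _ => hM.lineScale_nonneg q) (hM.index_mem_Icc hr _)

/-- The product `G' δ` along a line, for a block `e` of coordinates. -/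
theorem wbound_jac_dir (e : Fin m → Idx m p) (c : Fin p) :
    WBound (goodLines m p b r) (lineScale b) 3 (lineScale b)
      (fun q s => ∑ a, jac g q.1 (θs + s • thetaPart q.2) a c * q.2 (e a)) := by
  have hD : ∀ q ∈ goodLines m p b r, 0 ≤ lineScale b q := fun q _ => hM.lineScale_nonneg q
  refine WBound.sum hD hD fun a _ => ?_
  exact (hM.wbound_jac hr a c).mul (WBound.const (A := fun q : 𝒳 × (Idx m p → ℝ) => ‖q.2‖)
    (c := fun q => q.2 (e a)) (fun q _ => norm_le_pi_norm q.2 (e a)) hD)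

end

end IsRegularModel

end Lines

end ETEL

namespace ETEL

section Components

variable {Ω 𝒳 : Type*} [MeasurableSpace Ω] [MeasurableSpace 𝒳] {m p : ℕ} {μ : Measure Ω}
  {X : ℕ → Ω → 𝒳} {g : 𝒳 → (Fin p → ℝ) → Fin m → ℝ} {θs : Fin p → ℝ} {N : Set (Fin p → ℝ)}
  {b : 𝒳 → ℝ}

/-! ### Components of the moment functions -/

theorem phiETEL_τ (x : 𝒳) (β : Idx m p → ℝ) : phiETEL g x β iτ =
    Real.exp (∑ a, β (iΛ a) * g x (thetaPart β) a) - β iτ := rfl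

theorem phiETEL_κ (x : 𝒳) (β : Idx m p → ℝ) (a : Fin m) : phiETEL g x β (iκ a) =
    Real.exp (∑ a, β (iΛ a) * g x (thetaPart β) a) * g x (thetaPart β) a := rfl

theorem phiETEL_Λ (x : 𝒳) (β : Idx m p → ℝ) (a : Fin m) : phiETEL g x β (iΛ a) =
    (β iτ - Real.exp (∑ a, β (iΛ a) * g x (thetaPart β) a)) * g x (thetaPart β) a
      + Real.exp (∑ a, β (iΛ a) * g x (thetaPart β) a)
        * (∑ a, β (iκ a) * g x (thetaPart β) a) * g x (thetaPart β) a := by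
  have : (∑ a, β (iκ a) * g x (thetaPart β) a) = ∑ a, g x (thetaPart β) a * β (iκ a) :=
    Finset.sum_congr rfl fun _ _ => mul_comm _ _
  rw [this]
  rfl

theorem phiETEL_θ (x : 𝒳) (β : Idx m p → ℝ) (c : Fin p) : phiETEL g x β (iθ c) =
    Real.exp (∑ a, β (iΛ a) * g x (thetaPart β) a)
        * (∑ a, jac g x (thetaPart β) a c * β (iκ a))
      + Real.exp (∑ a, β (iΛ a) * g x (thetaPart β) a)
        * (∑ a, β (iκ a) * g x (thetaPart β) a) * (∑ a, jac g x (thetaPart β) a c * β (iΛ a))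
      - Real.exp (∑ a, β (iΛ a) * g x (thetaPart β) a)
        * (∑ a, jac g x (thetaPart β) a c * β (iΛ a))
      + β iτ * (∑ a, jac g x (thetaPart β) a c * β (iΛ a)) := by
  have : (∑ a, β (iκ a) * g x (thetaPart β) a) = ∑ a, g x (thetaPart β) a * β (iκ a) :=
    Finset.sum_congr rfl fun _ _ => mul_comm _ _
  rw [this]
  rfl

theorem phiEL_Λ (x : 𝒳) (β : Idx m p → ℝ) (a : Fin m) : phiEL g x β (iΛ a) =
    (1 - ∑ a, β (iκ a) * g x (thetaPart β) a)⁻¹ * g x (thetaPart β) a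
      - Real.exp (∑ a, β (iΛ a) * g x (thetaPart β) a) * g x (thetaPart β) a := rfl

theorem phiEL_θ (x : 𝒳) (β : Idx m p → ℝ) (c : Fin p) : phiEL g x β (iθ c) =
    (1 - ∑ a, β (iκ a) * g x (thetaPart β) a)⁻¹
      * (∑ a, jac g x (thetaPart β) a c * β (iκ a)) := rfl

theorem thetaPart_betaStar_add (s : ℝ) (δ : Idx m p → ℝ) :
    thetaPart (betaStar θs + s • δ) = θs + s • thetaPart δ := rfl

theorem line_τ (s : ℝ) (δ : Idx m p → ℝ) : (betaStar θs + s • δ : Idx m p → ℝ) iτ = 1 + s * δ iτ := rfl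

theorem line_κ (s : ℝ) (δ : Idx m p → ℝ) (a : Fin m) :
    (betaStar θs + s • δ : Idx m p → ℝ) (iκ a) = s * δ (iκ a) := zero_add _

theorem line_Λ (s : ℝ) (δ : Idx m p → ℝ) (a : Fin m) :
    (betaStar θs + s • δ : Idx m p → ℝ) (iΛ a) = s * δ (iΛ a) := zero_add _

/-- `φ` along the line through the true value with direction `δ`. -/
def lineFun {ι : Type*} (φ : 𝒳 → (ι → ℝ) → ι → ℝ) (βs : ι → ℝ) (l : ι) (x : 𝒳) (δ : ι → ℝ) :
    ℝ → ℝ := fun s => φ x (βs + s • δ) l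

theorem lineFun_eq {ι : Type*} (φ : 𝒳 → (ι → ℝ) → ι → ℝ) (βs : ι → ℝ) (l : ι) (x : 𝒳)
    (δ : ι → ℝ) : lineFun φ βs l x δ = fun s => φ x (βs + s • δ) l := rfl

/-- The Taylor expansion of order three of the `l`-th moment function along good lines. -/
def HasLineTaylor (m p : ℕ) (b : 𝒳 → ℝ) (r : ℝ) (f : 𝒳 × (Idx m p → ℝ) → ℝ → ℝ) : Prop :=
  WBound (goodLines m p b r) (lineScale b) 3 (fun q => 1 + b q.1) f ∧
  ∃ C : ℝ, 0 ≤ C ∧ ∀ q ∈ goodLines m p b r, |f q 1 - (f q 0 + iteratedDeriv 1 (f q) 0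
      + 1 / 2 * iteratedDeriv 2 (f q) 0 + 1 / 6 * iteratedDeriv 3 (f q) 0)| ≤
        C * (1 + b q.1) * lineScale b q ^ 4

namespace IsRegularModel

variable (hM : IsRegularModel μ X g θs N b) {r : ℝ} (hr : Metric.closedBall θs r ⊆ N)
include hM

theorem hasLineTaylor_of_wbound {f : 𝒳 × (Idx m p → ℝ) → ℝ → ℝ}
    (h : WBound (goodLines m p b r) (lineScale b) 4 (fun q => 1 + b q.1) f) :
    HasLineTaylor m p b r f := ⟨h.of_le (by norm_num), h.taylor_three⟩

/-- Here the weight of f is itself one power of the scale; together with the cubic factor in the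
remainder this is the fourth power. -/
theorem hasLineTaylor_id_mul {f : 𝒳 × (Idx m p → ℝ) → ℝ → ℝ}
    (h : WBound (goodLines m p b r) (lineScale b) 3 (lineScale b) f)
    (h' : WBound (goodLines m p b r) (lineScale b) 3 (fun q => 1 + b q.1)
      (fun q s => s * f q s)) :
    HasLineTaylor m p b r (fun q s => s * f q s) := by
  refine ⟨h', ?_⟩
  obtain ⟨C, hC, H⟩ := h.taylor_three_id_mul
  refine ⟨C, hC, fun q hq => (H q hq).trans ?_⟩
  have h1 := hM.lineScale_nonneg q
  have h2 := hM.b_nonneg q.1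
  calc C * lineScale b q * lineScale b q ^ 3 = C * 1 * lineScale b q ^ 4 := by ring
    _ ≤ _ := by gcongr; linarith

theorem wbound_one : WBound (goodLines m p b r) (lineScale b) 4 (fun _ => 1) (fun _ _ => 1) :=
  WBound.const (fun _ _ => by simp) fun q _ => hM.lineScale_nonneg q

theorem wbound_tau : WBound (goodLines m p b r) (lineScale b) 4 (fun _ => 1)
    (fun q s => 1 + s * q.2 iτ) :=
  hM.wbound_one.add ((hM.wbound_coord iτ 4).weaken (fun q _ => hM.lineScale_nonneg q)
    fun q _ => inv_le_one_of_one_le₀ (by linarith [hM.b_nonneg q.1]))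

include hr

theorem wbound_jac_coord (e : Fin m → Idx m p) (c : Fin p) :
    WBound (goodLines m p b r) (lineScale b) 3 (fun _ => 1)
      (fun q s => ∑ a, jac g q.1 (θs + s • thetaPart q.2) a c * (s * q.2 (e a))) := by
  have hD : ∀ q ∈ goodLines m p b r, 0 ≤ lineScale b q := fun q _ => hM.lineScale_nonneg q
  refine WBound.sum (fun _ _ => zero_le_one) hD fun a _ => ?_
  refine ((hM.wbound_jac hr a c).mul (hM.wbound_coord (e a) 3)).weaken hD fun q _ => ?_
  rw [mul_inv_cancel₀ (by linarith [hM.b_nonneg q.1])]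

theorem hasLineTaylor_phiETEL (l : Idx m p) :
    HasLineTaylor m p b r (fun q => lineFun (phiETEL g) (betaStar θs) l q.1 q.2) := by
  have hD : ∀ q ∈ goodLines m p b r, 0 ≤ lineScale b q := fun q _ => hM.lineScale_nonneg q
  have hb1 : ∀ q ∈ goodLines m p b r, (1 : ℝ) ≤ 1 + b q.1 := fun q _ => by
    linarith [hM.b_nonneg q.1]
  have mul1 : ∀ {k : ℕ} {A : 𝒳 × (Idx m p → ℝ) → ℝ} {f f' : 𝒳 × (Idx m p → ℝ) → ℝ → ℝ},
      WBound (goodLines m p b r) (lineScale b) k (fun _ => 1) f →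
      WBound (goodLines m p b r) (lineScale b) k A f' →
      WBound (goodLines m p b r) (lineScale b) k A (fun p s => f p s * f' p s) :=
    fun h h' => (h.mul h').weaken hD fun q _ => (one_mul _).le
  rcases l with _ | a | a | c
  · change HasLineTaylor m p b r (fun q => lineFun (phiETEL g) (betaStar θs) iτ q.1 q.2)
    refine hM.hasLineTaylor_of_wbound ?_
    simp only [lineFun_eq, phiETEL_τ, thetaPart_betaStar_add, line_Λ, line_τ]
    exact ((hM.wbound_exp hr).sub hM.wbound_tau).weaken hD hb1
  · refine hM.hasLineTaylor_of_wbound ?_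
    simp only [lineFun_eq, phiETEL_κ, thetaPart_betaStar_add, line_Λ]
    exact mul1 (hM.wbound_exp hr) (hM.wbound_g hr a)
  · refine hM.hasLineTaylor_of_wbound ?_
    simp only [lineFun_eq, phiETEL_Λ, thetaPart_betaStar_add, line_Λ, line_τ, line_κ]
    exact (mul1 (hM.wbound_tau.sub (hM.wbound_exp hr)) (hM.wbound_g hr a)).add
      (mul1 (mul1 (hM.wbound_exp hr) (hM.wbound_index hr _)) (hM.wbound_g hr a))
  · have hexp := (hM.wbound_exp hr).of_le (show 3 ≤ 4 by norm_num)
    have hidx := (hM.wbound_index hr iκ).of_le (show 3 ≤ 4 by norm_num)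
    have htau := (hM.wbound_tau (r := r)).of_le (show 3 ≤ 4 by norm_num)
    -- Every summand of the θ-block is linear in κ or λ, which vanish at β*, so a factor s can be
    -- pulled out of the restriction to a line.
    have key : ∀ (q : 𝒳 × (Idx m p → ℝ)), lineFun (phiETEL g) (betaStar θs) (iθ c) q.1 q.2 =
        fun s => s * (Real.exp (∑ a, s * q.2 (iΛ a) * g q.1 (θs + s • thetaPart q.2) a)
        * (∑ a, jac g q.1 (θs + s • thetaPart q.2) a c * q.2 (iκ a))
      + Real.exp (∑ a, s * q.2 (iΛ a) * g q.1 (θs + s • thetaPart q.2) a)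
        * (∑ a, s * q.2 (iκ a) * g q.1 (θs + s • thetaPart q.2) a)
        * (∑ a, jac g q.1 (θs + s • thetaPart q.2) a c * q.2 (iΛ a))
      - Real.exp (∑ a, s * q.2 (iΛ a) * g q.1 (θs + s • thetaPart q.2) a)
        * (∑ a, jac g q.1 (θs + s • thetaPart q.2) a c * q.2 (iΛ a))
      + (1 + s * q.2 iτ) * (∑ a, jac g q.1 (θs + s • thetaPart q.2) a c * q.2 (iΛ a))) := by
      intro q
      ext s
      have e : ∀ e : Fin m → Idx m p,
          ∑ a, jac g q.1 (θs + s • thetaPart q.2) a c * (s * q.2 (e a)) =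
          s * ∑ a, jac g q.1 (θs + s • thetaPart q.2) a c * q.2 (e a) := fun e => by
        rw [Finset.mul_sum]; exact Finset.sum_congr rfl fun _ _ => by ring
      simp only [lineFun_eq, phiETEL_θ, thetaPart_betaStar_add, line_Λ, line_τ, line_κ, e]
      ring
    have h' : WBound (goodLines m p b r) (lineScale b) 3 (fun q => 1 + b q.1)
        (fun q => lineFun (phiETEL g) (betaStar θs) (iθ c) q.1 q.2) := by
      simp only [lineFun_eq, phiETEL_θ, thetaPart_betaStar_add, line_Λ, line_τ, line_κ]
      exact ((((mul1 hexp (hM.wbound_jac_coord hr _ c)).add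
        (mul1 (mul1 hexp hidx) (hM.wbound_jac_coord hr _ c))).sub
        (mul1 hexp (hM.wbound_jac_coord hr _ c))).add
        (mul1 htau (hM.wbound_jac_coord hr _ c))).weaken hD hb1
    simp only [key] at h' ⊢
    refine hM.hasLineTaylor_id_mul ?_ h'
    exact (((mul1 hexp (hM.wbound_jac_dir hr _ c)).add
        (mul1 (mul1 hexp hidx) (hM.wbound_jac_dir hr _ c))).sub
        (mul1 hexp (hM.wbound_jac_dir hr _ c))).add
        (mul1 htau (hM.wbound_jac_dir hr _ c))

theorem hasLineTaylor_phiEL (l : Idx m p) :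
    HasLineTaylor m p b r (fun q => lineFun (phiEL g) (betaStar θs) l q.1 q.2) := by
  have hD : ∀ q ∈ goodLines m p b r, 0 ≤ lineScale b q := fun q _ => hM.lineScale_nonneg q
  have hb1 : ∀ q ∈ goodLines m p b r, (1 : ℝ) ≤ 1 + b q.1 := fun q _ => by
    linarith [hM.b_nonneg q.1]
  have mul1 : ∀ {k : ℕ} {A : 𝒳 × (Idx m p → ℝ) → ℝ} {f f' : 𝒳 × (Idx m p → ℝ) → ℝ → ℝ},
      WBound (goodLines m p b r) (lineScale b) k (fun _ => 1) f →
      WBound (goodLines m p b r) (lineScale b) k A f' →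
      WBound (goodLines m p b r) (lineScale b) k A (fun p s => f p s * f' p s) :=
    fun h h' => (h.mul h').weaken hD fun q _ => (one_mul _).le
  rcases l with _ | a | a | c
  · exact hM.hasLineTaylor_phiETEL hr iτ
  · exact hM.hasLineTaylor_phiETEL hr (iκ a)
  · refine hM.hasLineTaylor_of_wbound ?_
    simp only [lineFun_eq, phiEL_Λ, thetaPart_betaStar_add, line_Λ, line_κ]
    exact (mul1 (hM.wbound_inv hr) (hM.wbound_g hr a)).sub
      (mul1 (hM.wbound_exp hr) (hM.wbound_g hr a))
  · have hinv := (hM.wbound_inv hr).of_le (show 3 ≤ 4 by norm_num)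
    have key : ∀ (q : 𝒳 × (Idx m p → ℝ)), lineFun (phiEL g) (betaStar θs) (iθ c) q.1 q.2 =
        fun s => s * ((1 - ∑ a, s * q.2 (iκ a) * g q.1 (θs + s • thetaPart q.2) a)⁻¹
          * ∑ a, jac g q.1 (θs + s • thetaPart q.2) a c * q.2 (iκ a)) := by
      intro q
      ext s
      have e : ∀ e : Fin m → Idx m p,
          ∑ a, jac g q.1 (θs + s • thetaPart q.2) a c * (s * q.2 (e a)) =
          s * ∑ a, jac g q.1 (θs + s • thetaPart q.2) a c * q.2 (e a) := fun e => by
        rw [Finset.mul_sum]; exact Finset.sum_congr rfl fun _ _ => by ring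
      simp only [lineFun_eq, phiEL_θ, thetaPart_betaStar_add, line_κ, e]
      ring
    have h' : WBound (goodLines m p b r) (lineScale b) 3 (fun q => 1 + b q.1)
        (fun q => lineFun (phiEL g) (betaStar θs) (iθ c) q.1 q.2) := by
      simp only [lineFun_eq, phiEL_θ, thetaPart_betaStar_add, line_κ]
      exact (mul1 hinv (hM.wbound_jac_coord hr _ c)).weaken hD hb1
    simp only [key] at h' ⊢
    exact hM.hasLineTaylor_id_mul (mul1 hinv (hM.wbound_jac_dir hr _ c)) h'

end IsRegularModel

end Components

end ETEL

namespace ETEL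

/-! ### Measurability of derivatives with respect to a parameter -/

/-- Peano's form of Taylor's theorem, arranged so that the j-th derivative is a limit of expressions
in function values and lower derivatives; this is what makes derivatives in the parameter measurable
in x. -/
theorem tendsto_taylor_quotient {h : ℝ → ℝ} {j : ℕ} (hh : ContDiffAt ℝ j h 0) :
    Tendsto (fun s : ℝ => (j.factorial : ℝ) * (s ^ j)⁻¹ *
      (h s - ∑ i ∈ Finset.range j, (i.factorial : ℝ)⁻¹ * s ^ i * iteratedDeriv i h 0))
      (𝓝[≠] 0) (𝓝 (iteratedDeriv j h 0)) := by
  obtain ⟨u, hu, hcu⟩ := hh.contDiffOn le_rfl (by simp)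
  obtain ⟨ε, hε, hεu⟩ := Metric.mem_nhds_iff.1 hu
  have h0 : (0 : ℝ) ∈ Metric.ball (0 : ℝ) ε := Metric.mem_ball_self hε
  have ho := taylor_isLittleO (convex_ball (0 : ℝ) ε) h0 (hcu.mono hεu)
  rw [Metric.isOpen_ball.nhdsWithin_eq h0] at ho
  have hit : ∀ i ≤ j, iteratedDerivWithin i h (Metric.ball 0 ε) 0 = iteratedDeriv i h 0 :=
    fun i hi => iteratedDerivWithin_eq_iteratedDeriv Metric.isOpen_ball.uniqueDiffOn
      (hh.of_le (by exact_mod_cast hi)) h0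
  have ho' := (ho.mono (nhdsWithin_le_nhds (s := {0}ᶜ))).tendsto_div_nhds_zero
  have hlim : Tendsto (fun s : ℝ => (j.factorial : ℝ) * ((h s -
      taylorWithinEval h j (Metric.ball 0 ε) 0 s) / (s - 0) ^ j) + iteratedDeriv j h 0)
      (𝓝[≠] 0) (𝓝 (iteratedDeriv j h 0)) := by
    simpa using (ho'.const_mul (j.factorial : ℝ)).add_const (iteratedDeriv j h 0)
  refine hlim.congr' ?_
  filter_upwards [self_mem_nhdsWithin] with s hs
  have hs0 : s ≠ 0 := hs
  rw [taylor_within_apply, Finset.sum_range_succ, hit j le_rfl]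
  have e : ∑ i ∈ Finset.range j, ((i.factorial : ℝ)⁻¹ * (s - 0) ^ i) •
      iteratedDerivWithin i h (Metric.ball 0 ε) 0 =
      ∑ i ∈ Finset.range j, (i.factorial : ℝ)⁻¹ * s ^ i * iteratedDeriv i h 0 :=
    Finset.sum_congr rfl fun i hi => by
      rw [hit i (Finset.mem_range.1 hi).le, sub_zero, smul_eq_mul]
  rw [e, sub_zero, smul_eq_mul]
  have hf : (j.factorial : ℝ) ≠ 0 := by positivity
  field_simp
  ring

theorem measurable_iteratedDeriv_zero {𝒳 : Type*} [MeasurableSpace 𝒳] {f : 𝒳 → ℝ → ℝ} {k : ℕ}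
    (hf : ∀ x, ContDiffAt ℝ k (f x) 0)
    (hm : ∀ᶠ s in 𝓝 (0 : ℝ), Measurable fun x => f x s) {j : ℕ} (hj : j ≤ k) :
    Measurable fun x => iteratedDeriv j (f x) 0 := by
  induction j using Nat.strong_induction_on with
  | _ j ih =>
    have hs : Tendsto (fun n : ℕ => 1 / ((n : ℝ) + 1)) atTop (𝓝[≠] 0) :=
      tendsto_nhdsWithin_iff.2 ⟨tendsto_one_div_add_atTop_nhds_zero_nat,
        Eventually.of_forall fun n => by
          have : (0 : ℝ) < 1 / ((n : ℝ) + 1) := by positivity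
          exact this.ne'⟩
    -- Measurability in x is assumed only for parameters near zero, so the sequence 1/(n+1) is
    -- started late.
    obtain ⟨n₀, hn₀⟩ := eventually_atTop.1
      (tendsto_one_div_add_atTop_nhds_zero_nat.eventually hm)
    have hsub := hs.comp (tendsto_add_atTop_nat n₀)
    refine measurable_of_tendsto_metrizable (f := fun n x => (j.factorial : ℝ) *
      ((1 / (((n + n₀ : ℕ) : ℝ) + 1)) ^ j)⁻¹ * (f x (1 / (((n + n₀ : ℕ) : ℝ) + 1)) -
        ∑ i ∈ Finset.range j, (i.factorial : ℝ)⁻¹ * (1 / (((n + n₀ : ℕ) : ℝ) + 1)) ^ i *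
          iteratedDeriv i (f x) 0)) (fun n => ?_) (tendsto_pi_nhds.2 fun x => ?_)
    · refine Measurable.const_mul ((hn₀ (n + n₀) (by omega)).sub ?_) _
      exact Finset.measurable_sum _ fun i hi =>
        (ih i (Finset.mem_range.1 hi) ((Finset.mem_range.1 hi).le.trans hj)).const_mul _
    · exact (tendsto_taylor_quotient ((hf x).of_le (by exact_mod_cast hj))).comp hsub

/-! ### Envelopes -/

/-- `f` is measurable and bounded by a multiple of the `d`-th power of `1 + b`. -/
def Dom {𝒳 : Type*} [MeasurableSpace 𝒳] (b : 𝒳 → ℝ) (d : ℕ) (f : 𝒳 → ℝ) : Prop :=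
  Measurable f ∧ ∃ C : ℝ, 0 ≤ C ∧ ∀ x, |f x| ≤ C * (1 + b x) ^ d

namespace Dom

variable {𝒳 : Type*} [MeasurableSpace 𝒳] {b : 𝒳 → ℝ} {d d' : ℕ} {f f' : 𝒳 → ℝ}

theorem add (hf : Dom b d f) (hf' : Dom b d f') : Dom b d (fun x => f x + f' x) := by
  obtain ⟨hm, C, hC, h⟩ := hf
  obtain ⟨hm', C', hC', h'⟩ := hf'
  exact ⟨hm.add hm', C + C', by positivity, fun x => (abs_add_le _ _).trans (by
    rw [add_mul]; exact add_le_add (h x) (h' x))⟩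

theorem mul (hf : Dom b d f) (hf' : Dom b d' f') : Dom b (d + d') (fun x => f x * f' x) := by
  obtain ⟨hm, C, hC, h⟩ := hf
  obtain ⟨hm', C', hC', h'⟩ := hf'
  refine ⟨hm.mul hm', C * C', by positivity, fun x => ?_⟩
  rw [abs_mul]
  calc _ ≤ (C * (1 + b x) ^ d) * (C' * (1 + b x) ^ d') :=
        mul_le_mul (h x) (h' x) (abs_nonneg _) ((abs_nonneg _).trans (h x))
    _ = _ := by rw [pow_add]; ring

theorem const_mul (c : ℝ) (hf : Dom b d f) : Dom b d (fun x => c * f x) := by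
  obtain ⟨hm, C, hC, h⟩ := hf
  refine ⟨hm.const_mul c, |c| * C, by positivity, fun x => ?_⟩
  rw [abs_mul, mul_assoc]
  exact mul_le_mul_of_nonneg_left (h x) (abs_nonneg _)

theorem neg (hf : Dom b d f) : Dom b d (fun x => -f x) := by simpa using hf.const_mul (-1)

theorem sub (hf : Dom b d f) (hf' : Dom b d f') : Dom b d (fun x => f x - f' x) := by
  simpa only [sub_eq_add_neg] using hf.add hf'.neg

theorem mono (hb : ∀ x, 0 ≤ b x) (hf : Dom b d f) (h : d ≤ d') : Dom b d' f := by
  obtain ⟨hm, C, hC, H⟩ := hf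
  refine ⟨hm, C, hC, fun x => (H x).trans (mul_le_mul_of_nonneg_left ?_ hC)⟩
  exact pow_le_pow_right₀ (by linarith [hb x]) h

theorem const (c : ℝ) : Dom b 0 (fun _ => c) := ⟨measurable_const, |c|, abs_nonneg c, by simp⟩

theorem const' (hb : ∀ x, 0 ≤ b x) (c : ℝ) (d : ℕ) : Dom b d (fun _ => c) :=
  (const c).mono hb (Nat.zero_le d)

theorem sum {ι : Type*} {t : Finset ι} {F : ι → 𝒳 → ℝ} (hb : ∀ x, 0 ≤ b x)
    (h : ∀ i ∈ t, Dom b d (F i)) : Dom b d (fun x => ∑ i ∈ t, F i x) := by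
  classical
  induction t using Finset.induction_on with
  | empty => simpa using const' hb 0 d
  | insert i t hi ih =>
    simp only [Finset.sum_insert hi]
    exact (h i (Finset.mem_insert_self i t)).add
      (ih fun j hj => h j (Finset.mem_insert_of_mem hj))

theorem prod {ι : Type*} {t : Finset ι} {F : ι → 𝒳 → ℝ} {e : ι → ℕ}
    (h : ∀ i ∈ t, Dom b (e i) (F i)) : Dom b (∑ i ∈ t, e i) (fun x => ∏ i ∈ t, F i x) := by
  classical
  induction t using Finset.induction_on with
  | empty => simpa using const 1
  | insert i t hi ih =>
    simp only [Finset.prod_insert hi, Finset.sum_insert hi]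
    exact (h i (Finset.mem_insert_self i t)).mul
      (ih fun j hj => h j (Finset.mem_insert_of_mem hj))

end Dom

/-- The moment functions `φ` are three times continuously differentiable at `βs`, with derivatives
and a Taylor remainder controlled by powers of `1 + b`. -/
structure HasEnvelope {𝒳 ι : Type*} [MeasurableSpace 𝒳] [Fintype ι] [DecidableEq ι]
    (φ : 𝒳 → (ι → ℝ) → ι → ℝ) (βs : ι → ℝ) (b : 𝒳 → ℝ) : Prop where
  b_nonneg : ∀ x, 0 ≤ b x
  contDiffAt : ∀ x l, ContDiffAt ℝ 3 (fun β => φ x β l) βs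
  dom0 : ∀ l, Dom b 1 (fun x => φ x βs l)
  dom1 : ∀ l j, Dom b 2 (d1 φ βs l j)
  dom2 : ∀ l j k, Dom b 3 (d2 φ βs l j k)
  dom3 : ∀ l j k h, Dom b 4 (d3 φ βs l j k h)
  taylor : ∃ r : ℝ, 0 < r ∧ ∃ C : ℝ, 0 ≤ C ∧ ∀ x δ l, (1 + b x) * ‖δ‖ ≤ r →
    |φ x (βs + δ) l - (φ x βs l + ∑ j, δ j * d1 φ βs l j x
      + 1 / 2 * quadForm (fun j k => d2 φ βs l j k x) δ
      + 1 / 6 * cubicForm (fun j k h => d3 φ βs l j k h x) δ)| ≤ C * (1 + b x) ^ 5 * ‖δ‖ ^ 4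

section

variable {𝒳 : Type*} [MeasurableSpace 𝒳] {ι : Type*} [Fintype ι] [DecidableEq ι]
  {φ : 𝒳 → (ι → ℝ) → ι → ℝ} {βs : ι → ℝ} {x : 𝒳} {l : ι}

theorem iteratedDeriv_one_lineFun (h : ContDiffAt ℝ 3 (fun β => φ x β l) βs) (v : ι → ℝ) :
    iteratedDeriv 1 (lineFun φ βs l x v) 0 = ∑ j, v j * d1 φ βs l j x :=
  iteratedDeriv_one_line (h.of_le (by norm_num)) v

theorem iteratedDeriv_two_lineFun (h : ContDiffAt ℝ 3 (fun β => φ x β l) βs) (v : ι → ℝ) :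
    iteratedDeriv 2 (lineFun φ βs l x v) 0 = quadForm (fun j k => d2 φ βs l j k x) v :=
  iteratedDeriv_two_line (h.of_le (by norm_num)) v

theorem iteratedDeriv_three_lineFun (h : ContDiffAt ℝ 3 (fun β => φ x β l) βs) (v : ι → ℝ) :
    iteratedDeriv 3 (lineFun φ βs l x v) 0 = cubicForm (fun j k h => d3 φ βs l j k h x) v :=
  iteratedDeriv_three_line h v

theorem d2_comm (h : ContDiffAt ℝ 3 (fun β => φ x β l) βs) (j k : ι) :
    d2 φ βs l j k x = d2 φ βs l k j x := pd_comm (h.of_le (by norm_num)) j k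

end

/-- Homogeneity turns bounds on good lines into bounds in every direction: v is shrunk by a factor
of order (1 + b)⁻¹, and undoing the scaling of a j-th derivative costs (1 + b)^j on top of the
weight 1 + b. Polarization then passes from forms to entries. -/
theorem hasEnvelope_of_hasLineTaylor {𝒳 : Type*} [MeasurableSpace 𝒳] {m p : ℕ}
    {φ : 𝒳 → (Idx m p → ℝ) → Idx m p → ℝ} {βs : Idx m p → ℝ} {b : 𝒳 → ℝ} {r : ℝ} (hr : 0 < r)
    (hb : ∀ x, 0 ≤ b x) (hd : ∀ x l, ContDiffAt ℝ 3 (fun β => φ x β l) βs)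
    (hm : ∀ l δ, ∀ᶠ s in 𝓝 (0 : ℝ), Measurable fun x => φ x (βs + s • δ) l)
    (ht : ∀ l, HasLineTaylor m p b r (fun q => lineFun φ βs l q.1 q.2)) :
    HasEnvelope φ βs b := by
  have hb1 : ∀ x, 0 < 1 + b x := fun x => by linarith [hb x]
  have hmeas : ∀ l δ (j : ℕ), j ≤ 3 →
      Measurable fun x => iteratedDeriv j (lineFun φ βs l x δ) 0 := fun l δ j hj =>
    measurable_iteratedDeriv_zero (k := 3)
      (fun x => contDiffAt_comp_line (by simpa using hd x l)) (hm l δ) hj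
  -- One threshold on (1 + b)‖δ‖ guaranteeing both conditions in `goodLines`.
  set ρ : ℝ := min r (1 / (2 * (m + 1))) with hρ
  have hρ0 : 0 < ρ := lt_min hr (by positivity)
  have hgood : ∀ x (δ : Idx m p → ℝ), (1 + b x) * ‖δ‖ ≤ ρ → (x, δ) ∈ goodLines m p b r := by
    intro x δ h
    have h1 : ‖δ‖ ≤ (1 + b x) * ‖δ‖ :=
      le_mul_of_one_le_left (norm_nonneg _) (by linarith [hb x])
    refine ⟨h1.trans (h.trans (min_le_left _ _)), ?_⟩
    have h2 := h.trans (min_le_right _ _)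
    have h3 : (0 : ℝ) < 2 * (m + 1) := by positivity
    rw [le_div_iff₀ h3] at h2
    linarith
  have hbound : ∀ l (v : Idx m p → ℝ) (j : ℕ), j ≤ 3 →
      (∀ x (c : ℝ), iteratedDeriv j (lineFun φ βs l x (c • v)) 0 =
        c ^ j * iteratedDeriv j (lineFun φ βs l x v) 0) →
      Dom b (j + 1) fun x => iteratedDeriv j (lineFun φ βs l x v) 0 := by
    intro l v j hj hom
    obtain ⟨C, hC, H⟩ := (ht l).1
    refine ⟨hmeas l v j hj, C * ((ρ / (1 + ‖v‖)) ^ j)⁻¹, by positivity, fun x => ?_⟩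
    have hv : 0 ≤ ‖v‖ := norm_nonneg v
    -- The scaling that brings v below the threshold; 1 + ‖v‖ rather than ‖v‖ avoids a separate
    -- treatment of v = 0.
    set c : ℝ := ρ / (1 + ‖v‖) / (1 + b x) with hc
    have hc0 : 0 < c := by have := hb1 x; positivity
    have hsc : (1 + b x) * ‖c • v‖ ≤ min ρ 1 := by
      rw [norm_smul, Real.norm_eq_abs, abs_of_pos hc0]
      have e : (1 + b x) * (c * ‖v‖) = ρ * (‖v‖ / (1 + ‖v‖)) := by
        rw [hc]; field_simp [(hb1 x).ne']
      have h1 : ‖v‖ / (1 + ‖v‖) ≤ 1 := (div_le_one (by positivity)).2 (by linarith)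
      have h2 : ρ * (‖v‖ / (1 + ‖v‖)) ≤ ρ := mul_le_of_le_one_right hρ0.le h1
      have h3 : ρ ≤ 1 := (min_le_right _ _).trans (by
        rw [div_le_one (by positivity)]
        have : (0 : ℝ) ≤ m := Nat.cast_nonneg m
        linarith)
      rw [e]
      exact le_min h2 (h2.trans h3)
    have key := (H (x, c • v) (hgood x _ (hsc.trans (min_le_left _ _))) 0 (by simp)).2 j hj
    simp only [lineScale, hom] at key
    have h4 : ((1 + b x) * ‖c • v‖) ^ j ≤ 1 :=
      pow_le_one₀ (mul_nonneg (hb1 x).le (norm_nonneg _)) (hsc.trans (min_le_right _ _))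
    have h5 : c ^ j * |iteratedDeriv j (lineFun φ βs l x v) 0| ≤ C * (1 + b x) := by
      rw [abs_mul, abs_of_pos (pow_pos hc0 j)] at key
      exact key.trans (mul_le_of_le_one_right (mul_nonneg hC (hb1 x).le) h4)
    have h6 : |iteratedDeriv j (lineFun φ βs l x v) 0| ≤ C * (1 + b x) * (c ^ j)⁻¹ := by
      rw [← div_eq_mul_inv, le_div_iff₀ (pow_pos hc0 j)]; linarith
    refine h6.trans (le_of_eq ?_)
    rw [hc, div_pow _ (1 + b x), inv_div, pow_succ]
    field_simp
  have hdom1 : ∀ l (v : Idx m p → ℝ), Dom b 2 fun x => ∑ j, v j * d1 φ βs l j x := fun l v => by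
    have := hbound l v 1 (by norm_num) fun x c => by
      rw [iteratedDeriv_one_lineFun (hd x l), iteratedDeriv_one_lineFun (hd x l), Finset.mul_sum]
      exact Finset.sum_congr rfl fun j _ => by simp; ring
    simpa only [iteratedDeriv_one_lineFun (hd _ l)] using this
  have hdom2 : ∀ l v, Dom b 3 fun x => quadForm (fun j k => d2 φ βs l j k x) v := fun l v => by
    have := hbound l v 2 (by norm_num) fun x c => by
      rw [iteratedDeriv_two_lineFun (hd x l), iteratedDeriv_two_lineFun (hd x l), quadForm_smul]
    simpa only [iteratedDeriv_two_lineFun (hd _ l)] using this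
  have hdom3 : ∀ l v, Dom b 4 fun x => cubicForm (fun j k h => d3 φ βs l j k h x) v :=
    fun l v => by
      have := hbound l v 3 (by norm_num) fun x c => by
        rw [iteratedDeriv_three_lineFun (hd x l), iteratedDeriv_three_lineFun (hd x l),
          cubicForm_smul]
      simpa only [iteratedDeriv_three_lineFun (hd _ l)] using this
  refine ⟨hb, hd, fun l => ?_, fun l j => ?_, fun l j k => ?_, fun l j k h => ?_, ?_⟩
  · have := hbound l 0 0 (by norm_num) fun x c => by simp
    simpa [lineFun] using this
  · have := hdom1 l (Pi.single j 1)
    simpa [Pi.single_apply] using this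
  · have e : d2 φ βs l j k = fun x => 1 / 2 *
        (quadForm (fun j k => d2 φ βs l j k x) (Pi.single j 1 + Pi.single k 1)
        - quadForm (fun j k => d2 φ βs l j k x) (Pi.single j 1)
        - quadForm (fun j k => d2 φ βs l j k x) (Pi.single k 1)) := by
      ext x
      exact entry_eq_polar_quadForm (A := fun j k => d2 φ βs l j k x)
        (fun j k => d2_comm (hd x l) j k) j k
    rw [e]
    exact (((hdom2 l _).sub (hdom2 l _)).sub (hdom2 l _)).const_mul _
  · have e : d3 φ βs l j k h = fun x => 1 / 6 *
        (cubicForm (fun j k h => d3 φ βs l j k h x)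
          (Pi.single j 1 + Pi.single k 1 + Pi.single h 1)
        - cubicForm (fun j k h => d3 φ βs l j k h x) (Pi.single j 1 + Pi.single k 1)
        - cubicForm (fun j k h => d3 φ βs l j k h x) (Pi.single j 1 + Pi.single h 1)
        - cubicForm (fun j k h => d3 φ βs l j k h x) (Pi.single k 1 + Pi.single h 1)
        + cubicForm (fun j k h => d3 φ βs l j k h x) (Pi.single j 1)
        + cubicForm (fun j k h => d3 φ βs l j k h x) (Pi.single k 1)
        + cubicForm (fun j k h => d3 φ βs l j k h x) (Pi.single h 1)) := by
      ext x
      exact entry_eq_polar_cubicForm (A := fun j k h => d3 φ βs l j k h x)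
        (fun j k h => pd_comm_left (hd x l) j k h) (fun j k h => pd_comm_right (hd x l) j k h) j k h
    rw [e]
    exact (((((((hdom3 l _).sub (hdom3 l _)).sub (hdom3 l _)).sub (hdom3 l _)).add
      (hdom3 l _)).add (hdom3 l _)).add (hdom3 l _)).const_mul _
  · choose C hC H using fun l => (ht l).2
    refine ⟨ρ, hρ0, ∑ l, C l, Finset.sum_nonneg fun l _ => hC l, fun x δ l h => ?_⟩
    have key := H l (x, δ) (hgood x δ h)
    simp only [iteratedDeriv_one_lineFun (hd _ l), iteratedDeriv_two_lineFun (hd _ l),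
      iteratedDeriv_three_lineFun (hd _ l), lineScale] at key
    simp only [lineFun, one_smul, zero_smul, add_zero] at key
    refine key.trans ?_
    have hCl : C l ≤ ∑ l, C l :=
      Finset.single_le_sum (f := C) (fun l _ => hC l) (Finset.mem_univ l)
    have := (hb1 x).le
    calc _ = C l * (1 + b x) ^ 5 * ‖δ‖ ^ 4 := by ring
      _ ≤ _ := by gcongr

end ETEL

namespace ETEL

section Envelope

variable {Ω 𝒳 : Type*} [MeasurableSpace Ω] [MeasurableSpace 𝒳] {m p : ℕ} {μ : Measure Ω}
  {X : ℕ → Ω → 𝒳} {g : 𝒳 → (Fin p → ℝ) → Fin m → ℝ} {θs : Fin p → ℝ} {N : Set (Fin p → ℝ)}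
  {b : 𝒳 → ℝ}

/-! ### The ETEL and EL moment functions have envelopes -/

theorem contDiff_thetaPart {n : WithTop ℕ∞} :
    ContDiff ℝ n (thetaPart : (Idx m p → ℝ) → Fin p → ℝ) :=
  contDiff_pi.2 fun c => contDiff_apply ℝ ℝ (iθ c)

namespace IsRegularModel

variable (hM : IsRegularModel μ X g θs N b)
include hM

theorem contDiffAt_g_comp (x : 𝒳) (a : Fin m) :
    ContDiffAt ℝ 3 (fun β : Idx m p → ℝ => g x (thetaPart β) a) (betaStar θs) :=
  ((hM.contDiffAt x hM.mem_N a).of_le (by norm_num)).comp (betaStar θs : Idx m p → ℝ)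
    (contDiff_thetaPart.contDiffAt)

theorem contDiffAt_jac_comp (x : 𝒳) (a : Fin m) (c : Fin p) :
    ContDiffAt ℝ 3 (fun β : Idx m p → ℝ => jac g x (thetaPart β) a c) (betaStar θs) :=
  (hM.contDiffAt_jac x hM.mem_N a c).comp (betaStar θs : Idx m p → ℝ)
    (contDiff_thetaPart.contDiffAt)

theorem contDiffAt_index (x : 𝒳) (e : Fin m → Idx m p) :
    ContDiffAt ℝ 3 (fun β : Idx m p → ℝ => ∑ a, β (e a) * g x (thetaPart β) a) (betaStar θs) :=
  ContDiffAt.sum fun a _ => (contDiff_apply ℝ ℝ (e a)).contDiffAt.mul (hM.contDiffAt_g_comp x a)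

theorem contDiffAt_jac_index (x : 𝒳) (e : Fin m → Idx m p) (c : Fin p) :
    ContDiffAt ℝ 3 (fun β : Idx m p → ℝ => ∑ a, jac g x (thetaPart β) a c * β (e a))
      (betaStar θs) :=
  ContDiffAt.sum fun a _ =>
    (hM.contDiffAt_jac_comp x a c).mul (contDiff_apply ℝ ℝ (e a)).contDiffAt

theorem contDiffAt_phiETEL (x : 𝒳) (l : Idx m p) :
    ContDiffAt ℝ 3 (fun β => phiETEL g x β l) (betaStar θs) := by
  have hτ : ContDiffAt ℝ 3 (fun β : Idx m p → ℝ => β iτ) (betaStar θs) :=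
    (contDiff_apply ℝ ℝ iτ).contDiffAt
  have hexp := (hM.contDiffAt_index x iΛ).exp
  rcases l with _ | a | a | c
  · exact hexp.sub hτ
  · exact hexp.mul (hM.contDiffAt_g_comp x a)
  · simp only [phiETEL_Λ]
    exact ((hτ.sub hexp).mul (hM.contDiffAt_g_comp x a)).add
      ((hexp.mul (hM.contDiffAt_index x iκ)).mul (hM.contDiffAt_g_comp x a))
  · simp only [phiETEL_θ]
    exact (((hexp.mul (hM.contDiffAt_jac_index x _ c)).add
      ((hexp.mul (hM.contDiffAt_index x iκ)).mul (hM.contDiffAt_jac_index x _ c))).sub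
      (hexp.mul (hM.contDiffAt_jac_index x _ c))).add (hτ.mul (hM.contDiffAt_jac_index x _ c))

theorem contDiffAt_phiEL (x : 𝒳) (l : Idx m p) :
    ContDiffAt ℝ 3 (fun β => phiEL g x β l) (betaStar θs) := by
  have hexp := (hM.contDiffAt_index x iΛ).exp
  have hinv := (contDiffAt_const (c := (1 : ℝ))).sub (hM.contDiffAt_index x iκ) |>.inv (by
    simp [betaStar, ETEL.mk])
  rcases l with _ | a | a | c
  · exact hM.contDiffAt_phiETEL x iτ
  · exact hM.contDiffAt_phiETEL x (iκ a)
  · simp only [phiEL_Λ]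
    exact (hinv.mul (hM.contDiffAt_g_comp x a)).sub (hexp.mul (hM.contDiffAt_g_comp x a))
  · simp only [phiEL_θ]
    exact hinv.mul (hM.contDiffAt_jac_index x _ c)

theorem measurable_g_apply {θ : Fin p → ℝ} (hθ : θ ∈ N) (a : Fin m) :
    Measurable fun x => g x θ a := (measurable_pi_apply a).comp (hM.measurable_g θ hθ)

theorem measurable_jac {θ : Fin p → ℝ} (hθ : θ ∈ N) (a : Fin m) (c : Fin p) :
    Measurable fun x => jac g x θ a c := by
  have hd : ∀ x, ContDiffAt ℝ 1 (fun θ => g x θ a) θ := fun x =>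
    (hM.contDiffAt x hθ a).of_le (by norm_num)
  have h := measurable_iteratedDeriv_zero (k := 1) (j := 1)
    (f := fun x s => g x (θ + s • Pi.single c 1) a)
    (fun x => contDiffAt_comp_line (F := fun θ => g x θ a) (by simpa using hd x))
    (by
      have hc : Tendsto (fun s : ℝ => θ + s • (Pi.single c 1 : Fin p → ℝ)) (𝓝 0) (𝓝 θ) := by
        have := (contDiff_line θ (Pi.single c 1 : Fin p → ℝ) (n := 0)).continuous.tendsto 0
        simpa using this
      filter_upwards [hc.eventually (hM.isOpen_N.mem_nhds hθ)] with s hs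
      exact hM.measurable_g_apply hs a) le_rfl
  have e : ∀ x, iteratedDeriv 1 (fun s : ℝ => g x (θ + s • Pi.single c 1) a) 0 = jac g x θ a c :=
    fun x => by
      rw [iteratedDeriv_one_line (F := fun θ => g x θ a) (hd x)]
      simp [Pi.single_apply, jac]
  simpa only [e] using h

theorem measurable_phi (β : Idx m p → ℝ) (hβ : thetaPart β ∈ N) (l : Idx m p) :
    Measurable (fun x => phiETEL g x β l) ∧ Measurable (fun x => phiEL g x β l) := by
  have hg := fun a => hM.measurable_g_apply hβ a
  have hG := fun a c => hM.measurable_jac hβ a c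
  have hi : ∀ e : Fin m → Idx m p, Measurable fun x => ∑ a, β (e a) * g x (thetaPart β) a :=
    fun e => Finset.measurable_sum _ fun a _ => (hg a).const_mul _
  have hj : ∀ (e : Fin m → Idx m p) c,
      Measurable fun x => ∑ a, jac g x (thetaPart β) a c * β (e a) :=
    fun e c => Finset.measurable_sum _ fun a _ => (hG a c).mul_const _
  have hexp := (hi iΛ).exp
  have hinv := ((measurable_const (a := (1 : ℝ))).sub (hi iκ)).inv
  rcases l with _ | a | a | c
  · exact ⟨hexp.sub_const _, hexp.sub_const _⟩
  · exact ⟨hexp.mul (hg a), hexp.mul (hg a)⟩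
  · simp only [phiETEL_Λ, phiEL_Λ]
    exact ⟨((hexp.const_sub _).mul (hg a)).add ((hexp.mul (hi iκ)).mul (hg a)),
      (hinv.mul (hg a)).sub (hexp.mul (hg a))⟩
  · simp only [phiETEL_θ, phiEL_θ]
    exact ⟨(((hexp.mul (hj _ c)).add ((hexp.mul (hi iκ)).mul (hj _ c))).sub
      (hexp.mul (hj _ c))).add ((hj _ c).const_mul _), hinv.mul (hj _ c)⟩

theorem eventually_line_mem (δ : Idx m p → ℝ) :
    ∀ᶠ s in 𝓝 (0 : ℝ), thetaPart (betaStar θs + s • δ) ∈ N := by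
  have hc : Tendsto (fun s : ℝ => θs + s • thetaPart δ) (𝓝 0) (𝓝 θs) := by
    have := (contDiff_line θs (thetaPart δ) (n := 0)).continuous.tendsto 0
    simpa using this
  exact hc.eventually (hM.isOpen_N.mem_nhds hM.mem_N)

theorem hasEnvelope_phiETEL : HasEnvelope (phiETEL g) (betaStar θs) b := by
  obtain ⟨r, hr, hrN⟩ := hM.exists_closedBall_subset
  exact hasEnvelope_of_hasLineTaylor hr hM.b_nonneg hM.contDiffAt_phiETEL
    (fun l δ => (hM.eventually_line_mem δ).mono fun s hs => (hM.measurable_phi _ hs l).1)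
    (hM.hasLineTaylor_phiETEL hrN)

theorem hasEnvelope_phiEL : HasEnvelope (phiEL g) (betaStar θs) b := by
  obtain ⟨r, hr, hrN⟩ := hM.exists_closedBall_subset
  exact hasEnvelope_of_hasLineTaylor hr hM.b_nonneg hM.contDiffAt_phiEL
    (fun l δ => (hM.eventually_line_mem δ).mono fun s hs => (hM.measurable_phi _ hs l).2)
    (hM.hasLineTaylor_phiEL hrN)

end IsRegularModel

end Envelope

end ETEL

namespace ETEL

/-! ### Jets of order three at zero -/

/-- `f` is three times continuously differentiable at zero, where its derivatives of order
`0, 1, 2, 3` are `c₀, c₁, c₂, c₃`. -/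
structure HasJet (f : ℝ → ℝ) (c₀ c₁ c₂ c₃ : ℝ) : Prop where
  contDiffAt : ContDiffAt ℝ 3 f 0
  val : f 0 = c₀
  one : iteratedDeriv 1 f 0 = c₁
  two : iteratedDeriv 2 f 0 = c₂
  three : iteratedDeriv 3 f 0 = c₃

namespace HasJet

variable {f f' : ℝ → ℝ} {a₀ a₁ a₂ a₃ b₀ b₁ b₂ b₃ : ℝ}

theorem contDiffAt_nat (h : HasJet f a₀ a₁ a₂ a₃) (k : ℕ) (hk : k ≤ 3) : ContDiffAt ℝ k f 0 :=
  h.contDiffAt.of_le (by exact_mod_cast hk)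

theorem const (c : ℝ) : HasJet (fun _ => c) c 0 0 0 :=
  ⟨contDiffAt_const, rfl, by simp [iteratedDeriv_const], by simp [iteratedDeriv_const],
    by simp [iteratedDeriv_const]⟩

theorem add (h : HasJet f a₀ a₁ a₂ a₃) (h' : HasJet f' b₀ b₁ b₂ b₃) :
    HasJet (fun s => f s + f' s) (a₀ + b₀) (a₁ + b₁) (a₂ + b₂) (a₃ + b₃) := by
  refine ⟨h.contDiffAt.add h'.contDiffAt, by rw [h.val, h'.val], ?_, ?_, ?_⟩
  · rw [iteratedDeriv_fun_add (h.contDiffAt_nat 1 (by norm_num)) (h'.contDiffAt_nat 1 (by norm_num)),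
      h.one, h'.one]
  · rw [iteratedDeriv_fun_add (h.contDiffAt_nat 2 (by norm_num)) (h'.contDiffAt_nat 2 (by norm_num)),
      h.two, h'.two]
  · rw [iteratedDeriv_fun_add (h.contDiffAt_nat 3 (by norm_num)) (h'.contDiffAt_nat 3 (by norm_num)),
      h.three, h'.three]

theorem mul (h : HasJet f a₀ a₁ a₂ a₃) (h' : HasJet f' b₀ b₁ b₂ b₃) :
    HasJet (fun s => f s * f' s) (a₀ * b₀) (a₀ * b₁ + a₁ * b₀) (a₀ * b₂ + 2 * a₁ * b₁ + a₂ * b₀)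
      (a₀ * b₃ + 3 * a₁ * b₂ + 3 * a₂ * b₁ + a₃ * b₀) := by
  refine ⟨h.contDiffAt.mul h'.contDiffAt, by rw [h.val, h'.val], ?_, ?_, ?_⟩
  · rw [iteratedDeriv_fun_mul (h.contDiffAt_nat 1 (by norm_num))
      (h'.contDiffAt_nat 1 (by norm_num))]
    simp only [Finset.sum_range_succ, Finset.sum_range_zero, iteratedDeriv_zero, h.val, h'.val,
      h.one, h'.one, Nat.sub_self, Nat.sub_zero]
    norm_num
  · rw [iteratedDeriv_fun_mul (h.contDiffAt_nat 2 (by norm_num))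
      (h'.contDiffAt_nat 2 (by norm_num))]
    simp only [Finset.sum_range_succ, Finset.sum_range_zero, iteratedDeriv_zero, h.val, h'.val,
      h.one, h'.one, h.two, h'.two, Nat.sub_self, Nat.sub_zero,
      show 2 - 1 = 1 from rfl]
    norm_num
  · rw [iteratedDeriv_fun_mul (h.contDiffAt_nat 3 (by norm_num))
      (h'.contDiffAt_nat 3 (by norm_num))]
    simp only [Finset.sum_range_succ, Finset.sum_range_zero, iteratedDeriv_zero, h.val, h'.val,
      h.one, h'.one, h.two, h'.two, h.three, h'.three, Nat.sub_self, Nat.sub_zero,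
      show 3 - 1 = 2 from rfl, show 3 - 2 = 1 from rfl, show Nat.choose 3 2 = 3 from rfl,
      show Nat.choose 3 1 = 3 from rfl]
    norm_num

theorem congr {c₀ c₁ c₂ c₃ : ℝ} (h : HasJet f a₀ a₁ a₂ a₃) (h₀ : a₀ = c₀) (h₁ : a₁ = c₁)
    (h₂ : a₂ = c₂) (h₃ : a₃ = c₃) : HasJet f c₀ c₁ c₂ c₃ := by
  subst h₀ h₁ h₂ h₃; exact h

theorem neg (h : HasJet f a₀ a₁ a₂ a₃) : HasJet (fun s => -f s) (-a₀) (-a₁) (-a₂) (-a₃) := by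
  have := ((const (-1)).mul h).congr (c₀ := -a₀) (c₁ := -a₁) (c₂ := -a₂) (c₃ := -a₃)
    (by ring) (by ring) (by ring) (by ring)
  simpa using this

theorem sub (h : HasJet f a₀ a₁ a₂ a₃) (h' : HasJet f' b₀ b₁ b₂ b₃) :
    HasJet (fun s => f s - f' s) (a₀ - b₀) (a₁ - b₁) (a₂ - b₂) (a₃ - b₃) := by
  simpa only [sub_eq_add_neg] using h.add h'.neg

theorem id_mul_const (c : ℝ) : HasJet (fun s => s * c) 0 c 0 0 := by
  have hd : deriv (fun s : ℝ => s * c) = fun _ => c := by ext; simp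
  refine ⟨by fun_prop, zero_mul c, ?_, ?_, ?_⟩
  · rw [iteratedDeriv_one, hd]
  · rw [iteratedDeriv_succ', hd, iteratedDeriv_const]; simp
  · rw [iteratedDeriv_succ', hd, iteratedDeriv_const]; simp

theorem sum {ι : Type*} (t : Finset ι) {F : ι → ℝ → ℝ} {c₀ c₁ c₂ c₃ : ι → ℝ}
    (h : ∀ i ∈ t, HasJet (F i) (c₀ i) (c₁ i) (c₂ i) (c₃ i)) :
    HasJet (fun s => ∑ i ∈ t, F i s) (∑ i ∈ t, c₀ i) (∑ i ∈ t, c₁ i) (∑ i ∈ t, c₂ i)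
      (∑ i ∈ t, c₃ i) := by
  classical
  induction t using Finset.induction_on with
  | empty => simpa using const 0
  | insert i t hi ih =>
    simp only [Finset.sum_insert hi]
    exact (h i (Finset.mem_insert_self i t)).add
      (ih fun j hj => h j (Finset.mem_insert_of_mem hj))

theorem of_contDiffAt (h : ContDiffAt ℝ 3 f 0) :
    HasJet f (f 0) (iteratedDeriv 1 f 0) (iteratedDeriv 2 f 0) (iteratedDeriv 3 f 0) :=
  ⟨h, rfl, rfl, rfl, rfl⟩

theorem unique (h : HasJet f a₀ a₁ a₂ a₃) (h' : HasJet f b₀ b₁ b₂ b₃) :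
    a₀ = b₀ ∧ a₁ = b₁ ∧ a₂ = b₂ ∧ a₃ = b₃ :=
  ⟨h.val.symm.trans h'.val, h.one.symm.trans h'.one, h.two.symm.trans h'.two,
    h.three.symm.trans h'.three⟩

/-- The derivatives of the reciprocal are unknowns in (1 - f)⁻¹ (1 - f) = 1; Leibniz' rule makes the
system triangular and it is solved order by order. -/
theorem inv_one_sub (h : HasJet f 0 a₁ a₂ a₃) :
    HasJet (fun s => (1 - f s)⁻¹) 1 a₁ (a₂ + 2 * a₁ ^ 2) (a₃ + 6 * a₁ * a₂ + 6 * a₁ ^ 3) := by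
  have h1 : ContDiffAt ℝ 3 (fun s => 1 - f s) 0 := contDiffAt_const.sub h.contDiffAt
  have hne : (1 - f 0) ≠ 0 := by rw [h.val]; norm_num
  have hI := of_contDiffAt (f := fun s => (1 - f s)⁻¹) (h1.inv hne)
  have hprod := hI.mul ((const 1).sub h)
  have hone : HasJet (fun s => (1 - f s)⁻¹ * (1 - f s)) 1 0 0 0 := by
    have he : (fun s => (1 - f s)⁻¹ * (1 - f s)) =ᶠ[𝓝 0] fun _ => 1 := by
      filter_upwards [h1.continuousAt.eventually_ne hne] with s hs
      exact inv_mul_cancel₀ hs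
    have hc := const 1
    exact ⟨hc.contDiffAt.congr_of_eventuallyEq he, he.eq_of_nhds,
      (he.iteratedDeriv_eq 1).trans hc.one, (he.iteratedDeriv_eq 2).trans hc.two,
      (he.iteratedDeriv_eq 3).trans hc.three⟩
  obtain ⟨u0, u1, u2, u3⟩ := hprod.unique hone
  have v0 : (1 - f 0)⁻¹ = 1 := by rw [h.val]; norm_num
  rw [v0] at u1 u2 u3
  have v1 : iteratedDeriv 1 (fun s => (1 - f s)⁻¹) 0 = a₁ := by linarith
  rw [v1] at u2 u3
  have v2 : iteratedDeriv 2 (fun s => (1 - f s)⁻¹) 0 = a₂ + 2 * a₁ ^ 2 := by nlinarith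
  rw [v2] at u3
  have v3 : iteratedDeriv 3 (fun s => (1 - f s)⁻¹) 0 = a₃ + 6 * a₁ * a₂ + 6 * a₁ ^ 3 := by
    nlinarith
  exact hI.congr v0 v1 v2 v3

/-- Differentiating once gives exp f · f', and Leibniz' rule expresses each derivative of exp f
through the lower ones. -/
theorem exp (h : HasJet f 0 a₁ a₂ a₃) :
    HasJet (fun s => Real.exp (f s)) 1 a₁ (a₂ + a₁ ^ 2) (a₃ + 3 * a₁ * a₂ + a₁ ^ 3) := by
  have hE := of_contDiffAt h.contDiffAt.exp
  have hd : deriv (fun s => Real.exp (f s)) =ᶠ[𝓝 0] fun s => Real.exp (f s) * deriv f s := by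
    filter_upwards [h.contDiffAt.eventually (by simp)] with s hs
    exact ((hs.differentiableAt (by norm_num)).hasDerivAt.exp).deriv
  have hf' : ContDiffAt ℝ 2 (deriv f) 0 := by
    have : deriv f = fun s => fderiv ℝ f s 1 := by ext; simp
    rw [this]
    exact (h.contDiffAt.fderiv_right (m := 2) (by norm_num)).clm_apply contDiffAt_const
  have key : ∀ n : ℕ, n ≤ 2 → iteratedDeriv (n + 1) (fun s => Real.exp (f s)) 0 =
      ∑ i ∈ Finset.range (n + 1), (n.choose i : ℝ) * iteratedDeriv i (fun s => Real.exp (f s)) 0 *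
        iteratedDeriv (n - i + 1) f 0 := fun n hn => by
    rw [iteratedDeriv_succ', hd.iteratedDeriv_eq n,
      iteratedDeriv_fun_mul (hE.contDiffAt_nat n (hn.trans (by norm_num)))
        (hf'.of_le (by exact_mod_cast hn))]
    simp_rw [iteratedDeriv_succ']
  have v0 : Real.exp (f 0) = 1 := by rw [h.val, Real.exp_zero]
  have v1 : iteratedDeriv 1 (fun s => Real.exp (f s)) 0 = a₁ := by
    rw [key 0 (by norm_num)]
    simp only [Finset.sum_range_succ, Finset.sum_range_zero, iteratedDeriv_zero, v0,
      Nat.sub_self, zero_add, h.one]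
    norm_num
  have v2 : iteratedDeriv 2 (fun s => Real.exp (f s)) 0 = a₂ + a₁ ^ 2 := by
    rw [key 1 (by norm_num)]
    simp only [Finset.sum_range_succ, Finset.sum_range_zero, iteratedDeriv_zero, v0, v1,
      Nat.sub_self, Nat.sub_zero, zero_add, h.one, show 1 + 1 = 2 from rfl, h.two]
    norm_num
    ring
  have v3 : iteratedDeriv 3 (fun s => Real.exp (f s)) 0 = a₃ + 3 * a₁ * a₂ + a₁ ^ 3 := by
    rw [key 2 (by norm_num)]
    simp only [Finset.sum_range_succ, Finset.sum_range_zero, iteratedDeriv_zero, v0, v1, v2,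
      Nat.sub_self, Nat.sub_zero, zero_add, h.one, show 1 + 1 = 2 from rfl, h.two,
      show 2 + 1 = 3 from rfl, h.three]
    norm_num
    ring
  exact hE.congr v0 v1 v2 v3

end HasJet

/-! ### Derivatives of the moment functions at the true value -/

section Derivatives

variable {Ω 𝒳 : Type*} [MeasurableSpace Ω] [MeasurableSpace 𝒳] {m p : ℕ} {μ : Measure Ω}
  {X : ℕ → Ω → 𝒳} {g : 𝒳 → (Fin p → ℝ) → Fin m → ℝ} {θs : Fin p → ℝ} {N : Set (Fin p → ℝ)}
  {b : 𝒳 → ℝ}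

/-- `∑ δ_a g_a(x, θ*)` for the block `e` of coordinates of `δ`. -/
noncomputable def blockDot (g : 𝒳 → (Fin p → ℝ) → Fin m → ℝ) (θs : Fin p → ℝ) (e : Fin m → Idx m p)
    (δ : Idx m p → ℝ) (x : 𝒳) : ℝ := ∑ a, δ (e a) * g x θs a

/-- The derivative of `g_a(x, ·)` at `θ*` in the direction of the `θ`-part of `δ`. -/
noncomputable def jacDir (g : 𝒳 → (Fin p → ℝ) → Fin m → ℝ) (θs : Fin p → ℝ) (δ : Idx m p → ℝ) (a : Fin m)
    (x : 𝒳) : ℝ := ∑ c, δ (iθ c) * jac g x θs a c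

/-- `∑ G_{ac}(x, θ*) δ_a` for the block `e` of coordinates of `δ`. -/
noncomputable def jacDot (g : 𝒳 → (Fin p → ℝ) → Fin m → ℝ) (θs : Fin p → ℝ) (e : Fin m → Idx m p)
    (δ : Idx m p → ℝ) (c : Fin p) (x : 𝒳) : ℝ := ∑ a, jac g x θs a c * δ (e a)

namespace IsRegularModel

variable (hM : IsRegularModel μ X g θs N b)
include hM

/-- The second and third derivatives stay anonymous: they cancel wherever ETEL is compared with EL.
-/
theorem hasJet_g (x : 𝒳) (δ : Idx m p → ℝ) : ∃ y₂ y₃ : Fin m → ℝ, ∀ a,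
    HasJet (fun s => g x (θs + s • thetaPart δ) a) (g x θs a) (jacDir g θs δ a x)
      (y₂ a) (y₃ a) := by
  refine ⟨fun a => iteratedDeriv 2 (fun s : ℝ => g x (θs + s • thetaPart δ) a) 0,
    fun a => iteratedDeriv 3 (fun s : ℝ => g x (θs + s • thetaPart δ) a) 0, fun a => ?_⟩
  have hd := (hM.contDiffAt x hM.mem_N a).of_le (show (3 : WithTop ℕ∞) ≤ 4 by norm_num)
  refine (HasJet.of_contDiffAt (contDiffAt_comp_line (F := fun θ => g x θ a)
    (by simpa using hd))).congr (by simp) ?_ rfl rfl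
  rw [iteratedDeriv_one_line (F := fun θ => g x θ a) (hd.of_le (by norm_num))]
  rfl

theorem hasJet_index (x : 𝒳) (δ : Idx m p → ℝ) : ∃ w : (Fin m → Idx m p) → ℝ,
    ∀ e : Fin m → Idx m p,
    HasJet (fun s => ∑ a, s * δ (e a) * g x (θs + s • thetaPart δ) a) 0 (blockDot g θs e δ x)
      (2 * ∑ a, δ (e a) * jacDir g θs δ a x) (w e) := by
  obtain ⟨y₂, y₃, hy⟩ := hM.hasJet_g x δ
  refine ⟨fun e => 3 * ∑ a, δ (e a) * y₂ a, fun e => ?_⟩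
  refine (HasJet.sum Finset.univ fun a _ => (HasJet.id_mul_const (δ (e a))).mul (hy a)).congr
    (by simp) ?_ ?_ ?_
  · exact Finset.sum_congr rfl fun a _ => by ring
  · rw [Finset.mul_sum]; exact Finset.sum_congr rfl fun a _ => by ring
  · beta_reduce; rw [Finset.mul_sum]; exact Finset.sum_congr rfl fun a _ => by ring

/-- The unnamed derivatives are functions of the coefficient vector rather than of the block, so
they agree for κ and λ when these two blocks are equal. -/
theorem hasJet_jac_index (x : 𝒳) (δ : Idx m p → ℝ) (c : Fin p) :
    ∃ w₂ w₃ : (Fin m → ℝ) → ℝ, ∀ e : Fin m → Idx m p,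
    HasJet (fun s => ∑ a, jac g x (θs + s • thetaPart δ) a c * (s * δ (e a))) 0
      (jacDot g θs e δ c x) (w₂ fun a => δ (e a)) (w₃ fun a => δ (e a)) := by
  have hz : ∀ a, ∃ z₁ z₂ z₃ : ℝ, HasJet (fun s => jac g x (θs + s • thetaPart δ) a c)
      (jac g x θs a c) z₁ z₂ z₃ := fun a =>
    ⟨_, _, _, (HasJet.of_contDiffAt (contDiffAt_comp_line (F := fun θ => jac g x θ a c)
      (by simpa using hM.contDiffAt_jac x hM.mem_N a c))).congr (by simp) rfl rfl rfl⟩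
  choose z₁ z₂ z₃ hz using hz
  refine ⟨fun v => 2 * ∑ a, v a * z₁ a, fun v => 3 * ∑ a, v a * z₂ a, fun e => ?_⟩
  refine (HasJet.sum Finset.univ fun a _ => (hz a).mul (HasJet.id_mul_const (δ (e a)))).congr
    (by simp) ?_ ?_ ?_
  · exact Finset.sum_congr rfl fun a _ => by ring
  · beta_reduce; rw [Finset.mul_sum]; exact Finset.sum_congr rfl fun a _ => by ring
  · beta_reduce; rw [Finset.mul_sum]; exact Finset.sum_congr rfl fun a _ => by ring

theorem hasJet_tau (δ : Idx m p → ℝ) : HasJet (fun s => 1 + s * δ iτ) 1 (δ iτ) 0 0 :=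
  ((HasJet.const 1).add (HasJet.id_mul_const _)).congr (by ring) (by ring) (by ring) (by ring)

/-- First and second derivatives of the `τ`-component. -/
theorem deriv_phi_τ (x : 𝒳) (δ : Idx m p → ℝ) :
    ∑ j, δ j * d1 (phiETEL g) (betaStar θs) iτ j x = blockDot g θs iΛ δ x - δ iτ ∧
    quadForm (fun j k => d2 (phiETEL g) (betaStar θs) iτ j k x) δ =
      2 * (∑ a, δ (iΛ a) * jacDir g θs δ a x) + blockDot g θs iΛ δ x ^ 2 := by
  obtain ⟨w, hw⟩ := hM.hasJet_index x δ
  have h := ((hw iΛ).exp).sub (hM.hasJet_tau δ)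
  have hd := hM.contDiffAt_phiETEL x iτ
  have e : lineFun (phiETEL g) (betaStar θs) iτ x δ = fun s =>
      Real.exp (∑ a, s * δ (iΛ a) * g x (θs + s • thetaPart δ) a) - (1 + s * δ iτ) := by
    simp only [lineFun_eq, phiETEL_τ, thetaPart_betaStar_add, line_Λ, line_τ]
  rw [← e] at h
  rw [← iteratedDeriv_one_lineFun hd, ← iteratedDeriv_two_lineFun hd]
  exact ⟨h.one, h.two.trans (by ring)⟩

theorem deriv_phi_κ (x : 𝒳) (δ : Idx m p → ℝ) (a : Fin m) :
    ∑ j, δ j * d1 (phiETEL g) (betaStar θs) (iκ a) j x =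
      blockDot g θs iΛ δ x * g x θs a + jacDir g θs δ a x := by
  obtain ⟨w, hw⟩ := hM.hasJet_index x δ
  obtain ⟨y₂, y₃, hy⟩ := hM.hasJet_g x δ
  have h := ((hw iΛ).exp).mul (hy a)
  have e : lineFun (phiETEL g) (betaStar θs) (iκ a) x δ = fun s =>
      Real.exp (∑ a, s * δ (iΛ a) * g x (θs + s • thetaPart δ) a)
        * g x (θs + s • thetaPart δ) a := by
    simp only [lineFun_eq, phiETEL_κ, thetaPart_betaStar_add, line_Λ]
  rw [← e] at h
  rw [← iteratedDeriv_one_lineFun (hM.contDiffAt_phiETEL x _)]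
  exact h.one.trans (by ring)

/-- With τ-direction zero and u = κ'g = λ'g, the λ-blocks are g times 1 - e^u + u e^u and g times (1
- u)⁻¹ - e^u. Their difference is -u³/2 to leading order, whence agreement to second order and the
factor -3 at third order. -/
theorem deriv_phi_Λ (x : 𝒳) (δ : Idx m p → ℝ) (a : Fin m) :
    ∑ j, δ j * d1 (phiETEL g) (betaStar θs) (iΛ a) j x =
      (δ iτ - blockDot g θs iΛ δ x + blockDot g θs iκ δ x) * g x θs a ∧
    ∑ j, δ j * d1 (phiEL g) (betaStar θs) (iΛ a) j x =
      (blockDot g θs iκ δ x - blockDot g θs iΛ δ x) * g x θs a ∧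
    quadForm (fun j k => d2 (phiETEL g) (betaStar θs) (iΛ a) j k x) δ -
      quadForm (fun j k => d2 (phiEL g) (betaStar θs) (iΛ a) j k x) δ =
      2 * (δ iτ * jacDir g θs δ a x + g x θs a * (blockDot g θs iΛ δ x * blockDot g θs iκ δ x
        - blockDot g θs iκ δ x ^ 2)) ∧
    ((∀ i, δ (iκ i) = δ (iΛ i)) →
      quadForm (fun j k => d2 (phiEL g) (betaStar θs) (iΛ a) j k x) δ =
        g x θs a * blockDot g θs iκ δ x ^ 2 ∧
      (δ iτ = 0 → cubicForm (fun j k h => d3 (phiETEL g) (betaStar θs) (iΛ a) j k h x) δ -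
        cubicForm (fun j k h => d3 (phiEL g) (betaStar θs) (iΛ a) j k h x) δ =
        -3 * (g x θs a * blockDot g θs iκ δ x ^ 3))) := by
  obtain ⟨w, hw⟩ := hM.hasJet_index x δ
  obtain ⟨y₂, y₃, hy⟩ := hM.hasJet_g x δ
  have hE := (((hM.hasJet_tau δ).sub (hw iΛ).exp).mul (hy a)).add
    (((hw iΛ).exp.mul (hw iκ)).mul (hy a))
  have hL := ((hw iκ).inv_one_sub.mul (hy a)).sub ((hw iΛ).exp.mul (hy a))
  have eE : lineFun (phiETEL g) (betaStar θs) (iΛ a) x δ = fun s =>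
      (1 + s * δ iτ - Real.exp (∑ a, s * δ (iΛ a) * g x (θs + s • thetaPart δ) a))
        * g x (θs + s • thetaPart δ) a
      + Real.exp (∑ a, s * δ (iΛ a) * g x (θs + s • thetaPart δ) a)
        * (∑ a, s * δ (iκ a) * g x (θs + s • thetaPart δ) a) * g x (θs + s • thetaPart δ) a := by
    simp only [lineFun_eq, phiETEL_Λ, thetaPart_betaStar_add, line_Λ, line_τ, line_κ]
  have eL : lineFun (phiEL g) (betaStar θs) (iΛ a) x δ = fun s =>
      (1 - ∑ a, s * δ (iκ a) * g x (θs + s • thetaPart δ) a)⁻¹ * g x (θs + s • thetaPart δ) a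
      - Real.exp (∑ a, s * δ (iΛ a) * g x (θs + s • thetaPart δ) a)
        * g x (θs + s • thetaPart δ) a := by
    simp only [lineFun_eq, phiEL_Λ, thetaPart_betaStar_add, line_Λ, line_κ]
  rw [← eE] at hE
  rw [← eL] at hL
  have dE := hM.contDiffAt_phiETEL x (iΛ a)
  have dL := hM.contDiffAt_phiEL x (iΛ a)
  rw [← iteratedDeriv_one_lineFun dE, ← iteratedDeriv_one_lineFun dL,
    ← iteratedDeriv_two_lineFun dE, ← iteratedDeriv_two_lineFun dL,
    ← iteratedDeriv_three_lineFun dE, ← iteratedDeriv_three_lineFun dL]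
  refine ⟨hE.one.trans (by ring), hL.one.trans (by ring), ?_, fun hk => ?_⟩
  · rw [hE.two, hL.two]; ring
  have e1 : blockDot g θs iΛ δ x = blockDot g θs iκ δ x :=
    Finset.sum_congr rfl fun i _ => by rw [hk]
  have e2 : ∑ a, δ (iΛ a) * jacDir g θs δ a x = ∑ a, δ (iκ a) * jacDir g θs δ a x :=
    Finset.sum_congr rfl fun i _ => by rw [hk]
  have e3 : w iΛ = w iκ := by
    have h1 : (fun s => ∑ a, s * δ (iΛ a) * g x (θs + s • thetaPart δ) a) =
        fun s => ∑ a, s * δ (iκ a) * g x (θs + s • thetaPart δ) a := by simp only [hk]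
    exact ((h1 ▸ hw iΛ).unique (hw iκ)).2.2.2
  refine ⟨?_, fun h0 => ?_⟩
  · rw [hL.two, e1, e2]; ring
  · rw [hE.three, hL.three, e1, e2, e3, h0]; ring

/-- Under the same restriction the blocks are G'κ times 1 + u e^u and times (1 - u)⁻¹. As G'κ
already vanishes to first order, the discrepancy starts at order four and the cubic forms agree. -/
theorem deriv_phi_θ (x : 𝒳) (δ : Idx m p → ℝ) (c : Fin p) :
    ∑ j, δ j * d1 (phiETEL g) (betaStar θs) (iθ c) j x = jacDot g θs iκ δ c x ∧
    ∑ j, δ j * d1 (phiEL g) (betaStar θs) (iθ c) j x = jacDot g θs iκ δ c x ∧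
    quadForm (fun j k => d2 (phiETEL g) (betaStar θs) (iθ c) j k x) δ -
      quadForm (fun j k => d2 (phiEL g) (betaStar θs) (iθ c) j k x) δ =
      2 * (jacDot g θs iκ δ c x * (blockDot g θs iΛ δ x - blockDot g θs iκ δ x)
        + jacDot g θs iΛ δ c x * (δ iτ + blockDot g θs iκ δ x - blockDot g θs iΛ δ x)) ∧
    ((∀ i, δ (iκ i) = δ (iΛ i)) → δ iτ = 0 →
      cubicForm (fun j k h => d3 (phiETEL g) (betaStar θs) (iθ c) j k h x) δ -
        cubicForm (fun j k h => d3 (phiEL g) (betaStar θs) (iθ c) j k h x) δ = 0) := by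
  obtain ⟨w, hw⟩ := hM.hasJet_index x δ
  obtain ⟨z₂, z₃, hz⟩ := hM.hasJet_jac_index x δ c
  have hE := ((((hw iΛ).exp.mul (hz iκ)).add (((hw iΛ).exp.mul (hw iκ)).mul (hz iΛ))).sub
    ((hw iΛ).exp.mul (hz iΛ))).add ((hM.hasJet_tau δ).mul (hz iΛ))
  have hL := (hw iκ).inv_one_sub.mul (hz iκ)
  have eE : lineFun (phiETEL g) (betaStar θs) (iθ c) x δ = fun s =>
      Real.exp (∑ a, s * δ (iΛ a) * g x (θs + s • thetaPart δ) a)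
        * (∑ a, jac g x (θs + s • thetaPart δ) a c * (s * δ (iκ a)))
      + Real.exp (∑ a, s * δ (iΛ a) * g x (θs + s • thetaPart δ) a)
        * (∑ a, s * δ (iκ a) * g x (θs + s • thetaPart δ) a)
        * (∑ a, jac g x (θs + s • thetaPart δ) a c * (s * δ (iΛ a)))
      - Real.exp (∑ a, s * δ (iΛ a) * g x (θs + s • thetaPart δ) a)
        * (∑ a, jac g x (θs + s • thetaPart δ) a c * (s * δ (iΛ a)))
      + (1 + s * δ iτ) * (∑ a, jac g x (θs + s • thetaPart δ) a c * (s * δ (iΛ a))) := by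
    simp only [lineFun_eq, phiETEL_θ, thetaPart_betaStar_add, line_Λ, line_τ, line_κ]
  have eL : lineFun (phiEL g) (betaStar θs) (iθ c) x δ = fun s =>
      (1 - ∑ a, s * δ (iκ a) * g x (θs + s • thetaPart δ) a)⁻¹
        * (∑ a, jac g x (θs + s • thetaPart δ) a c * (s * δ (iκ a))) := by
    simp only [lineFun_eq, phiEL_θ, thetaPart_betaStar_add, line_κ]
  rw [← eE] at hE
  rw [← eL] at hL
  have dE := hM.contDiffAt_phiETEL x (iθ c)
  have dL := hM.contDiffAt_phiEL x (iθ c)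
  rw [← iteratedDeriv_one_lineFun dE, ← iteratedDeriv_one_lineFun dL,
    ← iteratedDeriv_two_lineFun dE, ← iteratedDeriv_two_lineFun dL,
    ← iteratedDeriv_three_lineFun dE, ← iteratedDeriv_three_lineFun dL]
  refine ⟨hE.one.trans (by ring), hL.one.trans (by ring), ?_, fun hk h0 => ?_⟩
  · rw [hE.two, hL.two]; ring
  have e1 : blockDot g θs iΛ δ x = blockDot g θs iκ δ x :=
    Finset.sum_congr rfl fun i _ => by rw [hk]
  have e2 : ∑ a, δ (iΛ a) * jacDir g θs δ a x = ∑ a, δ (iκ a) * jacDir g θs δ a x :=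
    Finset.sum_congr rfl fun i _ => by rw [hk]
  have e3 : jacDot g θs iΛ δ c x = jacDot g θs iκ δ c x :=
    Finset.sum_congr rfl fun i _ => by rw [hk]
  have e4 : (fun a => δ (iΛ a)) = fun a => δ (iκ a) := by simp only [hk]
  rw [hE.three, hL.three, e1, e2, e3, e4, h0]
  ring

end IsRegularModel

end Derivatives

end ETEL

namespace ETEL

/-! ### Population means -/

section Mean

variable {Ω 𝒳 : Type*} [MeasurableSpace Ω] [MeasurableSpace 𝒳] {μ : Measure Ω}
  [IsProbabilityMeasure μ] {X : ℕ → Ω → 𝒳} {b : 𝒳 → ℝ} {d q : ℕ} {f f' : 𝒳 → ℝ}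

theorem Dom.integrable (hX : Measurable (X 0)) (hq : MemLp b q (μ.map (X 0)))
    (hf : Dom b d f) (hd : d ≤ q) : Integrable (fun ω => f (X 0 ω)) μ := by
  have := Measure.isProbabilityMeasure_map (μ := μ) hX.aemeasurable
  obtain ⟨hm, C, hC, h⟩ := hf
  have h1 : MemLp (fun x => 1 + b x) q (μ.map (X 0)) := (memLp_const (1 : ℝ)).add hq
  have hdq : (d : ENNReal) ≤ (q : ENNReal) := Nat.cast_le.2 hd
  have h2 : Integrable (fun x => ‖1 + b x‖ ^ d) (μ.map (X 0)) :=
    (h1.mono_exponent hdq).integrable_norm_pow'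
  have h3 : Integrable f (μ.map (X 0)) :=
    (h2.const_mul C).mono' hm.aestronglyMeasurable (Eventually.of_forall fun x => by
      rw [Real.norm_eq_abs, Real.norm_eq_abs]
      refine (h x).trans (mul_le_mul_of_nonneg_left ?_ hC)
      rw [← abs_pow]
      exact le_abs_self _)
  exact h3.comp_measurable hX

omit [IsProbabilityMeasure μ] in
theorem mean_const_mul (c : ℝ) : mean μ X (fun x => c * f x) = c * mean μ X f :=
  integral_const_mul c _

omit [IsProbabilityMeasure μ] in
theorem mean_add (hf : Integrable (fun ω => f (X 0 ω)) μ)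
    (hf' : Integrable (fun ω => f' (X 0 ω)) μ) :
    mean μ X (fun x => f x + f' x) = mean μ X f + mean μ X f' := integral_add hf hf'

omit [IsProbabilityMeasure μ] in
theorem mean_sub (hf : Integrable (fun ω => f (X 0 ω)) μ)
    (hf' : Integrable (fun ω => f' (X 0 ω)) μ) :
    mean μ X (fun x => f x - f' x) = mean μ X f - mean μ X f' := integral_sub hf hf'

omit [IsProbabilityMeasure μ] in
theorem mean_sum {ι : Type*} (t : Finset ι) {F : ι → 𝒳 → ℝ}
    (h : ∀ i ∈ t, Integrable (fun ω => F i (X 0 ω)) μ) :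
    mean μ X (fun x => ∑ i ∈ t, F i x) = ∑ i ∈ t, mean μ X (F i) := integral_finsetSum t h

theorem mean_const (c : ℝ) : mean μ X (fun _ => c) = c := by simp [mean]

end Mean

/-! ### Matrices -/

section Matrices

variable {m p : ℕ} {W : Matrix (Fin m) (Fin m) ℝ} {G : Matrix (Fin m) (Fin p) ℝ}

/-- Full column rank means that G is injective, and a positive definite form pulled back along an
injective map is positive definite, hence invertible. -/
theorem isUnit_transpose_mul_inv_mul (hW : W.PosDef) (hG : G.rank = p) :
    IsUnit (Gᵀ * W⁻¹ * G) := by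
  have hinj : Function.Injective G.mulVec := by
    have h1 := LinearMap.finrank_range_add_finrank_ker G.mulVecLin
    have h2 : Module.finrank ℝ (LinearMap.range G.mulVecLin) = p := hG
    rw [h2, Module.finrank_fin_fun] at h1
    have h3 : Module.finrank ℝ (LinearMap.ker G.mulVecLin) = 0 := by omega
    exact LinearMap.ker_eq_bot.1 (Submodule.finrank_eq_zero.1 h3)
  have := hW.inv.conjTranspose_mul_mul_same (B := G) hinj
  rw [conjTranspose_eq_transpose_of_trivial] at this
  exact this.isUnit

/-- For square matrices a right inverse is enough, so an explicit solution formula has to be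
verified on one side only. -/
theorem inv_of_mulVec_eq {ι : Type*} [Fintype ι] [DecidableEq ι] {A : Matrix ι ι ℝ}
    {M : (ι → ℝ) → ι → ℝ} (h : ∀ u, A *ᵥ M u = u) :
    IsUnit A ∧ ∀ u, A⁻¹ *ᵥ u = M u := by
  have hA : IsUnit A := mulVec_surjective_iff_isUnit.1 fun u => ⟨M u, h u⟩
  refine ⟨hA, fun u => ?_⟩
  have hdet := (isUnit_iff_isUnit_det A).1 hA
  conv_lhs => rw [← h u]
  rw [mulVec_mulVec, nonsing_inv_mul _ hdet, one_mulVec]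

end Matrices

/-! ### The mean Jacobian of the moment functions and its inverse -/

section Phi1

variable {Ω 𝒳 : Type*} [MeasurableSpace Ω] [MeasurableSpace 𝒳] {m p : ℕ} {μ : Measure Ω}
  [IsProbabilityMeasure μ]
  {X : ℕ → Ω → 𝒳} {g : 𝒳 → (Fin p → ℝ) → Fin m → ℝ} {θs : Fin p → ℝ} {N : Set (Fin p → ℝ)}
  {b : 𝒳 → ℝ}

namespace IsRegularModel

variable (hM : IsRegularModel μ X g θs N b)
include hM

omit [IsProbabilityMeasure μ] in
theorem memLp_six : MemLp b (6 : ℕ) (μ.map (X 0)) := by exact_mod_cast hM.moment_b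

omit [IsProbabilityMeasure μ] in
theorem dom_g (a : Fin m) : Dom b 1 (fun x => g x θs a) := by
  refine ⟨hM.measurable_g_apply hM.mem_N a, 1, zero_le_one, fun x => ?_⟩
  have := hM.norm_iteratedFDeriv_le x hM.mem_N a (Nat.zero_le 4)
  rw [norm_iteratedFDeriv_zero, Real.norm_eq_abs] at this
  linarith

omit [IsProbabilityMeasure μ] in
theorem dom_jac (a : Fin m) (c : Fin p) : Dom b 1 (fun x => jac g x θs a c) := by
  refine ⟨hM.measurable_jac hM.mem_N a c, 1, zero_le_one, fun x => ?_⟩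
  have := hM.norm_iteratedFDeriv_jac_le x hM.mem_N a c (Nat.zero_le 3)
  rw [norm_iteratedFDeriv_zero, Real.norm_eq_abs] at this
  linarith

omit [IsProbabilityMeasure μ] in
theorem dom_blockDot (e : Fin m → Idx m p) (δ : Idx m p → ℝ) : Dom b 1 (blockDot g θs e δ) :=
  Dom.sum hM.b_nonneg fun a _ => (hM.dom_g a).const_mul _

omit [IsProbabilityMeasure μ] in
theorem dom_jacDir (δ : Idx m p → ℝ) (a : Fin m) : Dom b 1 (jacDir g θs δ a) :=
  Dom.sum hM.b_nonneg fun c _ => (hM.dom_jac a c).const_mul _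

theorem integrable_dom {d : ℕ} {f : 𝒳 → ℝ} (hf : Dom b d f) (hd : d ≤ 6) :
    Integrable (fun ω => f (X 0 ω)) μ := hf.integrable (hM.measurable_X 0) hM.memLp_six hd

omit hM [IsProbabilityMeasure μ] in
theorem omega_symm : (OmegaMat g μ X θs)ᵀ = OmegaMat g μ X θs := by
  ext a c
  simp only [transpose_apply, OmegaMat, of_apply]
  congr 1
  ext x
  ring

theorem mean_blockDot (e : Fin m → Idx m p) (δ : Idx m p → ℝ) :
    mean μ X (blockDot g θs e δ) = 0 := by
  unfold blockDot
  rw [mean_sum _ fun a _ => hM.integrable_dom ((hM.dom_g a).const_mul _) (by norm_num)]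
  refine Finset.sum_eq_zero fun a _ => ?_
  rw [mean_const_mul, hM.mean_zero a, mul_zero]

theorem mean_blockDot_mul (e : Fin m → Idx m p) (δ : Idx m p → ℝ) (a : Fin m) :
    mean μ X (fun x => blockDot g θs e δ x * g x θs a) =
      (OmegaMat g μ X θs *ᵥ fun c => δ (e c)) a := by
  have : (fun x => blockDot g θs e δ x * g x θs a) =
      fun x => ∑ c, δ (e c) * (g x θs a * g x θs c) := by
    ext x
    rw [blockDot, Finset.sum_mul]
    exact Finset.sum_congr rfl fun c _ => by ring
  rw [this, mean_sum _ fun c _ =>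
    hM.integrable_dom (((hM.dom_g a).mul (hM.dom_g c)).const_mul _) (by norm_num)]
  exact Finset.sum_congr rfl fun c _ => by rw [mean_const_mul, mul_comm]; rfl

theorem mean_blockDot_sq (e : Fin m → Idx m p) (δ : Idx m p → ℝ) :
    mean μ X (fun x => blockDot g θs e δ x ^ 2) =
      (fun c => δ (e c)) ⬝ᵥ OmegaMat g μ X θs *ᵥ fun c => δ (e c) := by
  have : (fun x => blockDot g θs e δ x ^ 2) =
      fun x => ∑ a, δ (e a) * (blockDot g θs e δ x * g x θs a) := by
    ext x
    rw [sq]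
    nth_rw 2 [blockDot]
    rw [Finset.mul_sum]
    exact Finset.sum_congr rfl fun c _ => by ring
  rw [this, mean_sum _ fun c _ => hM.integrable_dom
    (((hM.dom_blockDot e δ).mul (hM.dom_g c)).const_mul _) (by norm_num)]
  exact Finset.sum_congr rfl fun c _ => by rw [mean_const_mul, hM.mean_blockDot_mul]

theorem mean_jacDir (δ : Idx m p → ℝ) (a : Fin m) :
    mean μ X (jacDir g θs δ a) = (GMat g μ X θs *ᵥ thetaPart δ) a := by
  unfold jacDir
  rw [mean_sum _ fun c _ => hM.integrable_dom ((hM.dom_jac a c).const_mul _) (by norm_num)]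
  exact Finset.sum_congr rfl fun c _ => by rw [mean_const_mul, mul_comm]; rfl

theorem mean_jacDot (e : Fin m → Idx m p) (δ : Idx m p → ℝ) (c : Fin p) :
    mean μ X (jacDot g θs e δ c) = ((GMat g μ X θs)ᵀ *ᵥ fun a => δ (e a)) c := by
  have : jacDot g θs e δ c = fun x => ∑ a, δ (e a) * jac g x θs a c := by
    ext x
    exact Finset.sum_congr rfl fun a _ => mul_comm _ _
  rw [this, mean_sum _ fun a _ => hM.integrable_dom ((hM.dom_jac a c).const_mul _) (by norm_num)]
  exact Finset.sum_congr rfl fun c _ => by rw [mean_const_mul, mul_comm]; rfl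

/-- v'Ωv = E[(v'g)²] ≥ 0, and a nonsingular positive semidefinite matrix is positive definite. -/
theorem omega_posDef : (OmegaMat g μ X θs).PosDef := by
  have hs : (OmegaMat g μ X θs).PosSemidef := by
    refine PosSemidef.of_dotProduct_mulVec_nonneg ?_ fun v => ?_
    · rw [IsHermitian, conjTranspose_eq_transpose_of_trivial, omega_symm]
    · rw [star_trivial]
      -- Any direction whose κ-block is `v` would do.
      have h := hM.mean_blockDot_sq iκ (ETEL.mk 0 v 0 0)
      have e : (fun c => (ETEL.mk 0 v 0 0 : Idx m p → ℝ) (iκ c)) = v := rfl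
      rw [e] at h
      rw [← h]
      exact integral_nonneg fun ω => sq_nonneg _
  exact hs.posDef_iff_isUnit.2 hM.omega_nonsingular

theorem isUnit_gram :
    IsUnit ((GMat g μ X θs)ᵀ * (OmegaMat g μ X θs)⁻¹ * GMat g μ X θs) :=
  isUnit_transpose_mul_inv_mul hM.omega_posDef hM.full_rank

omit [IsProbabilityMeasure μ] in
theorem omega_mul_inv : OmegaMat g μ X θs * (OmegaMat g μ X θs)⁻¹ = 1 :=
  mul_nonsing_inv _ ((isUnit_iff_isUnit_det _).1 hM.omega_nonsingular)

omit hM [IsProbabilityMeasure μ] in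
theorem omega_inv_symm : ((OmegaMat g μ X θs)⁻¹)ᵀ = (OmegaMat g μ X θs)⁻¹ := by
  rw [transpose_nonsing_inv, omega_symm]

omit hM [IsProbabilityMeasure μ] in
theorem sigma_symm : (SigmaMat g μ X θs)ᵀ = SigmaMat g μ X θs := by
  rw [SigmaMat, transpose_nonsing_inv, transpose_mul, transpose_mul, transpose_transpose,
    omega_inv_symm, Matrix.mul_assoc]

theorem sigma_mul_gram :
    SigmaMat g μ X θs * ((GMat g μ X θs)ᵀ * (OmegaMat g μ X θs)⁻¹ * GMat g μ X θs) = 1 :=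
  nonsing_inv_mul _ ((isUnit_iff_isUnit_det _).1 hM.isUnit_gram)

theorem H_mul_G : HMat g μ X θs * GMat g μ X θs = 1 := by
  have := hM.sigma_mul_gram
  simpa only [HMat, Matrix.mul_assoc] using this

omit hM [IsProbabilityMeasure μ] in
theorem H_transpose : (HMat g μ X θs)ᵀ =
    (OmegaMat g μ X θs)⁻¹ * GMat g μ X θs * SigmaMat g μ X θs := by
  rw [HMat, transpose_mul, transpose_mul, transpose_transpose, omega_inv_symm, sigma_symm,
    Matrix.mul_assoc]

omit hM [IsProbabilityMeasure μ] in
theorem P_eq : PMat g μ X θs =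
    (OmegaMat g μ X θs)⁻¹ - (OmegaMat g μ X θs)⁻¹ * GMat g μ X θs * HMat g μ X θs := by
  simp only [PMat, HMat, Matrix.mul_assoc]

omit hM [IsProbabilityMeasure μ] in
theorem P_symm : (PMat g μ X θs)ᵀ = PMat g μ X θs := by
  simp only [PMat, transpose_sub, transpose_mul, transpose_transpose, omega_inv_symm, sigma_symm,
    Matrix.mul_assoc]

theorem P_mul_G : PMat g μ X θs * GMat g μ X θs = 0 := by
  rw [P_eq, Matrix.sub_mul, Matrix.mul_assoc _ _ (GMat g μ X θs), hM.H_mul_G, Matrix.mul_one,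
    sub_self]

theorem G_transpose_mul_P : (GMat g μ X θs)ᵀ * PMat g μ X θs = 0 := by
  have := congrArg transpose hM.P_mul_G
  rwa [transpose_mul, P_symm, transpose_zero] at this

omit [IsProbabilityMeasure μ] in
theorem omega_mul_P : OmegaMat g μ X θs * PMat g μ X θs = 1 - GMat g μ X θs * HMat g μ X θs := by
  rw [P_eq, Matrix.mul_sub, hM.omega_mul_inv, ← Matrix.mul_assoc, ← Matrix.mul_assoc,
    hM.omega_mul_inv, Matrix.one_mul]

omit [IsProbabilityMeasure μ] in
theorem omega_mul_H_transpose :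
    OmegaMat g μ X θs * (HMat g μ X θs)ᵀ = GMat g μ X θs * SigmaMat g μ X θs := by
  rw [H_transpose, ← Matrix.mul_assoc, ← Matrix.mul_assoc, hM.omega_mul_inv, Matrix.one_mul]

theorem P_mul_omega_mul_P : PMat g μ X θs * (OmegaMat g μ X θs * PMat g μ X θs) =
    PMat g μ X θs := by
  rw [hM.omega_mul_P, Matrix.mul_sub, ← Matrix.mul_assoc, hM.P_mul_G, Matrix.zero_mul, sub_zero,
    Matrix.mul_one]

/-- In terms of moments: Pg and the influence function -Hg are uncorrelated. This orthogonality is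
what removes the difference of the third-order terms from the variance. -/
theorem P_mul_omega_mul_H_transpose :
    PMat g μ X θs * (OmegaMat g μ X θs * (HMat g μ X θs)ᵀ) = 0 := by
  rw [hM.omega_mul_H_transpose, ← Matrix.mul_assoc, hM.P_mul_G, Matrix.zero_mul]

theorem G_transpose_mul_H_transpose : (GMat g μ X θs)ᵀ * (HMat g μ X θs)ᵀ = 1 := by
  rw [← transpose_mul, hM.H_mul_G, transpose_one]

/-- The matrix of the mean first derivatives is the same for ETEL and EL. -/
theorem Phi1_mulVec (δ : Idx m p → ℝ) :
    Phi1 μ X (phiETEL g) (betaStar θs) *ᵥ δ =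
      ETEL.mk (-δ iτ) (OmegaMat g μ X θs *ᵥ (fun a => δ (iΛ a)) + GMat g μ X θs *ᵥ thetaPart δ)
        (OmegaMat g μ X θs *ᵥ ((fun a => δ (iκ a)) - fun a => δ (iΛ a)))
        ((GMat g μ X θs)ᵀ *ᵥ fun a => δ (iκ a)) ∧
    Phi1 μ X (phiEL g) (betaStar θs) *ᵥ δ = Phi1 μ X (phiETEL g) (betaStar θs) *ᵥ δ := by
  have key : ∀ φ : 𝒳 → (Idx m p → ℝ) → Idx m p → ℝ, HasEnvelope φ (betaStar θs) b → ∀ l,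
      (Phi1 μ X φ (betaStar θs) *ᵥ δ) l =
        mean μ X (fun x => ∑ j, δ j * d1 φ (betaStar θs) l j x) := fun φ hφ l => by
    rw [mean_sum _ fun j _ => hM.integrable_dom ((hφ.dom1 l j).const_mul _) (by norm_num)]
    change ∑ j, mean μ X (d1 φ (betaStar θs) l j) * δ j = _
    exact Finset.sum_congr rfl fun j _ => by rw [mean_const_mul, mul_comm]
  have ig := fun a => hM.integrable_dom (hM.dom_g a) (by norm_num)
  have ib := fun e => hM.integrable_dom (hM.dom_blockDot e δ) (by norm_num)
  have ibg := fun e a => hM.integrable_dom ((hM.dom_blockDot e δ).mul (hM.dom_g a)) (by norm_num)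
  have hE : Phi1 μ X (phiETEL g) (betaStar θs) *ᵥ δ =
      ETEL.mk (-δ iτ) (OmegaMat g μ X θs *ᵥ (fun a => δ (iΛ a)) + GMat g μ X θs *ᵥ thetaPart δ)
        (OmegaMat g μ X θs *ᵥ ((fun a => δ (iκ a)) - fun a => δ (iΛ a)))
        ((GMat g μ X θs)ᵀ *ᵥ fun a => δ (iκ a)) := by
    ext l
    rw [key _ hM.hasEnvelope_phiETEL]
    rcases l with _ | a | a | c
    · simp only [(hM.deriv_phi_τ _ δ).1]
      rw [mean_sub (ib iΛ) (integrable_const _), hM.mean_blockDot, mean_const]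
      exact zero_sub _
    · simp only [hM.deriv_phi_κ _ δ]
      rw [mean_add (ibg iΛ a) (hM.integrable_dom (hM.dom_jacDir δ a) (by norm_num)),
        hM.mean_blockDot_mul, hM.mean_jacDir]
      rfl
    -- The extra ETEL term δ_τ g is isolated here; it has mean zero, which is why both mean
    -- Jacobians coincide.
    · have : (fun x => ∑ j, δ j * d1 (phiETEL g) (betaStar θs) (iΛ a) j x) = fun x =>
          δ iτ * g x θs a + (blockDot g θs iκ δ x * g x θs a - blockDot g θs iΛ δ x * g x θs a) := by
        ext x; rw [(hM.deriv_phi_Λ x δ a).1]; ring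
      rw [this, mean_add ((ig a).const_mul _) ((ibg iκ a).sub (ibg iΛ a)), mean_const_mul,
        hM.mean_zero, mean_sub (ibg iκ a) (ibg iΛ a), hM.mean_blockDot_mul, hM.mean_blockDot_mul,
        mul_zero, zero_add, mulVec_sub]
      rfl
    · simp only [(hM.deriv_phi_θ _ δ c).1]
      rw [hM.mean_jacDot]
      rfl
  refine ⟨hE, ?_⟩
  ext l
  rcases l with _ | a | a | c
  · rfl
  · rfl
  · rw [hE, key _ hM.hasEnvelope_phiEL]
    have : (fun x => ∑ j, δ j * d1 (phiEL g) (betaStar θs) (iΛ a) j x) = fun x =>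
          blockDot g θs iκ δ x * g x θs a - blockDot g θs iΛ δ x * g x θs a := by
      ext x; rw [(hM.deriv_phi_Λ x δ a).2.1]; ring
    rw [this, mean_sub (ibg iκ a) (ibg iΛ a), hM.mean_blockDot_mul, hM.mean_blockDot_mul,
      mulVec_sub]
    rfl
  · rw [key _ hM.hasEnvelope_phiEL, key _ hM.hasEnvelope_phiETEL]
    simp only [(hM.deriv_phi_θ _ δ c).1, (hM.deriv_phi_θ _ δ c).2.1]

theorem Phi1_phiEL : Phi1 μ X (phiEL g) (betaStar θs) = Phi1 μ X (phiETEL g) (betaStar θs) :=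
  mulVec_injective (funext fun δ => (hM.Phi1_mulVec δ).2)

/-- The inverse of the matrix of the mean first derivatives. -/
theorem isUnit_Phi1_and_inv_mulVec :
    IsUnit (Phi1 μ X (phiETEL g) (betaStar θs)) ∧ ∀ u : Idx m p → ℝ,
    (Phi1 μ X (phiETEL g) (betaStar θs))⁻¹ *ᵥ u =
      ETEL.mk (-u iτ)
        (PMat g μ X θs *ᵥ ((fun a => u (iκ a)) + fun a => u (iΛ a))
          + (HMat g μ X θs)ᵀ *ᵥ thetaPart u)
        (PMat g μ X θs *ᵥ ((fun a => u (iκ a)) + fun a => u (iΛ a))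
          + (HMat g μ X θs)ᵀ *ᵥ thetaPart u - (OmegaMat g μ X θs)⁻¹ *ᵥ fun a => u (iΛ a))
        (HMat g μ X θs *ᵥ ((fun a => u (iκ a)) + fun a => u (iΛ a))
          - SigmaMat g μ X θs *ᵥ thetaPart u) := by
  -- The candidate solves Ωλ + Gθ = u_κ, Ω(κ - λ) = u_λ, G'κ = u_θ. Adding the first two gives Ωκ +
  -- Gθ = u_κ + u_λ, which with G'κ = u_θ is a bordered system inverted by P, H and Σ; λ then
  -- follows from κ.
  refine inv_of_mulVec_eq fun u => ?_
  rw [(hM.Phi1_mulVec _).1]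
  set uκ : Fin m → ℝ := fun a => u (iκ a)
  set uΛ : Fin m → ℝ := fun a => u (iΛ a)
  set uθ : Fin p → ℝ := thetaPart u
  set Wm := OmegaMat g μ X θs
  set P := PMat g μ X θs
  set H := HMat g μ X θs
  set G := GMat g μ X θs
  set S := SigmaMat g μ X θs
  have e1 : Wm *ᵥ (P *ᵥ (uκ + uΛ) + Hᵀ *ᵥ uθ - Wm⁻¹ *ᵥ uΛ) + G *ᵥ (H *ᵥ (uκ + uΛ) - S *ᵥ uθ)
      = uκ := by
    simp only [mulVec_add, mulVec_sub, mulVec_mulVec, Wm, P, H, G, S, hM.omega_mul_P,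
      hM.omega_mul_H_transpose, hM.omega_mul_inv, sub_mulVec, one_mulVec]
    abel
  have e2 : Wm *ᵥ (P *ᵥ (uκ + uΛ) + Hᵀ *ᵥ uθ - (P *ᵥ (uκ + uΛ) + Hᵀ *ᵥ uθ - Wm⁻¹ *ᵥ uΛ))
      = uΛ := by
    rw [sub_sub_cancel, mulVec_mulVec, hM.omega_mul_inv, one_mulVec]
  have e3 : Gᵀ *ᵥ (P *ᵥ (uκ + uΛ) + Hᵀ *ᵥ uθ) = uθ := by
    rw [mulVec_add, mulVec_mulVec, mulVec_mulVec, hM.G_transpose_mul_P,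
      hM.G_transpose_mul_H_transpose, zero_mulVec, one_mulVec, zero_add]
  ext l
  rcases l with _ | a | a | c
  · exact neg_neg _
  · exact congrFun e1 a
  · exact congrFun e2 a
  · exact congrFun e3 c

end IsRegularModel

end Phi1

end ETEL

namespace ETEL

/-! ### Contractions of the terms of the expansion -/

section Nsum

variable {Ω 𝒳 : Type*} {X : ℕ → Ω → 𝒳} {n : ℕ} {ω : Ω} {f f' : 𝒳 → ℝ}

theorem nsum_sub : nsum X n (fun x => f x - f' x) ω = nsum X n f ω - nsum X n f' ω := by
  simp only [nsum, Finset.sum_sub_distrib, mul_sub]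

theorem nsum_const_mul (c : ℝ) : nsum X n (fun x => c * f x) ω = c * nsum X n f ω := by
  simp only [nsum, ← Finset.mul_sum]
  ring

theorem nsum_zero : nsum X n (fun _ => 0) ω = 0 := by simp [nsum]

theorem nsum_sum {ι : Type*} (t : Finset ι) (F : ι → 𝒳 → ℝ) :
    nsum X n (fun x => ∑ i ∈ t, F i x) ω = ∑ i ∈ t, nsum X n (F i) ω := by
  simp only [nsum, ← Finset.mul_sum]
  rw [Finset.sum_comm]

end Nsum

section Contraction

variable {Ω 𝒳 ι : Type*} [MeasurableSpace Ω] [Fintype ι] [DecidableEq ι]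
  {μ : Measure Ω} {X : ℕ → Ω → 𝒳} {φ : 𝒳 → (ι → ℝ) → ι → ℝ} {βs : ι → ℝ} {n : ℕ} {ω : Ω}

theorem PsiBar_eq (l : ι) :
    PsiBar μ X φ βs n ω l = -((Phi1 μ X φ βs)⁻¹ *ᵥ PhiBar X φ βs n ω) l := rfl

/-- Contraction in the trailing indices commutes with applying the inverse Jacobian in the first.
Taking `κ` to be a product type covers the arrays with two and three trailing indices. -/
theorem sum_neg_sum_mul {κ : Type*} [Fintype κ] (A : Matrix ι ι ℝ) (F : ι → κ → ℝ) (c : κ → ℝ)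
    (l : ι) :
    ∑ i, (-∑ h, A l h * F h i) * c i = -(A *ᵥ fun h => ∑ i, c i * F h i) l := by
  simp only [mulVec, dotProduct, Finset.mul_sum, neg_mul, Finset.sum_mul, Finset.sum_neg_distrib]
  rw [Finset.sum_comm]
  exact congrArg Neg.neg (Finset.sum_congr rfl fun h _ => Finset.sum_congr rfl fun j _ => by ring)

theorem sum_PsiBar1_mul (v : ι → ℝ) (l : ι) :
    ∑ j, PsiBar1 μ X φ βs n ω l j * v j = -((Phi1 μ X φ βs)⁻¹ *ᵥ fun h =>
      nsum X n (fun x => ∑ j, v j * d1 φ βs h j x - (Phi1 μ X φ βs *ᵥ v) h) ω) l := by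
  have e : ∀ h, nsum X n (fun x => ∑ j, v j * d1 φ βs h j x - (Phi1 μ X φ βs *ᵥ v) h) ω =
      ∑ j, v j * PhiBar1 μ X φ βs n ω h j := fun h => by
    have : (fun x => ∑ j, v j * d1 φ βs h j x - (Phi1 μ X φ βs *ᵥ v) h) =
        fun x => ∑ j, v j * (d1 φ βs h j x - Phi1 μ X φ βs h j) := by
      ext x
      simp only [mulVec, dotProduct, ← Finset.sum_sub_distrib]
      exact Finset.sum_congr rfl fun j _ => by ring
    rw [this, nsum_sum]
    exact Finset.sum_congr rfl fun j _ => nsum_const_mul _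
  simp only [e]
  exact sum_neg_sum_mul _ _ _ _

theorem sum_Psi2_mul_mul (v w : ι → ℝ) (l : ι) :
    ∑ j, ∑ k, Psi2 μ X φ βs l j k * v j * w k = -((Phi1 μ X φ βs)⁻¹ *ᵥ fun h =>
      ∑ j, ∑ k, v j * w k * Phi2 μ X φ βs h j k) l := by
  have := sum_neg_sum_mul (κ := ι × ι) (Phi1 μ X φ βs)⁻¹
    (fun h i => Phi2 μ X φ βs h i.1 i.2) (fun i => v i.1 * w i.2) l
  simp only [Fintype.sum_prod_type, ← mul_assoc] at this
  exact this

theorem sum_PsiBar2_mul_mul (v : ι → ℝ) (l : ι) :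
    ∑ j, ∑ k, PsiBar2 μ X φ βs n ω l j k * v j * v k = -((Phi1 μ X φ βs)⁻¹ *ᵥ fun h =>
      nsum X n (fun x => quadForm (fun j k => d2 φ βs h j k x) v
        - quadForm (Phi2 μ X φ βs h) v) ω) l := by
  have e : ∀ h, nsum X n (fun x => quadForm (fun j k => d2 φ βs h j k x) v
      - quadForm (Phi2 μ X φ βs h) v) ω = ∑ j, ∑ k, v j * v k * PhiBar2 μ X φ βs n ω h j k :=
    fun h => by
    have : (fun x => quadForm (fun j k => d2 φ βs h j k x) v - quadForm (Phi2 μ X φ βs h) v) =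
        fun x => ∑ j, ∑ k, v j * v k * (d2 φ βs h j k x - Phi2 μ X φ βs h j k) := by
      ext x
      simp only [quadForm, ← Finset.sum_sub_distrib, mul_sub]
    rw [this, nsum_sum]
    refine Finset.sum_congr rfl fun j _ => ?_
    rw [nsum_sum]
    exact Finset.sum_congr rfl fun k _ => nsum_const_mul _
  simp only [e]
  have := sum_neg_sum_mul (κ := ι × ι) (Phi1 μ X φ βs)⁻¹
    (fun h i => PhiBar2 μ X φ βs n ω h i.1 i.2) (fun i => v i.1 * v i.2) l
  simp only [Fintype.sum_prod_type, ← mul_assoc] at this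
  exact this

theorem sum_Psi3_mul_mul_mul (v : ι → ℝ) (l : ι) :
    ∑ j, ∑ k, ∑ h, Psi3 μ X φ βs l j k h * v j * v k * v h = -((Phi1 μ X φ βs)⁻¹ *ᵥ fun q =>
      cubicForm (Phi3 μ X φ βs q) v) l := by
  have := sum_neg_sum_mul (κ := ι × ι × ι) (Phi1 μ X φ βs)⁻¹
    (fun h i => Phi3 μ X φ βs h i.1 i.2.1 i.2.2) (fun i => v i.1 * v i.2.1 * v i.2.2) l
  simp only [Fintype.sum_prod_type, ← mul_assoc] at this
  exact this

/-- Only the first derivatives in direction Ψ̄ and the quadratic form at Ψ̄ enter, so Q̄ can be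
compared without looking at single entries. -/
theorem QBar_eq (l : ι) :
    QBar μ X φ βs n ω l = -((Phi1 μ X φ βs)⁻¹ *ᵥ fun h =>
      nsum X n (fun x => ∑ j, PsiBar μ X φ βs n ω j * d1 φ βs h j x
        - (Phi1 μ X φ βs *ᵥ PsiBar μ X φ βs n ω) h) ω
      + 1 / 2 * quadForm (Phi2 μ X φ βs h) (PsiBar μ X φ βs n ω)) l := by
  have : (fun h => nsum X n (fun x => ∑ j, PsiBar μ X φ βs n ω j * d1 φ βs h j x
        - (Phi1 μ X φ βs *ᵥ PsiBar μ X φ βs n ω) h) ω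
      + 1 / 2 * quadForm (Phi2 μ X φ βs h) (PsiBar μ X φ βs n ω)) =
      (fun h => nsum X n (fun x => ∑ j, PsiBar μ X φ βs n ω j * d1 φ βs h j x
        - (Phi1 μ X φ βs *ᵥ PsiBar μ X φ βs n ω) h) ω)
      + (1 / 2 : ℝ) • fun h => quadForm (Phi2 μ X φ βs h) (PsiBar μ X φ βs n ω) := rfl
  rw [this, mulVec_add, mulVec_smul, Pi.add_apply, Pi.smul_apply, smul_eq_mul, QBar,
    sum_PsiBar1_mul, sum_Psi2_mul_mul, neg_add, mul_neg]
  rfl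

variable [MeasurableSpace 𝒳] [IsProbabilityMeasure μ]

theorem quadForm_Phi2 {l : ι} (v : ι → ℝ)
    (h : ∀ j k, Integrable (fun ω => d2 φ βs l j k (X 0 ω)) μ) :
    quadForm (Phi2 μ X φ βs l) v = mean μ X (fun x => quadForm (fun j k => d2 φ βs l j k x) v) := by
  unfold quadForm
  rw [mean_sum _ fun j _ => integrable_finsetSum _ fun k _ => (h j k).const_mul _]
  refine Finset.sum_congr rfl fun j _ => ?_
  rw [mean_sum _ fun k _ => (h j k).const_mul _]
  exact Finset.sum_congr rfl fun k _ => (mean_const_mul _).symm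

theorem cubicForm_Phi3 {l : ι} (v : ι → ℝ)
    (hi : ∀ j k h, Integrable (fun ω => d3 φ βs l j k h (X 0 ω)) μ) :
    cubicForm (Phi3 μ X φ βs l) v =
      mean μ X (fun x => cubicForm (fun j k h => d3 φ βs l j k h x) v) := by
  unfold cubicForm
  rw [mean_sum _ fun j _ => integrable_finsetSum _ fun k _ =>
    integrable_finsetSum _ fun h _ => (hi j k h).const_mul _]
  refine Finset.sum_congr rfl fun j _ => ?_
  rw [mean_sum _ fun k _ => integrable_finsetSum _ fun h _ => (hi j k h).const_mul _]
  refine Finset.sum_congr rfl fun k _ => ?_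
  rw [mean_sum _ fun h _ => (hi j k h).const_mul _]
  exact Finset.sum_congr rfl fun h _ => (mean_const_mul _).symm

end Contraction

end ETEL

namespace ETEL

/-! ### The terms of the expansions of ETEL and EL -/

section Terms

variable {Ω 𝒳 : Type*} [MeasurableSpace Ω] {m p : ℕ}

/-- The common first-order term of ETEL and EL. -/
noncomputable def psiVec (g : 𝒳 → (Fin p → ℝ) → Fin m → ℝ) (μ : Measure Ω) (X : ℕ → Ω → 𝒳)
    (θs : Fin p → ℝ) (n : ℕ) (ω : Ω) : Idx m p → ℝ :=
  mk 0 (-(PMat g μ X θs *ᵥ gBar g X θs n ω)) (-(PMat g μ X θs *ᵥ gBar g X θs n ω))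
    (-(HMat g μ X θs *ᵥ gBar g X θs n ω))

variable {g : 𝒳 → (Fin p → ℝ) → Fin m → ℝ} {θs : Fin p → ℝ}

theorem phiETEL_betaStar (x : 𝒳) :
    phiETEL g x (betaStar θs) = mk 0 (g x θs) 0 0 := by
  ext l
  have h1 : (fun a : Fin m => (betaStar θs : Idx m p → ℝ) (iκ a)) = 0 := rfl
  have h2 : (fun a : Fin m => (betaStar θs : Idx m p → ℝ) (iΛ a)) = 0 := rfl
  have h3 : (betaStar θs : Idx m p → ℝ) iτ = 1 := rfl
  have h4 : (fun c : Fin p => (betaStar θs : Idx m p → ℝ) (iθ c)) = θs := rfl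
  rcases l with _ | a | a | c <;> simp only [phiETEL, h1, h2, h3, h4] <;> simp [mk]

theorem phiEL_betaStar (x : 𝒳) :
    phiEL g x (betaStar θs) = mk 0 (g x θs) 0 0 := by
  ext l
  have h1 : (fun a : Fin m => (betaStar θs : Idx m p → ℝ) (iκ a)) = 0 := rfl
  have h2 : (fun a : Fin m => (betaStar θs : Idx m p → ℝ) (iΛ a)) = 0 := rfl
  have h3 : (betaStar θs : Idx m p → ℝ) iτ = 1 := rfl
  have h4 : (fun c : Fin p => (betaStar θs : Idx m p → ℝ) (iθ c)) = θs := rfl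
  rcases l with _ | a | a | c <;> simp only [phiEL, h1, h2, h3, h4] <;> simp [mk]

theorem PhiBar_eq {X : ℕ → Ω → 𝒳} {φ : 𝒳 → (Idx m p → ℝ) → Idx m p → ℝ}
    (h : ∀ x, φ x (betaStar θs) = mk 0 (g x θs) 0 0) (n : ℕ) (ω : Ω) :
    PhiBar X φ (betaStar θs) n ω = mk 0 (gBar g X θs n ω) 0 0 := by
  ext l
  simp only [PhiBar, h]
  rcases l with _ | a | a | c
  · exact nsum_zero
  · rfl
  · exact nsum_zero
  · exact nsum_zero

theorem d2_phiEL_τ {βs : Idx m p → ℝ} (i : Unit) :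
    d2 (phiEL g) βs (Sum.inl i) = d2 (phiETEL g) βs (Sum.inl i) := rfl

theorem d2_phiEL_κ {βs : Idx m p → ℝ} (a : Fin m) :
    d2 (phiEL g) βs (iκ a) = d2 (phiETEL g) βs (iκ a) := rfl

theorem d3_phiEL_τ {βs : Idx m p → ℝ} (i : Unit) :
    d3 (phiEL g) βs (Sum.inl i) = d3 (phiETEL g) βs (Sum.inl i) := rfl

theorem d3_phiEL_κ {βs : Idx m p → ℝ} (a : Fin m) :
    d3 (phiEL g) βs (iκ a) = d3 (phiETEL g) βs (iκ a) := rfl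

variable {X : ℕ → Ω → 𝒳}

theorem nsum_blockDot (e : Fin m → Idx m p) (δ : Idx m p → ℝ) (n : ℕ) (ω : Ω) :
    nsum X n (blockDot g θs e δ) ω = (fun a => δ (e a)) ⬝ᵥ gBar g X θs n ω := by
  unfold blockDot
  rw [nsum_sum]
  exact Finset.sum_congr rfl fun a _ => nsum_const_mul _

theorem blockDot_add (e : Fin m → Idx m p) (δ δ' : Idx m p → ℝ) (x : 𝒳) :
    blockDot g θs e (δ + δ') x = blockDot g θs e δ x + blockDot g θs e δ' x := by
  simp only [blockDot, Pi.add_apply, add_mul, Finset.sum_add_distrib]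

theorem jacDir_add (δ δ' : Idx m p → ℝ) (a : Fin m) (x : 𝒳) :
    jacDir g θs (δ + δ') a x = jacDir g θs δ a x + jacDir g θs δ' a x := by
  simp only [jacDir, Pi.add_apply, add_mul, Finset.sum_add_distrib]

theorem jacDot_add (e : Fin m → Idx m p) (δ δ' : Idx m p → ℝ) (c : Fin p) (x : 𝒳) :
    jacDot g θs e (δ + δ') c x = jacDot g θs e δ c x + jacDot g θs e δ' c x := by
  simp only [jacDot, Pi.add_apply, mul_add, Finset.sum_add_distrib]

variable [MeasurableSpace 𝒳] {μ : Measure Ω} [IsProbabilityMeasure μ]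
  {N : Set (Fin p → ℝ)} {b : 𝒳 → ℝ}

namespace IsRegularModel

variable (hM : IsRegularModel μ X g θs N b)
include hM

theorem PsiBar_phiETEL (n : ℕ) (ω : Ω) :
    PsiBar μ X (phiETEL g) (betaStar θs) n ω = psiVec g μ X θs n ω := by
  have : PsiBar μ X (phiETEL g) (betaStar θs) n ω =
      -((Phi1 μ X (phiETEL g) (betaStar θs))⁻¹ *ᵥ PhiBar X (phiETEL g) (betaStar θs) n ω) := rfl
  rw [this, PhiBar_eq phiETEL_betaStar, hM.isUnit_Phi1_and_inv_mulVec.2]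
  have h1 : (fun a => (ETEL.mk 0 (gBar g X θs n ω) 0 0 : Idx m p → ℝ) (iκ a)) =
    gBar g X θs n ω := rfl
  have h2 : (fun a => (ETEL.mk 0 (gBar g X θs n ω) 0 0 : Idx m p → ℝ) (iΛ a)) = 0 := rfl
  have h3 : thetaPart (ETEL.mk 0 (gBar g X θs n ω) 0 0 : Idx m p → ℝ) = 0 := rfl
  rw [h1, h2, h3]
  ext l
  rcases l with _ | a | a | c <;> simp [psiVec, ETEL.mk]

theorem PsiBar_phiEL (n : ℕ) (ω : Ω) :
    PsiBar μ X (phiEL g) (betaStar θs) n ω = psiVec g μ X θs n ω := by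
  rw [← hM.PsiBar_phiETEL]
  have h1 : PsiBar μ X (phiETEL g) (betaStar θs) n ω =
      -((Phi1 μ X (phiETEL g) (betaStar θs))⁻¹ *ᵥ PhiBar X (phiETEL g) (betaStar θs) n ω) := rfl
  have h2 : PsiBar μ X (phiEL g) (betaStar θs) n ω =
      -((Phi1 μ X (phiEL g) (betaStar θs))⁻¹ *ᵥ PhiBar X (phiEL g) (betaStar θs) n ω) := rfl
  rw [h1, h2, PhiBar_eq phiETEL_betaStar, PhiBar_eq phiEL_betaStar, hM.Phi1_phiEL]

theorem sum_d1_phiEL {δ : Idx m p → ℝ} (h : δ iτ = 0) (l : Idx m p) (x : 𝒳) :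
    ∑ j, δ j * d1 (phiEL g) (betaStar θs) l j x =
      ∑ j, δ j * d1 (phiETEL g) (betaStar θs) l j x := by
  rcases l with _ | a | a | c
  · rfl
  · rfl
  · rw [(hM.deriv_phi_Λ x δ a).1, (hM.deriv_phi_Λ x δ a).2.1, h]
    ring
  · rw [(hM.deriv_phi_θ x δ c).1, (hM.deriv_phi_θ x δ c).2.1]

omit hM in
theorem blockDot_congr {δ : Idx m p → ℝ} (h : ∀ i, δ (iκ i) = δ (iΛ i)) :
    blockDot g θs iΛ δ = blockDot g θs iκ δ := by
  ext x
  simp only [blockDot, h]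

omit hM in
theorem jacDot_congr {δ : Idx m p → ℝ} (h : ∀ i, δ (iκ i) = δ (iΛ i)) (c : Fin p) :
    jacDot g θs iΛ δ c = jacDot g θs iκ δ c := by
  ext x
  simp only [jacDot, h]

theorem quadForm_d2_phiEL {δ : Idx m p → ℝ} (h : δ iτ = 0) (h' : ∀ i, δ (iκ i) = δ (iΛ i))
    (l : Idx m p) (x : 𝒳) :
    quadForm (fun j k => d2 (phiEL g) (betaStar θs) l j k x) δ =
      quadForm (fun j k => d2 (phiETEL g) (betaStar θs) l j k x) δ := by
  rcases l with _ | a | a | c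
  · rfl
  · rfl
  · rw [eq_comm, ← sub_eq_zero, (hM.deriv_phi_Λ x δ a).2.2.1, blockDot_congr h', h]
    ring
  · rw [eq_comm, ← sub_eq_zero, (hM.deriv_phi_θ x δ c).2.2.1, blockDot_congr h', h]
    ring

theorem quadForm_Phi2_phiETEL (l : Idx m p) (δ : Idx m p → ℝ) :
    quadForm (Phi2 μ X (phiETEL g) (betaStar θs) l) δ =
      mean μ X fun x => quadForm (fun j k => d2 (phiETEL g) (betaStar θs) l j k x) δ :=
  quadForm_Phi2 δ fun j k => hM.integrable_dom (hM.hasEnvelope_phiETEL.dom2 l j k) (by norm_num)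

theorem quadForm_Phi2_phiEL (l : Idx m p) (δ : Idx m p → ℝ) :
    quadForm (Phi2 μ X (phiEL g) (betaStar θs) l) δ =
      mean μ X fun x => quadForm (fun j k => d2 (phiEL g) (betaStar θs) l j k x) δ :=
  quadForm_Phi2 δ fun j k => hM.integrable_dom (hM.hasEnvelope_phiEL.dom2 l j k) (by norm_num)

/-- Ψ̄ has zero τ-part and equal κ- and λ-parts; in such directions the first derivatives and the
second-order forms of the two systems agree for every x, not only in mean. -/
theorem QBar_phiEL (n : ℕ) (ω : Ω) :
    QBar μ X (phiEL g) (betaStar θs) n ω = QBar μ X (phiETEL g) (betaStar θs) n ω := by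
  ext l
  rw [QBar_eq, QBar_eq, hM.PsiBar_phiEL, hM.PsiBar_phiETEL, hM.Phi1_phiEL]
  congr 3
  ext h
  rw [hM.quadForm_Phi2_phiETEL, hM.quadForm_Phi2_phiEL]
  have h1 : psiVec g μ X θs n ω iτ = 0 := rfl
  have h2 : ∀ i, psiVec g μ X θs n ω (iκ i) = psiVec g μ X θs n ω (iΛ i) := fun _ => rfl
  simp only [hM.sum_d1_phiEL h1, hM.quadForm_d2_phiEL h1 h2]

omit hM [IsProbabilityMeasure μ] in
theorem P_mulVec_dotProduct (v w : Fin m → ℝ) :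
    (PMat g μ X θs *ᵥ v) ⬝ᵥ w = v ⬝ᵥ PMat g μ X θs *ᵥ w := by
  rw [dotProduct_mulVec, ← mulVec_transpose, P_symm]

theorem P_mulVec_dotProduct_omega (v : Fin m → ℝ) :
    (PMat g μ X θs *ᵥ v) ⬝ᵥ (OmegaMat g μ X θs *ᵥ (PMat g μ X θs *ᵥ v)) =
      v ⬝ᵥ PMat g μ X θs *ᵥ v := by
  rw [P_mulVec_dotProduct, mulVec_mulVec, mulVec_mulVec, Matrix.mul_assoc, hM.P_mul_omega_mul_P]

theorem P_mulVec_dotProduct_G (v : Fin m → ℝ) (w : Fin p → ℝ) :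
    (PMat g μ X θs *ᵥ v) ⬝ᵥ (GMat g μ X θs *ᵥ w) = 0 := by
  rw [P_mulVec_dotProduct, mulVec_mulVec, hM.P_mul_G, zero_mulVec, dotProduct_zero]

theorem mean_sum_mul_jacDir (v : Fin m → ℝ) (δ : Idx m p → ℝ) :
    mean μ X (fun x => ∑ a, v a * jacDir g θs δ a x) = v ⬝ᵥ GMat g μ X θs *ᵥ thetaPart δ := by
  rw [mean_sum _ fun a _ =>
    hM.integrable_dom ((hM.dom_jacDir δ a).const_mul _) (by norm_num)]
  exact Finset.sum_congr rfl fun a _ => by rw [mean_const_mul, hM.mean_jacDir]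

/-- The τ-row of the inverse Jacobian is -1 on the diagonal, so Q̄_τ is the bracket of the
τ-equation: the linear part λ'ḡ at λ = -Pḡ is -ḡ'Pḡ, and half of E[(λ'g)²] is ½ ḡ'PΩPḡ = ½ ḡ'Pḡ. The
Jacobian part vanishes by PG = 0. -/
theorem QBar_τ (n : ℕ) (ω : Ω) :
    QBar μ X (phiETEL g) (betaStar θs) n ω iτ =
      -(1 / 2 * (gBar g X θs n ω ⬝ᵥ PMat g μ X θs *ᵥ gBar g X θs n ω)) := by
  rw [QBar_eq, hM.isUnit_Phi1_and_inv_mulVec.2]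
  refine (neg_neg _).trans ?_
  rw [hM.quadForm_Phi2_phiETEL, (hM.Phi1_mulVec _).1, hM.PsiBar_phiETEL]
  simp only [(hM.deriv_phi_τ _ _).1, (hM.deriv_phi_τ _ _).2]
  have h1 : psiVec g μ X θs n ω iτ = 0 := rfl
  have h2 : (fun a => psiVec g μ X θs n ω (iΛ a)) = -(PMat g μ X θs *ᵥ gBar g X θs n ω) := rfl
  have h3 : ∀ (k l : Fin m → ℝ) (θ : Fin p → ℝ),
    (ETEL.mk (-0) k l θ : Idx m p → ℝ) iτ = 0 := fun _ _ _ => neg_zero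
  simp only [h1, h3, sub_zero]
  have h4 := hM.mean_blockDot_sq iΛ (psiVec g μ X θs n ω)
  have h5 := hM.mean_sum_mul_jacDir (fun a => psiVec g μ X θs n ω (iΛ a)) (psiVec g μ X θs n ω)
  have h6 := nsum_blockDot (g := g) (θs := θs) (X := X) iΛ (psiVec g μ X θs n ω) n ω
  rw [h2] at h4 h5 h6
  rw [neg_dotProduct, hM.P_mulVec_dotProduct_G, neg_zero] at h5
  rw [mulVec_neg, neg_dotProduct_neg, hM.P_mulVec_dotProduct_omega] at h4
  rw [neg_dotProduct, P_mulVec_dotProduct] at h6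
  have e1 : (fun x => blockDot g θs iΛ (psiVec g μ X θs n ω) x) =
    blockDot g θs iΛ (psiVec g μ X θs n ω) := rfl
  rw [mean_add, mean_const_mul, e1, h4, h6]
  · have : mean μ X (fun x => ∑ a, psiVec g μ X θs n ω (iΛ a) *
        jacDir g θs (psiVec g μ X θs n ω) a x) = 0 := h5
    rw [this]
    ring
  · exact (integrable_finsetSum _ fun a _ =>
      (hM.integrable_dom (hM.dom_jacDir _ a) (by norm_num)).const_mul _).const_mul 2
  · simp only [sq]
    exact hM.integrable_dom ((hM.dom_blockDot _ _).mul (hM.dom_blockDot _ _)) (by norm_num)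

/-- The κ- and λ-rows of the inverse differ by Ω⁻¹ applied to the λ-block. Consequently the
difference is a quadratic form in Pḡ with nonrandom coefficients, which keeps the remaining part of
R̄ in the cubic span. -/
theorem QBar_Λ_sub_κ (n : ℕ) (ω : Ω) (a : Fin m) :
    QBar μ X (phiETEL g) (betaStar θs) n ω (iΛ a) - QBar μ X (phiETEL g) (betaStar θs) n ω (iκ a) =
      1 / 2 * ((OmegaMat g μ X θs)⁻¹ *ᵥ fun a => mean μ X fun x =>
        g x θs a * blockDot g θs iκ (psiVec g μ X θs n ω) x ^ 2) a := by
  -- The EL representation is chosen since its λ-block has zero first derivative wherever the κ- and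
  -- λ-parts agree, leaving only the quadratic term.
  rw [← hM.QBar_phiEL, QBar_eq, QBar_eq, hM.Phi1_phiEL, hM.isUnit_Phi1_and_inv_mulVec.2]
  refine (neg_sub_neg _ _).trans ?_
  refine (sub_sub_cancel _ _).trans ?_
  rw [← smul_eq_mul, ← Pi.smul_apply, ← mulVec_smul]
  refine congrFun (congrArg _ ?_) a
  ext a
  rw [hM.PsiBar_phiEL, hM.quadForm_Phi2_phiEL, (hM.Phi1_mulVec _).1]
  have h2 : ∀ i, psiVec g μ X θs n ω (iκ i) = psiVec g μ X θs n ω (iΛ i) := fun _ => rfl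
  have h3 : ((fun a => psiVec g μ X θs n ω (iκ a)) - fun a => psiVec g μ X θs n ω (iΛ a)) = 0 :=
    sub_self _
  simp only [(hM.deriv_phi_Λ _ _ _).2.1, ((hM.deriv_phi_Λ _ _ _).2.2.2 h2).1, blockDot_congr h2,
    sub_self, zero_mul, h3, mulVec_zero, zero_sub]
  have : nsum X n (fun _ => -(ETEL.mk (-psiVec g μ X θs n ω iτ)
      ((OmegaMat g μ X θs *ᵥ fun a => psiVec g μ X θs n ω (iΛ a)) +
        GMat g μ X θs *ᵥ thetaPart (psiVec g μ X θs n ω)) 0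
      ((GMat g μ X θs)ᵀ *ᵥ fun a => psiVec g μ X θs n ω (iκ a)) : Idx m p → ℝ) (iΛ a)) ω = 0 :=
    (congrArg (fun f => nsum X n f ω) (funext fun _ => neg_zero)).trans nsum_zero
  rw [this, zero_add]
  rfl

/-- All differences between the two systems that matter for θ, once averaged or summed, lie in the
λ-block, on which the θ-rows of the inverse Jacobian act as H. -/
theorem neg_inv_mulVec_sub {u w : Idx m p → ℝ} {t : Fin m → ℝ}
    (h : u - w = ETEL.mk 0 0 t 0) (l : Fin p) :
    -((Phi1 μ X (phiETEL g) (betaStar θs))⁻¹ *ᵥ u) (iθ l)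
      - -((Phi1 μ X (phiETEL g) (betaStar θs))⁻¹ *ᵥ w) (iθ l) = -(HMat g μ X θs *ᵥ t) l := by
  rw [neg_sub_neg, ← neg_sub, ← Pi.sub_apply, ← mulVec_sub, h, hM.isUnit_Phi1_and_inv_mulVec.2]
  have h1 : (fun a => (ETEL.mk 0 0 t 0 : Idx m p → ℝ) (iκ a)) = 0 := rfl
  have h2 : (fun a => (ETEL.mk 0 0 t 0 : Idx m p → ℝ) (iΛ a)) = t := rfl
  have h3 : thetaPart (ETEL.mk 0 0 t 0 : Idx m p → ℝ) = 0 := rfl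
  rw [h1, h2, h3, zero_add, mulVec_zero, mulVec_zero, sub_zero]
  rfl

/-- The first derivatives differ by v_τ g in the λ-block alone, and g is already centred, so its
normalized sum is ḡ. -/
theorem sum_PsiBar1_sub_mul (n : ℕ) (ω : Ω) (v : Idx m p → ℝ) (l : Fin p) :
    ∑ j, (PsiBar1 μ X (phiETEL g) (betaStar θs) n ω (iθ l) j
        - PsiBar1 μ X (phiEL g) (betaStar θs) n ω (iθ l) j) * v j =
      -(v iτ * (HMat g μ X θs *ᵥ gBar g X θs n ω) l) := by
  simp only [sub_mul, Finset.sum_sub_distrib]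
  rw [sum_PsiBar1_mul, sum_PsiBar1_mul, hM.Phi1_phiEL,
    hM.neg_inv_mulVec_sub (t := v iτ • gBar g X θs n ω), mulVec_smul]
  · rfl
  · ext h
    rw [Pi.sub_apply, ← nsum_sub]
    simp only [sub_sub_sub_cancel_right]
    rcases h with _ | a | a | c
    · exact (congrArg (fun f => nsum X n f ω) (funext fun _ => sub_self _)).trans nsum_zero
    · exact (congrArg (fun f => nsum X n f ω) (funext fun _ => sub_self _)).trans nsum_zero
    · refine (congrArg (fun f => nsum X n f ω) (funext fun x => ?_)).trans
        (nsum_const_mul (X := X) (f := fun x => g x θs a) (v iτ))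
      rw [(hM.deriv_phi_Λ x v a).1, (hM.deriv_phi_Λ x v a).2.1]
      ring
    · refine (congrArg (fun f => nsum X n f ω) (funext fun x => ?_)).trans nsum_zero
      rw [(hM.deriv_phi_θ x v c).1, (hM.deriv_phi_θ x v c).2.1, sub_self]

omit hM [IsProbabilityMeasure μ] in
theorem Phi2_comm {φ : 𝒳 → (Idx m p → ℝ) → Idx m p → ℝ} {βs : Idx m p → ℝ}
    (h : HasEnvelope φ βs b) (l j k : Idx m p) :
    Phi2 μ X φ βs l j k = Phi2 μ X φ βs l k j :=
  congrArg (mean μ X) (funext fun x => d2_comm (h.contDiffAt x l) j k)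

theorem integrable_quadForm_d2 {φ : 𝒳 → (Idx m p → ℝ) → Idx m p → ℝ} {βs : Idx m p → ℝ}
    (h : HasEnvelope φ βs b) (l : Idx m p) (v : Idx m p → ℝ) :
    Integrable (fun ω => quadForm (fun j k => d2 φ βs l j k (X 0 ω)) v) μ :=
  integrable_finsetSum _ fun j _ => integrable_finsetSum _ fun k _ =>
    (hM.integrable_dom (h.dom2 l j k) (by norm_num)).const_mul _

omit hM [IsProbabilityMeasure μ] [MeasurableSpace 𝒳] in
theorem mean_polar_sub {f₁ f₂ f₃ h₁ h₂ h₃ : 𝒳 → ℝ} (i₁ : Integrable (fun ω => f₁ (X 0 ω)) μ)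
    (i₂ : Integrable (fun ω => f₂ (X 0 ω)) μ) (i₃ : Integrable (fun ω => f₃ (X 0 ω)) μ)
    (j₁ : Integrable (fun ω => h₁ (X 0 ω)) μ) (j₂ : Integrable (fun ω => h₂ (X 0 ω)) μ)
    (j₃ : Integrable (fun ω => h₃ (X 0 ω)) μ) :
    1 / 2 * (mean μ X f₁ - mean μ X f₂ - mean μ X f₃)
      - 1 / 2 * (mean μ X h₁ - mean μ X h₂ - mean μ X h₃) =
    mean μ X fun x => 1 / 2 * ((f₁ x - h₁ x) - (f₂ x - h₂ x) - (f₃ x - h₃ x)) := by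
  unfold mean
  have e₁ := integral_sub ((i₁.sub j₁).sub (i₂.sub j₂)) (i₃.sub j₃)
  have e₂ := integral_sub (i₁.sub j₁) (i₂.sub j₂)
  simp only [Pi.sub_apply] at e₁ e₂
  rw [integral_const_mul, e₁, e₂, integral_sub i₁ j₁, integral_sub i₂ j₂, integral_sub i₃ j₃]
  ring

theorem sum_Phi2_sub_mul_mul (v w : Idx m p → ℝ) (l : Idx m p) :
    ∑ j, ∑ k, v j * w k * Phi2 μ X (phiETEL g) (betaStar θs) l j k
      - ∑ j, ∑ k, v j * w k * Phi2 μ X (phiEL g) (betaStar θs) l j k =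
    mean μ X fun x => 1 / 2 *
      ((quadForm (fun j k => d2 (phiETEL g) (betaStar θs) l j k x) (v + w)
        - quadForm (fun j k => d2 (phiEL g) (betaStar θs) l j k x) (v + w))
      - (quadForm (fun j k => d2 (phiETEL g) (betaStar θs) l j k x) v
        - quadForm (fun j k => d2 (phiEL g) (betaStar θs) l j k x) v)
      - (quadForm (fun j k => d2 (phiETEL g) (betaStar θs) l j k x) w
        - quadForm (fun j k => d2 (phiEL g) (betaStar θs) l j k x) w)) := by
  have iE := hM.integrable_quadForm_d2 hM.hasEnvelope_phiETEL l
  have iL := hM.integrable_quadForm_d2 hM.hasEnvelope_phiEL l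
  rw [sum_sum_mul_mul_eq_polar (Phi2_comm hM.hasEnvelope_phiETEL l),
    sum_sum_mul_mul_eq_polar (Phi2_comm hM.hasEnvelope_phiEL l)]
  simp only [hM.quadForm_Phi2_phiEL, hM.quadForm_Phi2_phiETEL]
  exact mean_polar_sub (iE (v + w)) (iE v) (iE w) (iL (v + w)) (iL v) (iL w)

/-- By polarization the λ-block difference in directions v and Ψ̄ contains v_τ times the derivative
of g along Ψ̄_θ = -Hḡ, with mean -v_τ GHḡ. After HG = 1 this is the term that cancels the
contribution of the centred first derivatives; the other summand measures the gap between the κ- and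
λ-parts of v. -/
theorem sum_Psi2_sub_mul_mul (n : ℕ) (ω : Ω) (v : Idx m p → ℝ) (l : Fin p) :
    ∑ j, ∑ k, (Psi2 μ X (phiETEL g) (betaStar θs) (iθ l) j k
        - Psi2 μ X (phiEL g) (betaStar θs) (iθ l) j k) * psiVec g μ X θs n ω k * v j =
      v iτ * (HMat g μ X θs *ᵥ gBar g X θs n ω) l
      - (HMat g μ X θs *ᵥ fun a => mean μ X fun x => g x θs a *
          (blockDot g θs iκ (psiVec g μ X θs n ω) x *
            (blockDot g θs iΛ v x - blockDot g θs iκ v x))) l := by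
  set Ψ := psiVec g μ X θs n ω with hΨ
  have h1 : Ψ iτ = 0 := rfl
  have h2 : ∀ i, Ψ (iκ i) = Ψ (iΛ i) := fun _ => rfl
  have e : ∀ j k, (Psi2 μ X (phiETEL g) (betaStar θs) (iθ l) j k
        - Psi2 μ X (phiEL g) (betaStar θs) (iθ l) j k) * Ψ k * v j =
      Psi2 μ X (phiETEL g) (betaStar θs) (iθ l) j k * v j * Ψ k
        - Psi2 μ X (phiEL g) (betaStar θs) (iθ l) j k * v j * Ψ k := fun j k => by ring
  simp only [e, Finset.sum_sub_distrib]
  rw [sum_Psi2_mul_mul, sum_Psi2_mul_mul, hM.Phi1_phiEL,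
    hM.neg_inv_mulVec_sub (t := v iτ • (GMat g μ X θs *ᵥ thetaPart Ψ) + fun a =>
      mean μ X fun x => g x θs a *
          (blockDot g θs iκ Ψ x * (blockDot g θs iΛ v x - blockDot g θs iκ v x)))]
  · have h3 : thetaPart Ψ = -(HMat g μ X θs *ᵥ gBar g X θs n ω) := rfl
    rw [mulVec_add, mulVec_smul, mulVec_mulVec, hM.H_mul_G, one_mulVec, h3]
    simp only [Pi.add_apply, Pi.smul_apply, Pi.neg_apply, smul_eq_mul]
    ring
  · ext h
    rw [Pi.sub_apply, hM.sum_Phi2_sub_mul_mul]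
    rcases h with _ | a | a | c
    · simp only [d2_phiEL_τ, sub_self, mul_zero, mean_const]
      rfl
    · simp only [d2_phiEL_κ, sub_self, mul_zero, mean_const]
      rfl
    · simp only [(hM.deriv_phi_Λ _ _ a).2.2.1, blockDot_add, jacDir_add, blockDot_congr h2,
        Pi.add_apply, h1]
      have i1 := hM.integrable_dom (hM.dom_jacDir Ψ a) (by norm_num)
      have i2 := hM.integrable_dom ((hM.dom_g a).mul ((hM.dom_blockDot iκ Ψ).mul
        ((hM.dom_blockDot iΛ v).sub (hM.dom_blockDot iκ v)))) (by norm_num)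
      refine Eq.trans ?_ ((mean_add (f := fun x => v iτ * jacDir g θs Ψ a x)
        (f' := fun x => g x θs a * (blockDot g θs iκ Ψ x * (blockDot g θs iΛ v x
          - blockDot g θs iκ v x))) (i1.const_mul (v iτ)) i2).trans ?_)
      · refine congrArg (mean μ X) (funext fun x => ?_)
        ring
      · rw [mean_const_mul, hM.mean_jacDir]
        rfl
    · simp only [(hM.deriv_phi_θ _ _ c).2.2.1, blockDot_add, jacDot_add, blockDot_congr h2,
        jacDot_congr h2, Pi.add_apply, h1]
      -- In the θ-block only v_τ G'κ remains at κ = -Pḡ, and its mean vanishes by G'P = 0.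
      have h3 : (fun a => Ψ (iκ a)) = -(PMat g μ X θs *ᵥ gBar g X θs n ω) := rfl
      have h4 := hM.mean_jacDot iκ Ψ c
      rw [h3, mulVec_neg, mulVec_mulVec, hM.G_transpose_mul_P, zero_mulVec, neg_zero, Pi.zero_apply] at h4
      refine Eq.trans ?_ ((mean_const_mul (v iτ)).trans (by rw [h4, mul_zero]; rfl))
      refine congrArg (mean μ X) (funext fun x => ?_)
      ring

/-- Both trailing indices are contracted with Ψ̄, where the second-order forms agree pointwise in x.
-/
theorem sum_PsiBar2_sub_mul_mul (n : ℕ) (ω : Ω) (l : Idx m p) :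
    ∑ j, ∑ k, (PsiBar2 μ X (phiETEL g) (betaStar θs) n ω l j k
        - PsiBar2 μ X (phiEL g) (betaStar θs) n ω l j k) * psiVec g μ X θs n ω j
        * psiVec g μ X θs n ω k = 0 := by
  have h1 : psiVec g μ X θs n ω iτ = 0 := rfl
  have h2 : ∀ i, psiVec g μ X θs n ω (iκ i) = psiVec g μ X θs n ω (iΛ i) := fun _ => rfl
  simp only [sub_mul, Finset.sum_sub_distrib]
  rw [sum_PsiBar2_mul_mul, sum_PsiBar2_mul_mul, hM.Phi1_phiEL]
  simp only [hM.quadForm_Phi2_phiEL, hM.quadForm_Phi2_phiETEL, hM.quadForm_d2_phiEL h1 h2, sub_self]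

theorem cubicForm_Phi3_eq_mean {φ : 𝒳 → (Idx m p → ℝ) → Idx m p → ℝ} {βs : Idx m p → ℝ}
    (hφ : HasEnvelope φ βs b) (l : Idx m p) (v : Idx m p → ℝ) :
    cubicForm (Phi3 μ X φ βs l) v =
      mean μ X (fun x => cubicForm (fun j k h => d3 φ βs l j k h x) v) :=
  cubicForm_Phi3 v fun j k h => hM.integrable_dom (hφ.dom3 l j k h) (by norm_num)

theorem integrable_cubicForm_d3 {φ : 𝒳 → (Idx m p → ℝ) → Idx m p → ℝ} {βs : Idx m p → ℝ}
    (hφ : HasEnvelope φ βs b) (l : Idx m p) (v : Idx m p → ℝ) :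
    Integrable (fun ω => cubicForm (fun j k h => d3 φ βs l j k h (X 0 ω)) v) μ :=
  integrable_finsetSum _ fun j _ => integrable_finsetSum _ fun k _ =>
    integrable_finsetSum _ fun h _ =>
      (hM.integrable_dom (hφ.dom3 l j k h) (by norm_num)).const_mul _

theorem sum_Psi3_sub_mul_mul_mul (n : ℕ) (ω : Ω) (l : Fin p) :
    ∑ j, ∑ k, ∑ h, (Psi3 μ X (phiETEL g) (betaStar θs) (iθ l) j k h
        - Psi3 μ X (phiEL g) (betaStar θs) (iθ l) j k h) * psiVec g μ X θs n ω j
        * psiVec g μ X θs n ω k * psiVec g μ X θs n ω h =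
      3 * (HMat g μ X θs *ᵥ fun a => mean μ X fun x => g x θs a *
        blockDot g θs iκ (psiVec g μ X θs n ω) x ^ 3) l := by
  set Ψ := psiVec g μ X θs n ω with hΨ
  have h1 : Ψ iτ = 0 := rfl
  have h2 : ∀ i, Ψ (iκ i) = Ψ (iΛ i) := fun _ => rfl
  simp only [sub_mul, Finset.sum_sub_distrib]
  rw [sum_Psi3_mul_mul_mul, sum_Psi3_mul_mul_mul, hM.Phi1_phiEL,
    hM.neg_inv_mulVec_sub (t := (-3 : ℝ) • fun a => mean μ X fun x => g x θs a *
        blockDot g θs iκ Ψ x ^ 3)]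
  · rw [mulVec_smul, Pi.smul_apply, smul_eq_mul, neg_mul, neg_neg]
  · ext h
    rw [Pi.sub_apply, hM.cubicForm_Phi3_eq_mean hM.hasEnvelope_phiETEL,
      hM.cubicForm_Phi3_eq_mean hM.hasEnvelope_phiEL,
      ← mean_sub (hM.integrable_cubicForm_d3 hM.hasEnvelope_phiETEL h Ψ)
        (hM.integrable_cubicForm_d3 hM.hasEnvelope_phiEL h Ψ)]
    rcases h with _ | a | a | c
    · simp only [d3_phiEL_τ, sub_self, mean_const]
      rfl
    · simp only [d3_phiEL_κ, sub_self, mean_const]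
      rfl
    · simp only [((hM.deriv_phi_Λ _ _ a).2.2.2 h2).2 h1]
      exact mean_const_mul _
    · simp only [(hM.deriv_phi_θ _ _ c).2.2.2 h2 h1, mean_const]
      rfl

/-- The difference of the third-order terms. -/
theorem RBar_sub (n : ℕ) (ω : Ω) (l : Fin p) :
    RBar μ X (phiETEL g) (betaStar θs) n ω (iθ l) - RBar μ X (phiEL g) (betaStar θs) n ω (iθ l) =
      1 / 2 * (HMat g μ X θs *ᵥ fun a => mean μ X fun x => g x θs a *
        blockDot g θs iκ (psiVec g μ X θs n ω) x ^ 3) l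
      - (HMat g μ X θs *ᵥ fun a => mean μ X fun x => g x θs a *
          (blockDot g θs iκ (psiVec g μ X θs n ω) x *
            (blockDot g θs iΛ (QBar μ X (phiETEL g) (betaStar θs) n ω) x
              - blockDot g θs iκ (QBar μ X (phiETEL g) (betaStar θs) n ω) x))) l := by
  have hA := hM.sum_PsiBar1_sub_mul n ω (QBar μ X (phiETEL g) (betaStar θs) n ω) l
  have hB := hM.sum_Psi2_sub_mul_mul n ω (QBar μ X (phiETEL g) (betaStar θs) n ω) l
  have hC := hM.sum_PsiBar2_sub_mul_mul n ω (iθ l)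
  have hD := hM.sum_Psi3_sub_mul_mul_mul n ω l
  simp only [sub_mul, Finset.sum_sub_distrib] at hA hB hC hD
  have comm : ∀ φ : 𝒳 → (Idx m p → ℝ) → Idx m p → ℝ,
      ∑ j, ∑ k, Psi2 μ X φ (betaStar θs) (iθ l) j k * psiVec g μ X θs n ω k
        * QBar μ X (phiETEL g) (betaStar θs) n ω j =
      ∑ j, ∑ k, Psi2 μ X φ (betaStar θs) (iθ l) j k * QBar μ X (phiETEL g) (betaStar θs) n ω j
        * psiVec g μ X θs n ω k := fun φ =>
    Finset.sum_congr rfl fun j _ => Finset.sum_congr rfl fun k _ => by ring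
  rw [comm, comm] at hB
  simp only [RBar, hM.PsiBar_phiEL, hM.PsiBar_phiETEL, hM.QBar_phiEL]
  -- The weights are those of the four terms in R̄. The two terms with the τ-part of Q̄ cancel, and
  -- 1/6 times 3 leaves the factor 1/2 on the cubic term.
  linear_combination hA + hB + 1 / 2 * hC + 1 / 6 * hD

end IsRegularModel

end Terms

end ETEL

namespace ETEL

/-! ### Product moments of sums of i.i.d. variables -/

section SumMoments

variable {Ω 𝒳 ι : Type*} [MeasurableSpace Ω] [MeasurableSpace 𝒳] {μ : Measure Ω}
  [IsProbabilityMeasure μ] {X : ℕ → Ω → 𝒳} [DecidableEq ι]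

/-- `∏_{i ∈ s} ∑_{k < n} f_i(x_k)`. -/
def sumProd (X : ℕ → Ω → 𝒳) (f : ι → 𝒳 → ℝ) (n : ℕ) (s : Finset ι) (ω : Ω) : ℝ :=
  ∏ i ∈ s, ∑ k ∈ Finset.range n, f i (X k ω)

omit [MeasurableSpace Ω] [MeasurableSpace 𝒳] in
-- Each factor is the new observation's term plus the old sum; expanding the product sums over the
-- set T of factors that contribute the new term.
theorem sumProd_succ (f : ι → 𝒳 → ℝ) (n : ℕ) (s : Finset ι) (ω : Ω) :
    sumProd X f (n + 1) s ω =
      ∑ T ∈ s.powerset, (∏ i ∈ T, f i (X n ω)) * sumProd X f n (s \ T) ω := by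
  unfold sumProd
  simp only [Finset.sum_range_succ]
  rw [← Finset.prod_add]
  exact Finset.prod_congr rfl fun i _ => add_comm _ _

omit [IsProbabilityMeasure μ] in
theorem indepFun_comp_sumProd (hX : ∀ i, Measurable (X i)) (hi : iIndepFun X μ) {f : ι → 𝒳 → ℝ}
    (hf : ∀ i, Measurable (f i)) (n : ℕ) (s T : Finset ι) :
    IndepFun (fun ω => ∏ i ∈ T, f i (X n ω)) (sumProd X f n s) μ := by
  have h := hi.indepFun_finset {n} (Finset.range n) (by simp) hX
  have h1 : Measurable fun z : (({n} : Finset ℕ) → 𝒳) =>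
      ∏ i ∈ T, f i (z ⟨n, Finset.mem_singleton_self n⟩) :=
    Finset.measurable_prod _ fun i _ => (hf i).comp (measurable_pi_apply _)
  have h2 : Measurable fun z : (Finset.range n → 𝒳) => ∏ i ∈ s, ∑ k, f i (z k) :=
    Finset.measurable_prod _ fun i _ => Finset.measurable_sum _ fun k _ =>
      (hf i).comp (measurable_pi_apply _)
  have e : sumProd X f n s = (fun z : (Finset.range n → 𝒳) => ∏ i ∈ s, ∑ k, f i (z k)) ∘
      fun ω (i : Finset.range n) => X i ω := by
    ext ω
    refine Finset.prod_congr rfl fun i _ => ?_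
    exact (Finset.sum_coe_sort (Finset.range n) fun k => f i (X k ω)).symm
  rw [e]
  exact h.comp h1 h2

variable (hX : ∀ i, Measurable (X i)) (hi : iIndepFun X μ)
  (hid : ∀ i, IdentDistrib (X i) (X 0) μ μ) {f : ι → 𝒳 → ℝ} (hf : ∀ i, Measurable (f i))
include hX hi hid hf

/-- Independence of the new observation factorizes every summand of `sumProd_succ`, so product
moments satisfy a recursion in n over subsets of the factors. -/
theorem integrable_sumProd_and_integral {s : Finset ι}
    (hint : ∀ T ⊆ s, Integrable (fun ω => ∏ i ∈ T, f i (X 0 ω)) μ) (n : ℕ) :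
    (∀ T ⊆ s, Integrable (sumProd X f n T) μ) ∧
      ∀ T ⊆ s, ∫ ω, sumProd X f (n + 1) T ω ∂μ =
        ∑ U ∈ T.powerset, mean μ X (fun x => ∏ i ∈ U, f i x) * ∫ ω, sumProd X f n (T \ U) ω ∂μ := by
  have hmeas : ∀ U : Finset ι, Measurable fun x => ∏ i ∈ U, f i x := fun U =>
    Finset.measurable_prod _ fun i _ => hf i
  have hid' : ∀ U : Finset ι, IdentDistrib (fun ω => ∏ i ∈ U, f i (X n ω))
      (fun ω => ∏ i ∈ U, f i (X 0 ω)) μ μ := fun U => (hid n).comp (hmeas U)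
  have hI : ∀ (n : ℕ) (U : Finset ι), U ⊆ s → Integrable (fun ω => ∏ i ∈ U, f i (X n ω)) μ :=
    fun n U hU => ((hid n).comp (hmeas U)).integrable_iff.2 (hint U hU)
  have key : ∀ n, ∀ T ⊆ s, Integrable (sumProd X f n T) μ := by
    intro n
    induction n with
    | zero =>
      intro T _
      have : sumProd X f 0 T = fun _ => ∏ _i ∈ T, (0 : ℝ) := by ext; simp [sumProd]
      rw [this]
      exact integrable_const _
    | succ n ih =>
      intro T hT
      have : sumProd X f (n + 1) T = fun ω =>
          ∑ U ∈ T.powerset, (∏ i ∈ U, f i (X n ω)) * sumProd X f n (T \ U) ω :=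
        funext fun ω => sumProd_succ f n T ω
      rw [this]
      exact integrable_finsetSum _ fun U hU =>
        (indepFun_comp_sumProd hX hi hf n (T \ U) U).integrable_mul
          (hI n U ((Finset.mem_powerset.1 hU).trans hT)) (ih _ (Finset.sdiff_subset.trans hT))
  refine ⟨key n, fun T hT => ?_⟩
  simp only [sumProd_succ]
  rw [integral_finsetSum (f := fun U ω => (∏ i ∈ U, f i (X n ω)) * sumProd X f n (T \ U) ω) _
      fun U hU => (indepFun_comp_sumProd hX hi hf n (T \ U) U).integrable_mul
          (hI n U ((Finset.mem_powerset.1 hU).trans hT)) (key n _ (Finset.sdiff_subset.trans hT))]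
  refine Finset.sum_congr rfl fun U hU => ?_
  rw [(indepFun_comp_sumProd hX hi hf n (T \ U) U).integral_fun_mul_eq_mul_integral
    (hI n U ((Finset.mem_powerset.1 hU).trans hT)).aestronglyMeasurable
    (key n _ (Finset.sdiff_subset.trans hT)).aestronglyMeasurable, (hid' U).integral_eq]
  rfl

variable (h0 : ∀ i, mean μ X (f i) = 0)
include h0

/-- In the recursion the empty subset reproduces the previous moment and singletons vanish by
centring. An increment therefore involves at most k - 2 old sums and is O(n^{(k-2)/2}); adding n
increments gives n^{k/2}. -/
theorem abs_integral_sumProd_le {s : Finset ι}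
    (hint : ∀ T ⊆ s, Integrable (fun ω => ∏ i ∈ T, f i (X 0 ω)) μ) :
    ∃ C : ℝ, 0 ≤ C ∧ ∀ n, |∫ ω, sumProd X f n s ω ∂μ| ≤ C * √(n : ℝ) ^ s.card := by
  induction s using Finset.strongInduction with
  | H s ih =>
  have ih' : ∀ U ⊆ s, ∃ C : ℝ, 0 ≤ C ∧ (2 ≤ U.card →
      ∀ n, |∫ ω, sumProd X f n (s \ U) ω ∂μ| ≤ C * √(n : ℝ) ^ (s \ U).card) := fun U hU => by
    by_cases h : 2 ≤ U.card
    · have hne : U.Nonempty := Finset.card_pos.1 (by omega)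
      obtain ⟨C, h1, h2⟩ := ih (s \ U) (Finset.sdiff_ssubset hU hne)
        fun T hT => hint T (hT.trans Finset.sdiff_subset)
      exact ⟨C, h1, fun _ => h2⟩
    · exact ⟨0, le_rfl, fun h' => absurd h' h⟩
  choose! C hC0 hC using ih'
  rcases s.eq_empty_or_nonempty with rfl | hs
  · exact ⟨1, zero_le_one, fun n => by simp [sumProd]⟩
  let m : Finset ι → ℝ := fun U => mean μ X fun x => ∏ i ∈ U, f i x
  let K : ℝ := ∑ U ∈ s.powerset, |m U| * C U
  have hK : 0 ≤ K := Finset.sum_nonneg fun U hU =>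
    mul_nonneg (abs_nonneg _) (hC0 U (Finset.mem_powerset.1 hU))
  have step : ∀ n : ℕ, |∫ ω, sumProd X f (n + 1) s ω ∂μ - ∫ ω, sumProd X f n s ω ∂μ| ≤
      K * √((n + 1 : ℕ) : ℝ) ^ (s.card - 2) := fun n => by
    have h := (integrable_sumProd_and_integral hX hi hid hf hint n).2 s subset_rfl
    rw [← Finset.add_sum_erase _ _ (Finset.empty_mem_powerset s)] at h
    have e0 : mean μ X (fun x => ∏ i ∈ (∅ : Finset ι), f i x) = 1 := by
      simp only [Finset.prod_empty, mean_const]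
    rw [e0, one_mul, Finset.sdiff_empty] at h
    rw [h, add_sub_cancel_left]
    refine (Finset.abs_sum_le_sum_abs _ _).trans ?_
    have hle : ∑ U ∈ s.powerset.erase ∅, |m U| * C U ≤ K :=
      Finset.sum_le_sum_of_subset_of_nonneg (Finset.erase_subset _ _) fun U hU _ =>
        mul_nonneg (abs_nonneg _) (hC0 U (Finset.mem_powerset.1 hU))
    refine le_trans ?_ (mul_le_mul_of_nonneg_right hle (by positivity))
    rw [Finset.sum_mul]
    refine Finset.sum_le_sum fun U hU => ?_
    have hUs := Finset.mem_powerset.1 (Finset.mem_of_mem_erase hU)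
    have hne : U.Nonempty := Finset.nonempty_of_ne_empty (Finset.ne_of_mem_erase hU)
    have hnn := hC0 U hUs
    by_cases h2 : 2 ≤ U.card
    · rw [abs_mul, mul_assoc]
      refine mul_le_mul_of_nonneg_left ((hC U hUs h2 n).trans
        (mul_le_mul_of_nonneg_left ?_ hnn)) (abs_nonneg _)
      have h1 : (1 : ℝ) ≤ √((n + 1 : ℕ) : ℝ) := by
        rw [Real.one_le_sqrt]; push_cast; linarith [(Nat.cast_nonneg n : (0 : ℝ) ≤ n)]
      calc √(n : ℝ) ^ (s \ U).card ≤ √((n + 1 : ℕ) : ℝ) ^ (s \ U).card :=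
            pow_le_pow_left₀ (Real.sqrt_nonneg _) (Real.sqrt_le_sqrt (by push_cast; linarith)) _
        _ ≤ _ := pow_le_pow_right₀ h1 (by rw [Finset.card_sdiff_of_subset hUs]; omega)
    · obtain ⟨i, rfl⟩ := Finset.card_eq_one.1 (by have := hne.card_pos; omega : U.card = 1)
      have : mean μ X (fun x => ∏ j ∈ {i}, f j x) = 0 := by
        simp only [Finset.prod_singleton]; exact h0 i
      rw [this, zero_mul, abs_zero]
      positivity
  refine ⟨K, hK, fun n => ?_⟩
  have hz : ∫ ω, sumProd X f 0 s ω ∂μ = 0 := by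
    have : ∀ ω, sumProd X f 0 s ω = 0 := fun ω => by
      obtain ⟨i, hi⟩ := hs
      exact Finset.prod_eq_zero hi (by simp)
    simp [this]
  by_cases h2 : 2 ≤ s.card
  · have tel : ∀ k ≤ n, |∫ ω, sumProd X f k s ω ∂μ| ≤ k * (K * √(n : ℝ) ^ (s.card - 2)) := by
      intro k hk
      induction k with
      | zero => simp [hz]
      | succ k ihk =>
        have h1 := ihk (by omega)
        have h3 := step k
        have h4 : √((k + 1 : ℕ) : ℝ) ^ (s.card - 2) ≤ √(n : ℝ) ^ (s.card - 2) :=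
          pow_le_pow_left₀ (Real.sqrt_nonneg _) (Real.sqrt_le_sqrt (Nat.cast_le.2 hk)) _
        have h5 := mul_le_mul_of_nonneg_left h4 hK
        have h6 := abs_sub_abs_le_abs_sub (∫ ω, sumProd X f (k + 1) s ω ∂μ)
          (∫ ω, sumProd X f k s ω ∂μ)
        push_cast at *
        linarith
    refine (tel n le_rfl).trans (le_of_eq ?_)
    obtain ⟨c, hc⟩ : ∃ c, s.card = c + 2 := ⟨s.card - 2, by omega⟩
    rw [hc, Nat.add_sub_cancel, pow_add, Real.sq_sqrt (Nat.cast_nonneg n)]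
    ring
  -- A single factor is treated separately: there k - 2 truncates to zero and the increments would
  -- only give order n, whereas the moment is exactly zero.
  · obtain ⟨i, rfl⟩ := Finset.card_eq_one.1 (by have := hs.card_pos; omega : s.card = 1)
    have : ∀ n, ∫ ω, sumProd X f n {i} ω ∂μ = 0 := fun n => by
      induction n with
      | zero => exact hz
      | succ n ihn =>
        rw [(integrable_sumProd_and_integral hX hi hid hf hint n).2 _ subset_rfl]
        refine Finset.sum_eq_zero fun U hU => ?_
        rcases Finset.subset_singleton_iff.1 (Finset.mem_powerset.1 hU) with rfl | rfl
        · rw [Finset.sdiff_empty, ihn, mul_zero]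
        · simp only [Finset.prod_singleton]
          have := h0 i
          rw [show (mean μ X fun x => f i x) = 0 from this, zero_mul]
    rw [this, abs_zero]
    positivity

/-- If all proper nonempty subsets drop out of the recursion, each observation adds the same joint
moment. -/
theorem integral_sumProd_of_forall_eq_zero {s : Finset ι} (hs : s.Nonempty)
    (hint : ∀ T ⊆ s, Integrable (fun ω => ∏ i ∈ T, f i (X 0 ω)) μ)
    (hz : ∀ n, ∀ U ⊆ s, U ≠ ∅ → U ≠ s →
      mean μ X (fun x => ∏ i ∈ U, f i x) * ∫ ω, sumProd X f n (s \ U) ω ∂μ = 0) (n : ℕ) :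
    ∫ ω, sumProd X f n s ω ∂μ = n * mean μ X fun x => ∏ i ∈ s, f i x := by
  induction n with
  | zero =>
    have : ∀ ω, sumProd X f 0 s ω = 0 := fun ω => by
      obtain ⟨i, hi⟩ := hs
      exact Finset.prod_eq_zero hi (by simp)
    simp [this]
  | succ n ih =>
    rw [(integrable_sumProd_and_integral hX hi hid hf hint n).2 _ subset_rfl,
      Finset.sum_eq_add_of_mem ∅ s (Finset.empty_mem_powerset s) (Finset.mem_powerset_self s)
        hs.ne_empty.symm fun U hU hne => hz n U (Finset.mem_powerset.1 hU) hne.1 hne.2,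
      Finset.sdiff_empty, ih, Finset.sdiff_self]
    simp only [Finset.prod_empty, mean_const, sumProd, integral_const, probReal_univ, smul_eq_mul]
    push_cast
    ring

/-- The product moment of four centred sums, one of them uncorrelated with the others. -/
theorem integral_sumProd_of_card_eq_four {s : Finset ι} (hs : s.card = 4)
    (hint : ∀ T ⊆ s, Integrable (fun ω => ∏ i ∈ T, f i (X 0 ω)) μ) {z : ι} (hzs : z ∈ s)
    (hz : ∀ i ∈ s, i ≠ z → mean μ X (fun x => f i x * f z x) = 0) (n : ℕ) :
    ∫ ω, sumProd X f n s ω ∂μ = n * mean μ X fun x => ∏ i ∈ s, f i x := by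
  have one : ∀ i, mean μ X (fun x => ∏ j ∈ {i}, f j x) = 0 := fun i => by
    simp only [Finset.prod_singleton]
    exact h0 i
  have single : ∀ n, ∀ T ⊆ s, T.card = 1 → ∫ ω, sumProd X f n T ω ∂μ = 0 := fun n T hT hc => by
    obtain ⟨i, rfl⟩ := Finset.card_eq_one.1 hc
    rw [integral_sumProd_of_forall_eq_zero hX hi hid hf h0 (by simp)
      (fun U hU => hint U (hU.trans hT)), one, mul_zero]
    intro n U hU h1 h2
    rcases Finset.subset_singleton_iff.1 hU with rfl | rfl <;> contradiction
  have pair : ∀ T ⊆ s, T.card = 2 → z ∈ T → mean μ X (fun x => ∏ i ∈ T, f i x) = 0 :=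
    fun T hT hc hzT => by
    obtain ⟨i, hiT⟩ := Finset.card_eq_one.1
      (by rw [Finset.card_erase_of_mem hzT, hc] : (T.erase z).card = 1)
    have hi1 : i ∈ T.erase z := by rw [hiT]; exact Finset.mem_singleton_self i
    have hne := (Finset.mem_erase.1 hi1).1
    have hTe : T = {i, z} := by rw [← Finset.insert_erase hzT, hiT, Finset.pair_comm]
    simp only [hTe, Finset.prod_pair hne]
    exact hz i (hT (Finset.mem_erase.1 hi1).2) hne
  refine integral_sumProd_of_forall_eq_zero hX hi hid hf h0 ⟨z, hzs⟩ hint ?_ n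
  intro n U hU h1 h2
  have hc : U.card + (s \ U).card = 4 := by rw [Finset.card_sdiff_of_subset hU, hs]
                                            have := Finset.card_le_card hU; omega
  have hp : 0 < U.card := Finset.card_pos.2 (Finset.nonempty_of_ne_empty h1)
  have hp' : 0 < (s \ U).card := Finset.card_pos.2 (Finset.sdiff_nonempty.2 fun h =>
    h2 (Finset.Subset.antisymm hU h))
  -- The splits 1+3 and 3+1 vanish by centring. In a split 2+2 one of the pairs contains `z`, and
  -- that pair has mean zero.
  obtain h | h | h : U.card = 1 ∨ U.card = 2 ∨ U.card = 3 := by omega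
  · obtain ⟨i, rfl⟩ := Finset.card_eq_one.1 h
    rw [one, zero_mul]
  · by_cases hzU : z ∈ U
    · rw [pair U hU h hzU, zero_mul]
    · have hsub : s \ U ⊆ s := Finset.sdiff_subset
      rw [integral_sumProd_of_forall_eq_zero hX hi hid hf h0 ⟨z, Finset.mem_sdiff.2 ⟨hzs, hzU⟩⟩
        (fun T hT => hint T (hT.trans hsub)), pair (s \ U) hsub (by omega)
        (Finset.mem_sdiff.2 ⟨hzs, hzU⟩), mul_zero, mul_zero]
      intro k V hV hV1 hV2
      have h3 := Finset.card_pos.2 (Finset.nonempty_of_ne_empty hV1)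
      have h4 := Finset.card_lt_card (hV.ssubset_of_ne hV2)
      obtain ⟨i, rfl⟩ := Finset.card_eq_one.1 (by omega : V.card = 1)
      rw [one, zero_mul]
  · rw [single n _ Finset.sdiff_subset (by omega), mul_zero]

end SumMoments

/-! ### Polynomials in normalized sums -/

section Poly

variable {Ω 𝒳 : Type*} [MeasurableSpace Ω] [MeasurableSpace 𝒳]

/-- The span of the products of centred normalized sums of total degree at most `d`, where a
function bounded by a multiple of `(1 + b)^e` has degree `e`. -/
def polySpan (μ : Measure Ω) (X : ℕ → Ω → 𝒳) (b : 𝒳 → ℝ) (d : ℕ) : Submodule ℝ (ℕ → Ω → ℝ) :=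
  Submodule.span ℝ {F | ∃ (k : ℕ) (f : Fin k → 𝒳 → ℝ) (e : Fin k → ℕ),
    (∀ i, Dom b (e i) (f i)) ∧ (∀ i, mean μ X (f i) = 0) ∧ ∑ i, e i ≤ d ∧
    F = fun n ω => ∏ i, nsum X n (f i) ω}

variable {μ : Measure Ω} {X : ℕ → Ω → 𝒳} {b : 𝒳 → ℝ} {d d' : ℕ}

theorem polySpan_mono (h : d ≤ d') : polySpan μ X b d ≤ polySpan μ X b d' := by
  refine Submodule.span_mono ?_
  rintro F ⟨k, f, e, h1, h2, h3, h4⟩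
  exact ⟨k, f, e, h1, h2, h3.trans h, h4⟩

theorem nsum_mem_polySpan {f : 𝒳 → ℝ} (hf : Dom b d f) (h0 : mean μ X f = 0) :
    (fun n ω => nsum X n f ω) ∈ polySpan μ X b d :=
  Submodule.subset_span ⟨1, fun _ => f, fun _ => d, fun _ => hf, fun _ => h0, by simp, by
    ext; simp⟩

theorem mul_mem_polySpan {F F' : ℕ → Ω → ℝ} (h : F ∈ polySpan μ X b d)
    (h' : F' ∈ polySpan μ X b d') : F * F' ∈ polySpan μ X b (d + d') := by
  induction h using Submodule.span_induction with
  | zero => rw [zero_mul]; exact zero_mem _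
  | add x y _ _ hx hy => rw [add_mul]; exact add_mem hx hy
  | smul a x _ hx => rw [smul_mul_assoc]; exact Submodule.smul_mem _ _ hx
  | mem F hF =>
    induction h' using Submodule.span_induction with
    | zero => rw [mul_zero]; exact zero_mem _
    | add x y _ _ hx hy => rw [mul_add]; exact add_mem hx hy
    | smul a x _ hx => rw [mul_smul_comm]; exact Submodule.smul_mem _ _ hx
    | mem F' hF' =>
      obtain ⟨k, f, e, h1, h2, h3, rfl⟩ := hF
      obtain ⟨k', f', e', h1', h2', h3', rfl⟩ := hF'
      refine Submodule.subset_span ⟨k + k', Fin.append f f', Fin.append e e', ?_, ?_, ?_, ?_⟩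
      · intro i
        induction i using Fin.addCases with
        | left i => rw [Fin.append_left, Fin.append_left]; exact h1 i
        | right i => rw [Fin.append_right, Fin.append_right]; exact h1' i
      · intro i
        induction i using Fin.addCases with
        | left i => rw [Fin.append_left]; exact h2 i
        | right i => rw [Fin.append_right]; exact h2' i
      · rw [Fin.sum_univ_add]
        simp only [Fin.append_left, Fin.append_right]
        omega
      · ext n ω
        simp only [Fin.prod_univ_add, Fin.append_left, Fin.append_right]
        rfl

theorem nsum_prod_eq {k : ℕ} (f : Fin k → 𝒳 → ℝ) (n : ℕ) (ω : Ω) :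
    ∏ i, nsum X n (f i) ω = (√(n : ℝ))⁻¹ ^ k * sumProd X f n Finset.univ ω := by
  simp only [nsum, sumProd, Finset.prod_mul_distrib, Finset.prod_const, Finset.card_univ,
    Fintype.card_fin]

variable [IsProbabilityMeasure μ]

theorem integrable_prod_dom (hX : Measurable (X 0)) {q : ℕ}
    (hq : MemLp b q (μ.map (X 0))) {k : ℕ} {f : Fin k → 𝒳 → ℝ} {e : Fin k → ℕ}
    (hf : ∀ i, Dom b (e i) (f i)) (he : ∑ i, e i ≤ q) (T : Finset (Fin k)) :
    Integrable (fun ω => ∏ i ∈ T, f i (X 0 ω)) μ := by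
  exact (Dom.prod fun i _ => hf i).integrable hX hq ((Finset.sum_le_sum_of_subset (Finset.subset_univ T)).trans he)

/-- Polynomials in normalized sums have bounded means. -/
theorem integrable_and_bounded_of_mem_polySpan (hX : ∀ i, Measurable (X i)) (hi : iIndepFun X μ)
    (hid : ∀ i, IdentDistrib (X i) (X 0) μ μ) {q : ℕ}
    (hq : MemLp b q (μ.map (X 0))) (hd : d ≤ q) {F : ℕ → Ω → ℝ} (hF : F ∈ polySpan μ X b d) :
    (∀ n, Integrable (F n) μ) ∧ ∃ C, ∀ n, |∫ ω, F n ω ∂μ| ≤ C := by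
  induction hF using Submodule.span_induction with
  | zero => exact ⟨fun n => integrable_zero _ _ _, 0, fun n => by simp⟩
  | add x y _ _ hx hy =>
    obtain ⟨hx, C, hC⟩ := hx
    obtain ⟨hy, C', hC'⟩ := hy
    refine ⟨fun n => (hx n).add (hy n), C + C', fun n => ?_⟩
    have : ∫ ω, (x + y) n ω ∂μ = ∫ ω, x n ω ∂μ + ∫ ω, y n ω ∂μ := integral_add (hx n) (hy n)
    rw [this]
    exact (abs_add_le _ _).trans (add_le_add (hC n) (hC' n))
  | smul a x _ hx =>
    obtain ⟨hx, C, hC⟩ := hx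
    refine ⟨fun n => (hx n).const_mul a, |a| * C, fun n => ?_⟩
    have : ∫ ω, (a • x) n ω ∂μ = a * ∫ ω, x n ω ∂μ := integral_const_mul _ _
    rw [this, abs_mul]
    exact mul_le_mul_of_nonneg_left (hC n) (abs_nonneg _)
  | mem F hF =>
    obtain ⟨k, f, e, h1, h2, h3, rfl⟩ := hF
    have hint := integrable_prod_dom (hX 0) hq h1 (h3.trans hd)
    have hI := fun n => (integrable_sumProd_and_integral hX hi hid (fun i => (h1 i).1)
      (fun T _ => hint T) n).1 Finset.univ subset_rfl
    obtain ⟨C, hC0, hC⟩ := abs_integral_sumProd_le hX hi hid (fun i => (h1 i).1) h2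
      (s := Finset.univ) (fun T _ => hint T)
    simp only [nsum_prod_eq]
    refine ⟨fun n => (hI n).const_mul _, C, fun n => ?_⟩
    rw [integral_const_mul, abs_mul, abs_of_nonneg (by positivity)]
    have h := hC n
    rw [Finset.card_univ, Fintype.card_fin] at h
    refine (mul_le_mul_of_nonneg_left h (by positivity)).trans ?_
    rw [mul_left_comm, ← mul_pow]
    refine mul_le_of_le_one_right hC0 (pow_le_one₀ (by positivity) ?_)
    rcases eq_or_ne (√(n : ℝ)) 0 with h | h
    · rw [h, mul_zero]; exact zero_le_one
    · rw [inv_mul_cancel₀ h]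

/-- The normalization n⁻² meets only n surviving terms. Index 3 is the factor uncorrelated with the
others. -/
theorem integral_prod_four_nsum (hX : ∀ i, Measurable (X i)) (hi : iIndepFun X μ)
    (hid : ∀ i, IdentDistrib (X i) (X 0) μ μ) {q : ℕ} (hq : MemLp b q (μ.map (X 0))) (h4 : 4 ≤ q)
    {f : Fin 4 → 𝒳 → ℝ} (hf : ∀ i, Dom b 1 (f i)) (h0 : ∀ i, mean μ X (f i) = 0)
    (hz : ∀ i, i ≠ 3 → mean μ X (fun x => f i x * f 3 x) = 0) (n : ℕ) :
    ∫ ω, ∏ i, nsum X n (f i) ω ∂μ = (n : ℝ)⁻¹ * mean μ X fun x => ∏ i, f i x := by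
  have hint := integrable_prod_dom (hX 0) hq hf (by simpa using h4)
  simp only [nsum_prod_eq]
  rw [integral_const_mul, integral_sumProd_of_card_eq_four hX hi hid (fun i => (hf i).1) h0
    (by simp) (fun T _ => hint T) (Finset.mem_univ 3) (fun i _ => hz i), ← mul_assoc]
  congr 1
  rcases n.eq_zero_or_pos with rfl | hn
  · simp
  · have : (0 : ℝ) < n := Nat.cast_pos.2 hn
    rw [show (√(n : ℝ))⁻¹ ^ 4 = ((√(n : ℝ) ^ 2)⁻¹) ^ 2 by ring, Real.sq_sqrt this.le]
    field_simp

end Poly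

end ETEL

namespace ETEL

/-! ### The terms of the expansion as polynomials in normalized sums -/

section Membership

variable {Ω 𝒳 ι : Type*} [MeasurableSpace Ω] [MeasurableSpace 𝒳] [Fintype ι] [DecidableEq ι]
  {μ : Measure Ω} [IsProbabilityMeasure μ] {X : ℕ → Ω → 𝒳} {φ : 𝒳 → (ι → ℝ) → ι → ℝ} {βs : ι → ℝ}
  {b : 𝒳 → ℝ}

theorem neg_sum_mul_mem {κ : Type*} [Fintype κ] {S : Submodule ℝ (ℕ → Ω → ℝ)} {c : κ → ℝ}
    {F : κ → ℕ → Ω → ℝ} (h : ∀ i, F i ∈ S) : (fun n ω => -∑ i, c i * F i n ω) ∈ S := by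
  have : (fun n ω => -∑ i, c i * F i n ω) = -∑ i, c i • F i := by
    ext n ω
    simp [Finset.sum_apply]
  rw [this]
  exact neg_mem (Submodule.sum_mem _ fun i _ => Submodule.smul_mem _ _ (h i))

theorem sum_fun_mem {κ : Type*} [Fintype κ] {S : Submodule ℝ (ℕ → Ω → ℝ)}
    {F : κ → ℕ → Ω → ℝ} (h : ∀ i, F i ∈ S) : (fun n ω => ∑ i, F i n ω) ∈ S := by
  have : (fun n ω => ∑ i, F i n ω) = ∑ i, F i := by
    ext n ω
    simp [Finset.sum_apply]
  rw [this]
  exact Submodule.sum_mem _ fun i _ => h i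

omit [IsProbabilityMeasure μ] in
theorem mul_fun_mem_polySpan {d d' : ℕ} {F F' : ℕ → Ω → ℝ}
    (h : (fun n ω => F n ω) ∈ polySpan μ X b d) (h' : (fun n ω => F' n ω) ∈ polySpan μ X b d') :
    (fun n ω => F n ω * F' n ω) ∈ polySpan μ X b (d + d') := mul_mem_polySpan h h'

theorem const_mul_fun_mem {S : Submodule ℝ (ℕ → Ω → ℝ)} (c : ℝ) {F : ℕ → Ω → ℝ}
    (h : (fun n ω => F n ω) ∈ S) : (fun n ω => c * F n ω) ∈ S := S.smul_mem c h

theorem add_fun_mem {S : Submodule ℝ (ℕ → Ω → ℝ)} {F F' : ℕ → Ω → ℝ}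
    (h : (fun n ω => F n ω) ∈ S) (h' : (fun n ω => F' n ω) ∈ S) :
    (fun n ω => F n ω + F' n ω) ∈ S := S.add_mem h h'

variable (hφ : HasEnvelope φ βs b) (h0 : ∀ l, mean μ X (fun x => φ x βs l) = 0)
  (hX : Measurable (X 0)) {q : ℕ} (hq : MemLp b q (μ.map (X 0)))
include hφ

include h0 in
theorem PsiBar_mem_polySpan (l : ι) :
    (fun n ω => PsiBar μ X φ βs n ω l) ∈ polySpan μ X b 1 :=
  neg_sum_mul_mem fun h => nsum_mem_polySpan (hφ.dom0 h) (h0 h)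

theorem Dom.centred_mem_polySpan {f : 𝒳 → ℝ} {d : ℕ} (hf : Dom b d f)
    (hX : Measurable (X 0)) (hq : MemLp b q (μ.map (X 0))) (hd : d ≤ q) :
    (fun n ω => nsum X n (fun x => f x - mean μ X f) ω) ∈ polySpan μ X b d := by
  refine nsum_mem_polySpan (hf.sub (Dom.const' hφ.b_nonneg _ d)) ?_
  rw [mean_sub (hf.integrable hX hq hd) (integrable_const _), mean_const, sub_self]

include hX hq in
theorem PsiBar1_mem_polySpan (h2 : 2 ≤ q) (l j : ι) :
    (fun n ω => PsiBar1 μ X φ βs n ω l j) ∈ polySpan μ X b 2 :=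
  neg_sum_mul_mem fun h => Dom.centred_mem_polySpan hφ (hφ.dom1 h j) hX hq h2

include hX hq in
theorem PsiBar2_mem_polySpan (h3 : 3 ≤ q) (l j k : ι) :
    (fun n ω => PsiBar2 μ X φ βs n ω l j k) ∈ polySpan μ X b 3 :=
  neg_sum_mul_mem fun h => Dom.centred_mem_polySpan hφ (hφ.dom2 h j k) hX hq h3

include hX hq h0 in
theorem QBar_mem_polySpan (h2 : 2 ≤ q) (l : ι) :
    (fun n ω => QBar μ X φ βs n ω l) ∈ polySpan μ X b 3 := by
  have hP := PsiBar_mem_polySpan hφ h0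
  have t₁ := sum_fun_mem fun j =>
    mul_fun_mem_polySpan (PsiBar1_mem_polySpan hφ hX hq h2 l j) (hP j)
  have t₂ := const_mul_fun_mem (1 / 2) (sum_fun_mem fun j => sum_fun_mem fun k =>
    mul_fun_mem_polySpan (const_mul_fun_mem (Psi2 μ X φ βs l j k) (hP j)) (hP k))
  simp only [QBar]
  exact add_fun_mem t₁ (polySpan_mono (by norm_num) t₂)

include hX hq h0 in
-- Centred derivatives of order j have degree j + 1, so the leading products have degree 2 + 3 and 3
-- + 1 + 1. This count fixes the moments required: six for R̄Ψ̄ and ten for R̄².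
theorem RBar_mem_polySpan (h3 : 3 ≤ q) (l : ι) :
    (fun n ω => RBar μ X φ βs n ω l) ∈ polySpan μ X b 5 := by
  have hP := PsiBar_mem_polySpan hφ h0
  have hQ := QBar_mem_polySpan hφ h0 hX hq (by omega)
  have t₁ := sum_fun_mem fun j =>
    mul_fun_mem_polySpan (PsiBar1_mem_polySpan hφ hX hq (by omega) l j) (hQ j)
  have t₂ := sum_fun_mem fun j => sum_fun_mem fun k =>
    mul_fun_mem_polySpan (const_mul_fun_mem (Psi2 μ X φ βs l j k) (hQ j)) (hP k)
  have t₃ := const_mul_fun_mem (1 / 2) (sum_fun_mem fun j => sum_fun_mem fun k =>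
    mul_fun_mem_polySpan (mul_fun_mem_polySpan (PsiBar2_mem_polySpan hφ hX hq h3 l j k) (hP j))
      (hP k))
  have t₄ := const_mul_fun_mem (1 / 6) (sum_fun_mem fun j => sum_fun_mem fun k => sum_fun_mem fun h =>
    mul_fun_mem_polySpan (mul_fun_mem_polySpan
      (const_mul_fun_mem (Psi3 μ X φ βs l j k h) (hP j)) (hP k)) (hP h))
  simp only [RBar]
  exact add_fun_mem (add_fun_mem (add_fun_mem t₁ (polySpan_mono (by norm_num) t₂)) t₃)
    (polySpan_mono (by norm_num) t₄)

end Membership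

end ETEL

namespace ETEL

/-! ### Terms that are asymptotically uncorrelated with the first-order term for `θ` -/

section Uncorrelated

variable {Ω 𝒳 : Type*} [MeasurableSpace Ω] {m p : ℕ}

/-- The functions `P g`. -/
noncomputable def projFun (g : 𝒳 → (Fin p → ℝ) → Fin m → ℝ) (μ : Measure Ω) (X : ℕ → Ω → 𝒳)
    (θs : Fin p → ℝ) (a : Fin m) (x : 𝒳) : ℝ := -∑ c, PMat g μ X θs a c * g x θs c

/-- The influence functions of the estimators of `θ`. -/
noncomputable def inflFun (g : 𝒳 → (Fin p → ℝ) → Fin m → ℝ) (μ : Measure Ω) (X : ℕ → Ω → 𝒳)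
    (θs : Fin p → ℝ) (l : Fin p) (x : 𝒳) : ℝ := -∑ c, HMat g μ X θs l c * g x θs c

/-- The span of the products of two normalized sums of `projFun`. -/
noncomputable def quadSpan (g : 𝒳 → (Fin p → ℝ) → Fin m → ℝ) (μ : Measure Ω) (X : ℕ → Ω → 𝒳)
    (θs : Fin p → ℝ) : Submodule ℝ (ℕ → Ω → ℝ) :=
  Submodule.span ℝ {F | ∃ a c : Fin m, F = fun n ω =>
    psiVec g μ X θs n ω (iκ a) * psiVec g μ X θs n ω (iκ c)}

/-- The span of the products of three normalized sums of `projFun`. -/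
noncomputable def cubicSpan (g : 𝒳 → (Fin p → ℝ) → Fin m → ℝ) (μ : Measure Ω) (X : ℕ → Ω → 𝒳)
    (θs : Fin p → ℝ) : Submodule ℝ (ℕ → Ω → ℝ) :=
  Submodule.span ℝ {F | ∃ a c e : Fin m, F = fun n ω =>
    psiVec g μ X θs n ω (iκ e) * (psiVec g μ X θs n ω (iκ a) * psiVec g μ X θs n ω (iκ c))}

variable {g : 𝒳 → (Fin p → ℝ) → Fin m → ℝ} {θs : Fin p → ℝ} {μ : Measure Ω} {X : ℕ → Ω → 𝒳}

theorem psiVec_κ (n : ℕ) (ω : Ω) (a : Fin m) :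
    psiVec g μ X θs n ω (iκ a) = nsum X n (projFun g μ X θs a) ω := by
  have : projFun g μ X θs a = fun x => ∑ c, (-PMat g μ X θs a c) * g x θs c := by
    ext x; simp only [projFun, neg_mul, Finset.sum_neg_distrib]
  rw [this, nsum_sum]
  simp only [nsum_const_mul]
  simp only [neg_mul, Finset.sum_neg_distrib]
  rfl

theorem psiVec_θ (n : ℕ) (ω : Ω) (l : Fin p) :
    psiVec g μ X θs n ω (iθ l) = nsum X n (inflFun g μ X θs l) ω := by
  have : inflFun g μ X θs l = fun x => ∑ c, (-HMat g μ X θs l c) * g x θs c := by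
    ext x; simp only [inflFun, neg_mul, Finset.sum_neg_distrib]
  rw [this, nsum_sum]
  simp only [nsum_const_mul]
  simp only [neg_mul, Finset.sum_neg_distrib]
  rfl

theorem mul_mem_cubicSpan {F : ℕ → Ω → ℝ} (h : F ∈ quadSpan g μ X θs) (e : Fin m) :
    (fun n ω => psiVec g μ X θs n ω (iκ e) * F n ω) ∈ cubicSpan g μ X θs := by
  induction h using Submodule.span_induction with
  | zero => simp only [Pi.zero_apply, mul_zero]; exact zero_mem _
  | add x y _ _ hx hy => simp only [Pi.add_apply, mul_add]; exact add_mem hx hy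
  | smul a x _ hx =>
    simp only [Pi.smul_apply, smul_eq_mul, mul_left_comm _ a]
    exact Submodule.smul_mem _ _ hx
  | mem F hF =>
    obtain ⟨a, c, rfl⟩ := hF
    exact Submodule.subset_span ⟨a, c, e, rfl⟩

variable [MeasurableSpace 𝒳] [IsProbabilityMeasure μ] {N : Set (Fin p → ℝ)} {b : 𝒳 → ℝ}

namespace IsRegularModel

variable (hM : IsRegularModel μ X g θs N b)
include hM

theorem dom_neg_sum_mul_g (c : Fin m → ℝ) : Dom b 1 (fun x => -∑ a, c a * g x θs a) :=
  (Dom.sum hM.b_nonneg fun a _ => (hM.dom_g a).const_mul _).neg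

theorem mean_neg_sum_mul_g (c : Fin m → ℝ) : mean μ X (fun x => -∑ a, c a * g x θs a) = 0 := by
  have : (fun x => -∑ a, c a * g x θs a) = fun x => ∑ a, (-c a) * g x θs a := by
    ext x; simp only [neg_mul, Finset.sum_neg_distrib]
  rw [this, mean_sum _ fun a _ => hM.integrable_dom ((hM.dom_g a).const_mul _) (by norm_num)]
  simp only [mean_const_mul, hM.mean_zero, mul_zero, Finset.sum_const_zero]

theorem mean_projFun_mul_inflFun (a : Fin m) (l : Fin p) :
    mean μ X (fun x => projFun g μ X θs a x * inflFun g μ X θs l x) = 0 := by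
  have h := congrFun (congrFun hM.P_mul_omega_mul_H_transpose a) l
  have e : (fun x => projFun g μ X θs a x * inflFun g μ X θs l x) = fun x => ∑ c, ∑ d,
      PMat g μ X θs a c * HMat g μ X θs l d * (g x θs c * g x θs d) := by
    ext x
    simp only [projFun, inflFun, neg_mul_neg, Finset.sum_mul_sum]
    exact Finset.sum_congr rfl fun c _ => Finset.sum_congr rfl fun d _ => by ring
  have i := fun c d => hM.integrable_dom (((hM.dom_g c).mul (hM.dom_g d)).const_mul
    (PMat g μ X θs a c * HMat g μ X θs l d)) (by norm_num)
  rw [e, mean_sum _ fun c _ => integrable_finsetSum _ fun d _ => i c d, ← Matrix.zero_apply a l, ← h,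
    Matrix.mul_apply]
  refine Finset.sum_congr rfl fun c _ => ?_
  rw [mean_sum _ fun d _ => i c d, Matrix.mul_apply, Finset.mul_sum]
  refine Finset.sum_congr rfl fun d _ => ?_
  rw [mean_const_mul, transpose_apply]
  simp only [OmegaMat, of_apply]
  ring

/-- By linearity it suffices to treat one product of three normalized sums of Pg with a normalized
sum of the influence function. The latter is uncorrelated with the former three, so no pairing
contributes at order one and the fourth-moment formula leaves n⁻¹. -/
theorem integral_mul_psiVec_of_mem_cubicSpan {F : ℕ → Ω → ℝ} (hF : F ∈ cubicSpan g μ X θs)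
    (l : Fin p) :
    (∀ n, Integrable (fun ω => F n ω * psiVec g μ X θs n ω (iθ l)) μ) ∧
      ∃ C : ℝ, ∀ n : ℕ, |∫ ω, F n ω * psiVec g μ X θs n ω (iθ l) ∂μ| ≤ C * (n : ℝ)⁻¹ := by
  induction hF using Submodule.span_induction with
  | zero => simp only [Pi.zero_apply, zero_mul]; exact ⟨fun _ => integrable_zero _ _ _, 0, by simp⟩
  | add x y _ _ hx hy =>
    obtain ⟨hx, C, hC⟩ := hx
    obtain ⟨hy, C', hC'⟩ := hy
    simp only [Pi.add_apply, add_mul]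
    refine ⟨fun n => (hx n).add (hy n), C + C', fun n => ?_⟩
    rw [integral_add (hx n) (hy n), add_mul]
    exact (abs_add_le _ _).trans (add_le_add (hC n) (hC' n))
  | smul a x _ hx =>
    obtain ⟨hx, C, hC⟩ := hx
    simp only [Pi.smul_apply, smul_eq_mul, mul_assoc]
    refine ⟨fun n => (hx n).const_mul a, |a| * C, fun n => ?_⟩
    rw [integral_const_mul, abs_mul, mul_assoc]
    exact mul_le_mul_of_nonneg_left (hC n) (abs_nonneg _)
  | mem F hF =>
    obtain ⟨a, c, e, rfl⟩ := hF
    let f : Fin 4 → 𝒳 → ℝ := ![projFun g μ X θs e, projFun g μ X θs a, projFun g μ X θs c,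
      inflFun g μ X θs l]
    have hf : ∀ i, Dom b 1 (f i) := fun i => by
      fin_cases i <;> exact hM.dom_neg_sum_mul_g _
    have h0 : ∀ i, mean μ X (f i) = 0 := fun i => by
      fin_cases i <;> exact hM.mean_neg_sum_mul_g _
    have hz : ∀ i, i ≠ 3 → mean μ X (fun x => f i x * f 3 x) = 0 := fun i hi => by
      fin_cases i
      · exact hM.mean_projFun_mul_inflFun e l
      · exact hM.mean_projFun_mul_inflFun a l
      · exact hM.mean_projFun_mul_inflFun c l
      · exact absurd rfl hi
    have e1 : ∀ n ω, psiVec g μ X θs n ω (iκ e) *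
        (psiVec g μ X θs n ω (iκ a) * psiVec g μ X θs n ω (iκ c)) * psiVec g μ X θs n ω (iθ l) =
        ∏ i, nsum X n (f i) ω := fun n ω => by
      rw [Fin.prod_univ_four, psiVec_κ, psiVec_κ, psiVec_κ, psiVec_θ, ← mul_assoc]
      rfl
    simp only [e1]
    have hmem : (fun n ω => ∏ i, nsum X n (f i) ω) ∈ polySpan μ X b 4 :=
      Submodule.subset_span ⟨4, f, fun _ => 1, hf, h0, by simp, rfl⟩
    refine ⟨(integrable_and_bounded_of_mem_polySpan hM.measurable_X hM.indep hM.ident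
      hM.memLp_six (by norm_num) hmem).1, |mean μ X fun x => ∏ i, f i x|, fun n => ?_⟩
    rw [integral_prod_four_nsum hM.measurable_X hM.indep hM.ident hM.memLp_six (by norm_num) hf h0 hz,
      abs_mul, abs_of_nonneg (by positivity), mul_comm]

theorem mean_mul_sum_mul_sum (a : Fin m) (u v : Fin m → ℝ) :
    mean μ X (fun x => g x θs a * ((∑ c, u c * g x θs c) * ∑ d, v d * g x θs d)) =
      ∑ c, u c * ∑ d, mean μ X (fun x => g x θs a * (g x θs c * g x θs d)) * v d := by
  have e : (fun x => g x θs a * ((∑ c, u c * g x θs c) * ∑ d, v d * g x θs d)) = fun x => ∑ c, ∑ d,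
      u c * v d * (g x θs a * (g x θs c * g x θs d)) := by
    ext x
    rw [Finset.sum_mul_sum]
    simp only [Finset.mul_sum]
    exact Finset.sum_congr rfl fun c _ => Finset.sum_congr rfl fun d _ => by ring
  have i := fun c d => hM.integrable_dom (((hM.dom_g a).mul ((hM.dom_g c).mul (hM.dom_g d))).const_mul
    (u c * v d)) (by norm_num)
  rw [e, mean_sum _ fun c _ => integrable_finsetSum _ fun d _ => i c d]
  refine Finset.sum_congr rfl fun c _ => ?_
  rw [mean_sum _ fun d _ => i c d, Finset.mul_sum]
  refine Finset.sum_congr rfl fun d _ => ?_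
  rw [mean_const_mul]
  ring

theorem mean_mul_sum_pow_three (a : Fin m) (u : Fin m → ℝ) :
    mean μ X (fun x => g x θs a * (∑ c, u c * g x θs c) ^ 3) =
      ∑ c, ∑ d, ∑ e, mean μ X (fun x => g x θs a * (g x θs c * (g x θs d * g x θs e)))
        * (u c * (u d * u e)) := by
  have e : (fun x => g x θs a * (∑ c, u c * g x θs c) ^ 3) = fun x => ∑ c, ∑ d, ∑ e,
      u c * (u d * u e) * (g x θs a * (g x θs c * (g x θs d * g x θs e))) := by
    ext x
    rw [pow_succ', pow_two, Finset.sum_mul_sum, Finset.sum_mul_sum]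
    simp only [Finset.mul_sum]
    exact Finset.sum_congr rfl fun c _ => Finset.sum_congr rfl fun d _ =>
      Finset.sum_congr rfl fun e _ => by ring
  have i := fun c d e => hM.integrable_dom (((hM.dom_g a).mul ((hM.dom_g c).mul
    ((hM.dom_g d).mul (hM.dom_g e)))).const_mul (u c * (u d * u e))) (by norm_num)
  rw [e, mean_sum _ fun c _ => integrable_finsetSum _ fun d _ => integrable_finsetSum _
    fun e _ => i c d e]
  refine Finset.sum_congr rfl fun c _ => ?_
  rw [mean_sum _ fun d _ => integrable_finsetSum _ fun e _ => i c d e]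
  refine Finset.sum_congr rfl fun d _ => ?_
  rw [mean_sum _ fun e _ => i c d e]
  exact Finset.sum_congr rfl fun e _ => by rw [mean_const_mul, mul_comm]

theorem cubic_term_mem_cubicSpan (l : Fin p) :
    (fun n ω => (HMat g μ X θs *ᵥ fun a => mean μ X fun x => g x θs a *
        blockDot g θs iκ (psiVec g μ X θs n ω) x ^ 3) l) ∈ cubicSpan g μ X θs := by
  simp only [mulVec, dotProduct, blockDot, hM.mean_mul_sum_pow_three]
  exact sum_fun_mem fun a => const_mul_fun_mem _ (sum_fun_mem fun c => sum_fun_mem fun d =>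
    sum_fun_mem fun e => const_mul_fun_mem _ (Submodule.subset_span ⟨d, e, c, rfl⟩))

/-- The gap between the λ- and κ-parts of Q̄ is quadratic in Pḡ; it is multiplied by one more factor
Pḡ, and all coefficients are population third moments. -/
theorem mixed_term_mem_cubicSpan (l : Fin p) :
    (fun n ω => (HMat g μ X θs *ᵥ fun a => mean μ X fun x => g x θs a *
          (blockDot g θs iκ (psiVec g μ X θs n ω) x *
            (blockDot g θs iΛ (QBar μ X (phiETEL g) (betaStar θs) n ω) x
              - blockDot g θs iκ (QBar μ X (phiETEL g) (betaStar θs) n ω) x))) l)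
      ∈ cubicSpan g μ X θs := by
  have e : ∀ n ω x, blockDot g θs iΛ (QBar μ X (phiETEL g) (betaStar θs) n ω) x
      - blockDot g θs iκ (QBar μ X (phiETEL g) (betaStar θs) n ω) x = ∑ c,
      1 / 2 * ((OmegaMat g μ X θs)⁻¹ *ᵥ fun a => mean μ X fun x =>
        g x θs a * blockDot g θs iκ (psiVec g μ X θs n ω) x ^ 2) c * g x θs c := fun n ω x => by
    simp only [← hM.QBar_Λ_sub_κ, sub_mul, Finset.sum_sub_distrib]
    rfl
  simp only [e]
  simp only [mulVec, dotProduct, blockDot, hM.mean_mul_sum_mul_sum, sq]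
  refine sum_fun_mem fun a => const_mul_fun_mem _ (sum_fun_mem fun c => mul_mem_cubicSpan
    (F := fun n ω => _) ?_ c)
  refine sum_fun_mem fun d => const_mul_fun_mem _ (const_mul_fun_mem _ (sum_fun_mem fun e =>
    const_mul_fun_mem _ (sum_fun_mem fun c' => ?_)))
  simp only [Finset.mul_sum]
  refine sum_fun_mem fun d' => ?_
  have := const_mul_fun_mem (mean μ X fun x => g x θs e * (g x θs c' * g x θs d'))
    (Submodule.subset_span ⟨c', d', rfl⟩ : (fun n ω => psiVec g μ X θs n ω (iκ c') *
      psiVec g μ X θs n ω (iκ d')) ∈ quadSpan g μ X θs)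
  simp only [mul_left_comm] at this ⊢
  exact this

theorem RBar_sub_mem_cubicSpan (l : Fin p) :
    (fun n ω => RBar μ X (phiETEL g) (betaStar θs) n ω (iθ l)
      - RBar μ X (phiEL g) (betaStar θs) n ω (iθ l)) ∈ cubicSpan g μ X θs := by
  simp only [hM.RBar_sub]
  exact sub_mem (const_mul_fun_mem _ (hM.cubic_term_mem_cubicSpan l))
    (hM.mixed_term_mem_cubicSpan l)

end IsRegularModel

end Uncorrelated

end ETEL

namespace ETEL

/-! ### Variances -/

section Orders

theorem isBigO_inv_of_abs_le {a : ℕ → ℝ} {C : ℝ} (h : ∀ n : ℕ, |a n| ≤ C * (n : ℝ)⁻¹) :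
    a =O[atTop] fun n : ℕ => (n : ℝ)⁻¹ :=
  IsBigO.of_bound C (Eventually.of_forall fun n => by
    rw [Real.norm_eq_abs, Real.norm_of_nonneg (by positivity)]
    exact h n)

theorem isLittleO_mul_of_tendsto {a e : ℕ → ℝ} (h : Tendsto a atTop (𝓝 0)) :
    (fun n => e n * a n) =o[atTop] e := by
  have := (isBigO_refl e atTop).mul_isLittleO ((isLittleO_one_iff ℝ).2 h)
  simpa only [mul_one] using this

theorem isLittleO_mul_of_abs_le {a e : ℕ → ℝ} {C : ℝ} (h : ∀ n : ℕ, |a n| ≤ C * (n : ℝ)⁻¹) :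
    (fun n => e n * a n) =o[atTop] e := by
  refine isLittleO_mul_of_tendsto (squeeze_zero_norm (fun n => (h n : ‖a n‖ ≤ _)) ?_)
  simpa using (tendsto_inv_atTop_nhds_zero_nat (𝕜 := ℝ)).const_mul C

theorem tendsto_inv_sqrt_mul_of_abs_le {a : ℕ → ℝ} {C : ℝ} (h : ∀ n : ℕ, |a n| ≤ C) :
    Tendsto (fun n : ℕ => (√(n : ℝ))⁻¹ * a n) atTop (𝓝 0) := by
  have h1 : Tendsto (fun n : ℕ => (√(n : ℝ))⁻¹) atTop (𝓝 0) :=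
    tendsto_inv_atTop_zero.comp (Real.tendsto_sqrt_atTop.comp tendsto_natCast_atTop_atTop)
  refine squeeze_zero_norm (fun n => ?_) (by simpa using h1.mul_const C)
  rw [norm_mul, Real.norm_eq_abs, Real.norm_eq_abs, abs_of_nonneg (by positivity)]
  exact mul_le_mul_of_nonneg_left (h n) (by positivity)

theorem inv_sqrt_sq (n : ℕ) : (√(n : ℝ))⁻¹ ^ 2 = (n : ℝ)⁻¹ := by
  rw [inv_pow, Real.sq_sqrt (Nat.cast_nonneg n)]

end Orders

section Covariance

variable {Ω : Type*} [MeasurableSpace Ω] {μ : Measure Ω} [IsProbabilityMeasure μ]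

theorem covariance_eq_integral_mul {A B : Ω → ℝ} (hB : Integrable B μ)
    (hAB : Integrable (fun ω => A ω * B ω) μ) (h0 : ∫ ω, B ω ∂μ = 0) :
    cov[A, B; μ] = ∫ ω, A ω * B ω ∂μ := by
  have : ∀ ω, (A ω - μ[A]) * (B ω - μ[B]) = A ω * B ω - μ[A] * B ω := fun ω => by rw [h0]; ring
  rw [covariance]
  simp only [this]
  rw [integral_sub hAB (hB.const_mul _), integral_const_mul, h0, mul_zero, sub_zero]

/-- Weighted arithmetic–geometric mean inequality. The free parameter `t` is later taken
proportional to n⁻¹, to balance a variance of order n⁻¹ against a mean square of order o(n⁻³). -/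
theorem abs_covariance_le {A B : Ω → ℝ} (hA : MemLp A 2 μ) (hB : MemLp B 2 μ) {t : ℝ} (ht : 0 < t) :
    |cov[A, B; μ]| ≤ t * cov[A, A; μ] + t⁻¹ * ∫ ω, B ω ^ 2 ∂μ := by
  have hA' : MemLp (fun ω => A ω - μ[A]) 2 μ := hA.sub (memLp_const _)
  have hB' : MemLp (fun ω => B ω - μ[B]) 2 μ := hB.sub (memLp_const _)
  have i1 := hA'.integrable_sq.const_mul t
  have i2 := hB'.integrable_sq.const_mul t⁻¹
  have e1 : cov[A, A; μ] = ∫ ω, (A ω - μ[A]) ^ 2 ∂μ := by simp only [covariance, sq]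
  have e2 : ∫ ω, (B ω - μ[B]) ^ 2 ∂μ ≤ ∫ ω, B ω ^ 2 ∂μ := by
    have := variance_le_expectation_sq (μ := μ) hB.1
    rwa [variance_eq_integral hB.1.aemeasurable] at this
  have h := norm_integral_le_of_norm_le (i1.add i2)
    (f := fun ω => (A ω - μ[A]) * (B ω - μ[B])) (Eventually.of_forall fun ω => ?_)
  · rw [e1]
    refine h.trans ?_
    have e3 : ∫ ω, ((fun ω => t * (A ω - μ[A]) ^ 2) + fun ω => t⁻¹ * (B ω - μ[B]) ^ 2) ω ∂μ =
        t * ∫ ω, (A ω - μ[A]) ^ 2 ∂μ + t⁻¹ * ∫ ω, (B ω - μ[B]) ^ 2 ∂μ := by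
      rw [← integral_const_mul, ← integral_const_mul]
      exact integral_add i1 i2
    rw [e3]
    have := mul_le_mul_of_nonneg_left e2 (inv_pos.2 ht).le
    linarith
  · simp only [Pi.add_apply]
    generalize A ω - μ[A] = x
    generalize B ω - μ[B] = y
    rw [Real.norm_eq_abs, abs_mul, ← sq_abs x, ← sq_abs y]
    have h1 : t * t⁻¹ = 1 := mul_inv_cancel₀ ht.ne'
    have h2 : 0 ≤ t⁻¹ * (t * |x| - |y|) ^ 2 := by positivity
    have h3 : t⁻¹ * (t * |x| - |y|) ^ 2 = t * t⁻¹ * (t * |x| ^ 2) - 2 * (t * t⁻¹) * (|x| * |y|)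
      + t⁻¹ * |y| ^ 2 := by ring
    rw [h3, h1] at h2
    have : 0 ≤ |x| * |y| := by positivity
    nlinarith

theorem covariance_add_add {A B A' B' : Ω → ℝ} (hA : MemLp A 2 μ) (hB : MemLp B 2 μ)
    (hA' : MemLp A' 2 μ) (hB' : MemLp B' 2 μ) :
    cov[fun ω => A ω + B ω, fun ω => A' ω + B' ω; μ] =
      cov[A, A'; μ] + cov[A, B'; μ] + cov[B, A'; μ] + cov[B, B'; μ] := by
  have := covariance_add_left hA hB (hA'.add hB')
  rw [covariance_add_right hA hA' hB', covariance_add_right hB hA' hB'] at this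
  rw [← add_assoc] at this
  exact this

theorem covariance_linear_comb {A B C A' B' C' : Ω → ℝ} (hA : MemLp A 2 μ) (hB : MemLp B 2 μ)
    (hC : MemLp C 2 μ) (hA' : MemLp A' 2 μ) (hB' : MemLp B' 2 μ) (hC' : MemLp C' 2 μ) (x y z : ℝ) :
    cov[fun ω => x * A ω + y * B ω + z * C ω, fun ω => x * A' ω + y * B' ω + z * C' ω; μ] =
      x ^ 2 * cov[A, A'; μ] + x * y * (cov[A, B'; μ] + cov[B, A'; μ]) + y ^ 2 * cov[B, B'; μ]
      + x * z * (cov[C, A'; μ] + cov[A, C'; μ]) + y * z * (cov[B, C'; μ] + cov[C, B'; μ])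
      + z ^ 2 * cov[C, C'; μ] := by
  have left : ∀ {F : Ω → ℝ}, MemLp F 2 μ → cov[fun ω => x * A ω + y * B ω, F; μ] =
      x * cov[A, F; μ] + y * cov[B, F; μ] := fun {F} hF => by
    have := covariance_add_left (hA.const_mul x) (hB.const_mul y) hF
    rwa [covariance_const_mul_left, covariance_const_mul_left] at this
  have right : ∀ {F : Ω → ℝ}, MemLp F 2 μ → cov[F, fun ω => x * A' ω + y * B' ω; μ] =
      x * cov[F, A'; μ] + y * cov[F, B'; μ] := fun {F} hF => by
    have := covariance_add_right hF (hA'.const_mul x) (hB'.const_mul y)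
    rwa [covariance_const_mul_right, covariance_const_mul_right] at this
  have hF' : MemLp (fun ω => x * A' ω + y * B' ω) 2 μ := (hA'.const_mul x).add (hB'.const_mul y)
  rw [covariance_add_add (A := fun ω => x * A ω + y * B ω) (B := fun ω => z * C ω)
    (A' := fun ω => x * A' ω + y * B' ω) (B' := fun ω => z * C' ω)
    ((hA.const_mul x).add (hB.const_mul y)) (hC.const_mul z) hF' (hC'.const_mul z)]
  simp only [covariance_const_mul_left, covariance_const_mul_right, left hF', left hC', right hA,
    right hB, right hC]
  ring

end Covariance

/-! ### Covariances of the expansion and effect of the remainder -/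

section Expansion

variable {Ω 𝒳 ι : Type*} [MeasurableSpace Ω] [MeasurableSpace 𝒳] [Fintype ι] [DecidableEq ι]
  {μ : Measure Ω} [IsProbabilityMeasure μ] {X : ℕ → Ω → 𝒳} {φ : 𝒳 → (ι → ℝ) → ι → ℝ} {βs : ι → ℝ}
  {b : 𝒳 → ℝ} (hX : ∀ i, Measurable (X i)) (hi : iIndepFun X μ)
  (hid : ∀ i, IdentDistrib (X i) (X 0) μ μ) {q d d' : ℕ} (hq : MemLp b q (μ.map (X 0)))
include hX hi hid hq

theorem memLp_two_of_mem_polySpan (hd : d + d ≤ q) {F : ℕ → Ω → ℝ}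
    (hF : F ∈ polySpan μ X b d) (n : ℕ) : MemLp (F n) 2 μ := by
  have h1 := (integrable_and_bounded_of_mem_polySpan hX hi hid hq (by omega) hF).1 n
  have h2 := (integrable_and_bounded_of_mem_polySpan hX hi hid hq hd (mul_mem_polySpan hF hF)).1 n
  refine (memLp_two_iff_integrable_sq h1.1).2 ?_
  simp only [sq]
  exact h2

theorem abs_covariance_le_of_mem_polySpan (hd : d + d ≤ q) (hd' : d' + d' ≤ q) {F F' : ℕ → Ω → ℝ}
    (hF : F ∈ polySpan μ X b d) (hF' : F' ∈ polySpan μ X b d') :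
    ∃ C, ∀ n, |cov[F n, F' n; μ]| ≤ C := by
  obtain ⟨C₁, h₁⟩ := (integrable_and_bounded_of_mem_polySpan hX hi hid hq (by omega) hF).2
  obtain ⟨C₂, h₂⟩ := (integrable_and_bounded_of_mem_polySpan hX hi hid hq (by omega) hF').2
  obtain ⟨C₃, h₃⟩ := (integrable_and_bounded_of_mem_polySpan hX hi hid hq (by omega)
    (mul_mem_polySpan hF hF')).2
  refine ⟨C₃ + C₁ * C₂, fun n => ?_⟩
  rw [covariance_eq_sub (memLp_two_of_mem_polySpan hX hi hid hq hd hF n)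
    (memLp_two_of_mem_polySpan hX hi hid hq hd' hF' n)]
  refine (abs_sub _ _).trans (add_le_add (h₃ n) ?_)
  rw [abs_mul]
  exact mul_le_mul (h₁ n) (h₂ n) (abs_nonneg _) ((abs_nonneg _).trans (h₁ n))

variable (hφ : HasEnvelope φ βs b) (h0 : ∀ l, mean μ X (fun x => φ x βs l) = 0) (h10 : 10 ≤ q)
include hφ h0 h10

theorem memLp_expansion (l : ι) (n : ℕ) : MemLp (fun ω => expansion μ X φ βs n ω l) 2 μ := by
  have hP := memLp_two_of_mem_polySpan hX hi hid hq (by omega) (PsiBar_mem_polySpan hφ h0 l) n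
  have hQ := memLp_two_of_mem_polySpan hX hi hid hq (by omega)
    (QBar_mem_polySpan hφ h0 (hX 0) hq (by omega) l) n
  have hR := memLp_two_of_mem_polySpan hX hi hid hq (by omega)
    (RBar_mem_polySpan hφ h0 (hX 0) hq (by omega) l) n
  exact ((hP.const_mul _).add (hQ.const_mul _)).add (hR.const_mul _)

/-- The omitted covariances of Q̄ with R̄ and of R̄ with itself are bounded in n and carry the
factors n^{-5/2} and n⁻³. The bound on the latter is what requires ten moments. -/
theorem covariance_expansion_sub (l j : ι) :
    (fun n : ℕ => cov[fun ω => expansion μ X φ βs n ω l, fun ω => expansion μ X φ βs n ω j; μ]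
      - secondOrderVar μ X φ βs n l j) =o[atTop] fun n : ℕ => ((n : ℝ) ^ 2)⁻¹ := by
  have mP := fun l => PsiBar_mem_polySpan (X := X) hφ h0 l
  have mQ := QBar_mem_polySpan hφ h0 (hX 0) hq (by omega)
  have mR := RBar_mem_polySpan hφ h0 (hX 0) hq (by omega)
  have hP := fun l n => memLp_two_of_mem_polySpan hX hi hid hq (by omega) (mP l) n
  have hQ := fun l n => memLp_two_of_mem_polySpan hX hi hid hq (by omega) (mQ l) n
  have hR := fun l n => memLp_two_of_mem_polySpan hX hi hid hq (by omega) (mR l) n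
  obtain ⟨C₁, h₁⟩ := abs_covariance_le_of_mem_polySpan hX hi hid hq (by omega) (by omega)
    (mQ l) (mR j)
  obtain ⟨C₂, h₂⟩ := abs_covariance_le_of_mem_polySpan hX hi hid hq (by omega) (by omega)
    (mR l) (mQ j)
  obtain ⟨C₃, h₃⟩ := abs_covariance_le_of_mem_polySpan hX hi hid hq (by omega) (by omega)
    (mR l) (mR j)
  have t₁ := tendsto_inv_sqrt_mul_of_abs_le h₁
  have t₂ := tendsto_inv_sqrt_mul_of_abs_le h₂
  have t₃ := tendsto_inv_sqrt_mul_of_abs_le (C := 1 * C₃) (a := fun n : ℕ => (√(n : ℝ))⁻¹ *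
      cov[fun ω => RBar μ X φ βs n ω l, fun ω => RBar μ X φ βs n ω j; μ]) fun n => by
    rw [abs_mul]
    refine mul_le_mul ?_ (h₃ n) (abs_nonneg _) zero_le_one
    rw [abs_of_nonneg (by positivity)]
    rcases n.eq_zero_or_pos with rfl | hn
    · simp
    · exact inv_le_one_of_one_le₀ (by rw [Real.one_le_sqrt]; exact_mod_cast hn)
  have t := (t₁.add t₂).add t₃
  simp only [add_zero] at t
  refine (isLittleO_mul_of_tendsto (e := fun n : ℕ => ((n : ℝ) ^ 2)⁻¹) t).congr_left fun n => ?_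
  have e := covariance_linear_comb (hP l n) (hQ l n) (hR l n) (hP j n) (hQ j n) (hR j n)
    (√(n : ℝ))⁻¹ (n : ℝ)⁻¹ ((√(n : ℝ))⁻¹ ^ 3)
  simp only [expansion]
  rw [e, secondOrderVar]
  have e2 : ((n : ℝ) ^ 2)⁻¹ = (√(n : ℝ))⁻¹ ^ 4 := by
    rw [← inv_pow, ← inv_sqrt_sq]; ring
  rw [e2, ← inv_sqrt_sq]
  ring

theorem abs_secondOrderVar_le (l j : ι) :
    ∃ C, ∀ n : ℕ, |secondOrderVar μ X φ βs n l j| ≤ C * (n : ℝ)⁻¹ := by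
  have mP := fun l => PsiBar_mem_polySpan (X := X) hφ h0 l
  have mQ := QBar_mem_polySpan hφ h0 (hX 0) hq (by omega)
  have mR := RBar_mem_polySpan hφ h0 (hX 0) hq (by omega)
  obtain ⟨C₁, h₁⟩ := abs_covariance_le_of_mem_polySpan hX hi hid hq (by omega) (by omega)
    (mP l) (mP j)
  obtain ⟨C₂, h₂⟩ := abs_covariance_le_of_mem_polySpan hX hi hid hq (by omega) (by omega)
    (mP l) (mQ j)
  obtain ⟨C₃, h₃⟩ := abs_covariance_le_of_mem_polySpan hX hi hid hq (by omega) (by omega)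
    (mQ l) (mP j)
  obtain ⟨C₄, h₄⟩ := abs_covariance_le_of_mem_polySpan hX hi hid hq (by omega) (by omega)
    (mQ l) (mQ j)
  obtain ⟨C₅, h₅⟩ := abs_covariance_le_of_mem_polySpan hX hi hid hq (by omega) (by omega)
    (mR l) (mP j)
  obtain ⟨C₆, h₆⟩ := abs_covariance_le_of_mem_polySpan hX hi hid hq (by omega) (by omega)
    (mP l) (mR j)
  refine ⟨C₁ + (C₂ + C₃) + (C₄ + C₅ + C₆), fun n => ?_⟩
  have hs : (√(n : ℝ))⁻¹ ≤ 1 := by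
    rcases n.eq_zero_or_pos with rfl | hn
    · simp
    · exact inv_le_one_of_one_le₀ (by rw [Real.one_le_sqrt]; exact_mod_cast hn)
  have hs0 : 0 ≤ (√(n : ℝ))⁻¹ := by positivity
  have e3 : (√(n : ℝ))⁻¹ ^ 3 ≤ (n : ℝ)⁻¹ := by
    rw [← inv_sqrt_sq]; exact pow_le_pow_of_le_one hs0 hs (by norm_num)
  have e4 : ((n : ℝ) ^ 2)⁻¹ ≤ (n : ℝ)⁻¹ := by
    rw [← inv_pow, ← inv_sqrt_sq, ← pow_mul]; exact pow_le_pow_of_le_one hs0 hs (by norm_num)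
  rw [secondOrderVar, add_mul, add_mul]
  refine (abs_add_le _ _).trans (add_le_add ((abs_add_le _ _).trans (add_le_add ?_ ?_)) ?_)
  · rw [abs_mul, abs_of_nonneg (by positivity), mul_comm]
    exact mul_le_mul_of_nonneg_right (h₁ n) (by positivity)
  · rw [abs_mul, abs_of_nonneg (by positivity), mul_comm]
    exact mul_le_mul ((abs_add_le _ _).trans (add_le_add (h₂ n) (h₃ n))) e3 (by positivity)
      (add_nonneg ((abs_nonneg _).trans (h₂ n)) ((abs_nonneg _).trans (h₃ n)))
  · rw [abs_mul, abs_of_nonneg (by positivity), mul_comm]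
    exact mul_le_mul ((abs_add_three _ _ _).trans (add_le_add (add_le_add (h₄ n) (h₅ n)) (h₆ n))) e4
      (by positivity) (add_nonneg (add_nonneg ((abs_nonneg _).trans (h₄ n))
        ((abs_nonneg _).trans (h₅ n))) ((abs_nonneg _).trans (h₆ n)))

theorem covariance_expansion_isBigO (l j : ι) :
    (fun n : ℕ => cov[fun ω => expansion μ X φ βs n ω l, fun ω => expansion μ X φ βs n ω j; μ])
      =O[atTop] fun n : ℕ => (n : ℝ)⁻¹ := by
  obtain ⟨C, hC⟩ := abs_secondOrderVar_le hX hi hid hq hφ h0 h10 l j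
  have h1 := (covariance_expansion_sub hX hi hid hq hφ h0 h10 l j).isBigO
  have h2 : (fun n : ℕ => ((n : ℝ) ^ 2)⁻¹) =O[atTop] fun n : ℕ => (n : ℝ)⁻¹ := by
    refine IsBigO.of_bound 1 ?_
    filter_upwards [eventually_ge_atTop 1] with n hn
    have : (1 : ℝ) ≤ n := by exact_mod_cast hn
    rw [Real.norm_of_nonneg (by positivity), Real.norm_of_nonneg (by positivity), one_mul]
    exact inv_anti₀ (by positivity) (by nlinarith)
  refine ((h1.trans h2).add (isBigO_inv_of_abs_le hC)).congr_left fun n => ?_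
  ring

/-- A remainder of order `o(n^{-3/2})` in mean square does not affect variances to order
`n^{-2}`. -/
theorem covariance_estimator_sub {βh : ℕ → Ω → ι → ℝ} {l j : ι}
    (hl : ∀ᶠ n in atTop, MemLp (fun ω => remainder μ X φ βs βh n ω l) 2 μ)
    (hj : ∀ᶠ n in atTop, MemLp (fun ω => remainder μ X φ βs βh n ω j) 2 μ)
    (ol : (fun n : ℕ => ∫ ω, remainder μ X φ βs βh n ω l ^ 2 ∂μ) =o[atTop]
      fun n : ℕ => ((n : ℝ) ^ 3)⁻¹)
    (oj : (fun n : ℕ => ∫ ω, remainder μ X φ βs βh n ω j ^ 2 ∂μ) =o[atTop]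
      fun n : ℕ => ((n : ℝ) ^ 3)⁻¹) :
    (fun n : ℕ => cov[fun ω => βh n ω l, fun ω => βh n ω j; μ]
      - cov[fun ω => expansion μ X φ βs n ω l, fun ω => expansion μ X φ βs n ω j; μ]) =o[atTop]
      fun n : ℕ => ((n : ℝ) ^ 2)⁻¹ := by
  have hS := memLp_expansion hX hi hid hq hφ h0 h10
  have cross : ∀ i k : ι, (∀ᶠ n in atTop, MemLp (fun ω => remainder μ X φ βs βh n ω k) 2 μ) →
      (fun n : ℕ => ∫ ω, remainder μ X φ βs βh n ω k ^ 2 ∂μ) =o[atTop]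
        (fun n : ℕ => ((n : ℝ) ^ 3)⁻¹) →
      (fun n : ℕ => cov[fun ω => expansion μ X φ βs n ω i,
        fun ω => remainder μ X φ βs βh n ω k; μ]) =o[atTop] fun n : ℕ => ((n : ℝ) ^ 2)⁻¹ := by
    intro i k hk ok
    obtain ⟨C, hC0, hC⟩ := (covariance_expansion_isBigO hX hi hid hq hφ h0 h10 i i).exists_pos
    refine isLittleO_iff.2 fun c hc => ?_
    -- Chosen so that the two halves of the covariance bound at t = ε/n add up to ε(C + 1) n⁻² = c
    -- n⁻².
    set ε : ℝ := c / (C + 1) with hε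
    have hε0 : 0 < ε := by positivity
    filter_upwards [hC.bound, isLittleO_iff.1 ok (by positivity : 0 < ε ^ 2), hk,
      eventually_ge_atTop 1] with n h1 h2 h3 hn
    have hn0 : (0 : ℝ) < n := by exact_mod_cast hn
    rw [Real.norm_eq_abs, Real.norm_of_nonneg (by positivity)] at h1 h2 ⊢
    have h4 := abs_covariance_le (hS i n) h3 (t := ε * (n : ℝ)⁻¹) (by positivity)
    refine h4.trans ?_
    have h5 := mul_le_mul_of_nonneg_left ((le_abs_self _).trans h1)
      (by positivity : 0 ≤ ε * (n : ℝ)⁻¹)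
    have h6 := mul_le_mul_of_nonneg_left ((le_abs_self _).trans h2)
      (by positivity : 0 ≤ (ε * (n : ℝ)⁻¹)⁻¹)
    have e : ε * (n : ℝ)⁻¹ * (C * (n : ℝ)⁻¹) + (ε * (n : ℝ)⁻¹)⁻¹ * (ε ^ 2 * ((n : ℝ) ^ 3)⁻¹) =
        c * ((n : ℝ) ^ 2)⁻¹ := by
      have : c = ε * (C + 1) := by rw [hε]; field_simp
      rw [this]
      field_simp
    linarith
  have rem : (fun n : ℕ => cov[fun ω => remainder μ X φ βs βh n ω l,
        fun ω => remainder μ X φ βs βh n ω j; μ]) =o[atTop] fun n : ℕ => ((n : ℝ) ^ 2)⁻¹ := by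
    have h32 : (fun n : ℕ => ((n : ℝ) ^ 3)⁻¹) =O[atTop] fun n : ℕ => ((n : ℝ) ^ 2)⁻¹ := by
      refine IsBigO.of_bound 1 ?_
      filter_upwards [eventually_ge_atTop 1] with n hn
      have : (1 : ℝ) ≤ n := by exact_mod_cast hn
      rw [Real.norm_of_nonneg (by positivity), Real.norm_of_nonneg (by positivity), one_mul]
      exact inv_anti₀ (by positivity) (pow_le_pow_right₀ this (by norm_num))
    refine IsLittleO.trans_isBigO (IsBigO.trans_isLittleO ?_ (ol.norm_left.add oj.norm_left)) h32
    refine IsBigO.of_bound 1 ?_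
    filter_upwards [hl, hj] with n h1 h2
    have h := abs_covariance_le h1 h2 one_pos
    have e2 : cov[fun ω => remainder μ X φ βs βh n ω l, fun ω => remainder μ X φ βs βh n ω l; μ] ≤
        ∫ ω, remainder μ X φ βs βh n ω l ^ 2 ∂μ := by
      have := variance_le_expectation_sq (μ := μ) h1.1
      rwa [← covariance_self h1.1.aemeasurable] at this
    rw [one_mul, inv_one, one_mul] at h
    rw [one_mul, Real.norm_eq_abs]
    refine h.trans ((add_le_add e2 le_rfl).trans ?_)
    refine le_trans ?_ (le_abs_self _)
    exact add_le_add (le_abs_self _) (le_abs_self _)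
  have key := ((cross l j hj oj).add (cross j l hl ol)).add rem
  refine key.congr' ?_ EventuallyEq.rfl
  filter_upwards [hl, hj] with n h1 h2
  have e : ∀ i, (fun ω => βh n ω i) = fun ω => βs i + (expansion μ X φ βs n ω i
      + remainder μ X φ βs βh n ω i) := fun i => by
    ext ω; simp only [remainder]; ring
  have il : Integrable (fun ω => expansion μ X φ βs n ω l + remainder μ X φ βs βh n ω l) μ :=
    ((hS l n).add h1).integrable (by norm_num)
  have ij : Integrable (fun ω => expansion μ X φ βs n ω j + remainder μ X φ βs βh n ω j) μ :=
    ((hS j n).add h2).integrable (by norm_num)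
  rw [e l, e j, covariance_const_add_left il, covariance_const_add_right ij,
    covariance_add_add (hS l n) h1 (hS j n) h2,
    covariance_comm (fun ω => remainder μ X φ βs βh n ω l) (fun ω => expansion μ X φ βs n ω j)]
  ring

end Expansion

/-! ### Variances of ETEL and EL up to order n⁻² -/

section Model

variable {Ω 𝒳 : Type*} [MeasurableSpace Ω] [MeasurableSpace 𝒳] {m p : ℕ} {μ : Measure Ω}
  [IsProbabilityMeasure μ] {X : ℕ → Ω → 𝒳} {g : 𝒳 → (Fin p → ℝ) → Fin m → ℝ} {θs : Fin p → ℝ}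
  {N : Set (Fin p → ℝ)} {b : 𝒳 → ℝ}

namespace IsRegularModel

variable (hM : IsRegularModel μ X g θs N b)
include hM

theorem mean_phi_betaStar {φ : 𝒳 → (Idx m p → ℝ) → Idx m p → ℝ}
    (h : ∀ x, φ x (betaStar θs) = ETEL.mk 0 (g x θs) 0 0) (l : Idx m p) :
    mean μ X (fun x => φ x (betaStar θs) l) = 0 := by
  simp only [h]
  rcases l with _ | a | a | c
  · exact mean_const 0
  · exact hM.mean_zero a
  · exact mean_const 0
  · exact mean_const 0

theorem integral_psiVec_θ (n : ℕ) (c : Fin p) :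
    Integrable (fun ω => psiVec g μ X θs n ω (iθ c)) μ ∧
      ∫ ω, psiVec g μ X θs n ω (iθ c) ∂μ = 0 := by
  have h : Integrable (fun ω => inflFun g μ X θs c (X 0 ω)) μ :=
    hM.integrable_dom (hM.dom_neg_sum_mul_g _) (by norm_num)
  have hm : Measurable (inflFun g μ X θs c) := (hM.dom_neg_sum_mul_g _).1
  have hk : ∀ k, Integrable (fun ω => inflFun g μ X θs c (X k ω)) μ := fun k =>
    ((hM.ident k).comp hm).integrable_iff.2 h
  have h0 : ∀ k, ∫ ω, inflFun g μ X θs c (X k ω) ∂μ = 0 := fun k =>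
    (((hM.ident k).comp hm).integral_eq).trans (hM.mean_neg_sum_mul_g _)
  simp only [psiVec_θ, nsum]
  refine ⟨(integrable_finsetSum _ fun k _ => hk k).const_mul _, ?_⟩
  rw [integral_const_mul, integral_finsetSum _ fun k _ => hk k]
  simp only [h0, Finset.sum_const_zero, mul_zero]

theorem covariance_RBar {φ : 𝒳 → (Idx m p → ℝ) → Idx m p → ℝ} (hφ : HasEnvelope φ (betaStar θs) b)
    (h : ∀ x, φ x (betaStar θs) = ETEL.mk 0 (g x θs) 0 0)
    (hP : ∀ n ω, PsiBar μ X φ (betaStar θs) n ω = psiVec g μ X θs n ω) (n : ℕ) (l c : Fin p) :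
    Integrable (fun ω => RBar μ X φ (betaStar θs) n ω (iθ l) * psiVec g μ X θs n ω (iθ c)) μ ∧
    cov[fun ω => RBar μ X φ (betaStar θs) n ω (iθ l), fun ω => psiVec g μ X θs n ω (iθ c); μ] =
      ∫ ω, RBar μ X φ (betaStar θs) n ω (iθ l) * psiVec g μ X θs n ω (iθ c) ∂μ := by
  have h0 := hM.mean_phi_betaStar h
  have hmem := mul_fun_mem_polySpan
    (RBar_mem_polySpan hφ h0 (hM.measurable_X 0) hM.memLp_six (by norm_num) (iθ l))
    (PsiBar_mem_polySpan (μ := μ) (X := X) hφ h0 (iθ c))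
  simp only [hP] at hmem
  have hi := (integrable_and_bounded_of_mem_polySpan hM.measurable_X hM.indep hM.ident hM.memLp_six
    (by norm_num) hmem).1 n
  exact ⟨hi, covariance_eq_integral_mul (hM.integral_psiVec_θ n c).1 hi (hM.integral_psiVec_θ n c).2⟩

theorem covariance_RBar_sub (n : ℕ) (l c : Fin p) :
    cov[fun ω => RBar μ X (phiETEL g) (betaStar θs) n ω (iθ l),
        fun ω => psiVec g μ X θs n ω (iθ c); μ]
      - cov[fun ω => RBar μ X (phiEL g) (betaStar θs) n ω (iθ l),
        fun ω => psiVec g μ X θs n ω (iθ c); μ] =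
      ∫ ω, (RBar μ X (phiETEL g) (betaStar θs) n ω (iθ l)
        - RBar μ X (phiEL g) (betaStar θs) n ω (iθ l)) * psiVec g μ X θs n ω (iθ c) ∂μ := by
  obtain ⟨iE, hE⟩ := hM.covariance_RBar hM.hasEnvelope_phiETEL phiETEL_betaStar hM.PsiBar_phiETEL n l c
  obtain ⟨iL, hL⟩ := hM.covariance_RBar hM.hasEnvelope_phiEL phiEL_betaStar hM.PsiBar_phiEL n l c
  simp only [sub_mul]
  rw [hE, hL, integral_sub iE iL]

/-- Ψ̄ and Q̄ are common, so only the two covariances of R̄ with Ψ̄ differ. Since Ψ̄_θ is centred,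
these differences are means of a member of the cubic span times Ψ̄_θ, hence O(n⁻¹). -/
theorem secondOrderVar_sub_isLittleO (l c : Fin p) :
    (fun n : ℕ => secondOrderVar μ X (phiETEL g) (betaStar θs) n (iθ l) (iθ c) -
      secondOrderVar μ X (phiEL g) (betaStar θs) n (iθ l) (iθ c)) =o[atTop]
      fun n : ℕ => ((n : ℝ) ^ 2)⁻¹ := by
  obtain ⟨C, hC⟩ := (hM.integral_mul_psiVec_of_mem_cubicSpan (hM.RBar_sub_mem_cubicSpan l) c).2
  obtain ⟨C', hC'⟩ := (hM.integral_mul_psiVec_of_mem_cubicSpan (hM.RBar_sub_mem_cubicSpan c) l).2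
  refine ((isLittleO_mul_of_abs_le (e := fun n : ℕ => ((n : ℝ) ^ 2)⁻¹) hC).add
    (isLittleO_mul_of_abs_le hC')).congr_left fun n => ?_
  rw [← hM.covariance_RBar_sub, ← hM.covariance_RBar_sub]
  simp only [secondOrderVar, hM.PsiBar_phiEL, hM.PsiBar_phiETEL, hM.QBar_phiEL]
  rw [covariance_comm (fun ω => psiVec g μ X θs n ω (iθ l))
    (fun ω => RBar μ X (phiETEL g) (betaStar θs) n ω (iθ c)),
    covariance_comm (fun ω => psiVec g μ X θs n ω (iθ l))
    (fun ω => RBar μ X (phiEL g) (betaStar θs) n ω (iθ c))]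
  ring

end IsRegularModel

end Model

end ETEL

namespace ETEL

/-! ### Stochastic expansion of the estimators -/

/-- `f` is of the order of `a ^ i` along the filter `F`. -/
def HasOrder {α : Type*} (F : Filter α) (a : α → ℝ) (i : ℕ) (f : α → ℝ) : Prop :=
  f =O[F] fun x => a x ^ i

namespace HasOrder

variable {α : Type*} {F : Filter α} {a f f' : α → ℝ} {i j : ℕ}

theorem mul (h : HasOrder F a i f) (h' : HasOrder F a j f') :
    HasOrder F a (i + j) (fun x => f x * f' x) := by
  have := IsBigO.mul h h'
  simpa only [HasOrder, pow_add] using this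

theorem mono (ha : a =O[F] fun _ => (1 : ℝ)) (h : HasOrder F a j f) (hij : i ≤ j) :
    HasOrder F a i f := by
  obtain ⟨k, rfl⟩ := Nat.exists_eq_add_of_le hij
  refine IsBigO.trans h ?_
  have := (isBigO_refl (fun x => a x ^ i) F).mul (ha.pow k)
  simpa only [pow_add, one_pow, mul_one] using this

theorem add (h : HasOrder F a i f) (h' : HasOrder F a i f') :
    HasOrder F a i (fun x => f x + f' x) := IsBigO.add h h'

theorem const_mul (c : ℝ) (h : HasOrder F a i f) : HasOrder F a i (fun x => c * f x) :=
  IsBigO.const_mul_left h c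

theorem sum {κ : Type*} [Fintype κ] {f : κ → α → ℝ} (h : ∀ k, HasOrder F a i (f k)) :
    HasOrder F a i (fun x => ∑ k, f k x) := IsBigO.fun_sum fun k _ => h k

theorem self : HasOrder F a 1 a := by
  simpa only [HasOrder, pow_one] using isBigO_refl a F

end HasOrder

section Iterate

variable {α ι : Type*} [Fintype ι] {F : Filter α} {a : α → ℝ} {δ P E : ι → α → ℝ}
  {P1 : ι → ι → α → ℝ} {P2 : ι → ι → ι → α → ℝ} {c2 : ι → ι → ι → ℝ} {c3 : ι → ι → ι → ι → ℝ}

/-- Solving an equation for `δ` by iteration up to terms of order `a ^ 4`. -/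
theorem hasOrder_four_of_fixedPoint (ha : a =O[F] fun _ => (1 : ℝ))
    (hc2 : ∀ l j k, c2 l j k = c2 l k j)
    (hδ : ∀ l, HasOrder F a 1 (δ l)) (hP : ∀ l, HasOrder F a 0 (P l))
    (hP1 : ∀ l j, HasOrder F a 0 (P1 l j)) (hP2 : ∀ l j k, HasOrder F a 0 (P2 l j k))
    (hE : ∀ l, HasOrder F a 4 (E l))
    (heq : ∀ l x, δ l x = a x * P l x + a x * ∑ j, P1 l j x * δ j x
      + 1 / 2 * ∑ j, ∑ k, c2 l j k * (δ j x * δ k x)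
      + 1 / 2 * (a x * ∑ j, ∑ k, P2 l j k x * (δ j x * δ k x))
      + 1 / 6 * ∑ j, ∑ k, ∑ h, c3 l j k h * (δ j x * (δ k x * δ h x)) + E l x)
    {Q R : ι → α → ℝ}
    (hQ : ∀ l x, Q l x = ∑ j, P1 l j x * P j x + 1 / 2 * ∑ j, ∑ k, c2 l j k * P j x * P k x)
    (hR : ∀ l x, R l x = ∑ j, P1 l j x * Q j x + ∑ j, ∑ k, c2 l j k * Q j x * P k x
      + 1 / 2 * ∑ j, ∑ k, P2 l j k x * P j x * P k x
      + 1 / 6 * ∑ j, ∑ k, ∑ h, c3 l j k h * P j x * P k x * P h x) (l : ι) :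
    HasOrder F a 4 (fun x => δ l x - a x * P l x - a x ^ 2 * Q l x - a x ^ 3 * R l x) := by
  have hs := HasOrder.self (F := F) (a := a)
  have haP : ∀ l, HasOrder F a 1 (fun x => a x * P l x) := fun l => hs.mul (hP l)
  -- the second-order remainder
  set u : ι → α → ℝ := fun l x => δ l x - a x * P l x with hu
  have hu2 : ∀ l, HasOrder F a 2 (u l) := fun l => by
    have t₁ := hs.mul (HasOrder.sum fun j => (hP1 l j).mul (hδ j))
    have t₂ := (HasOrder.sum fun j => HasOrder.sum fun k =>
      ((hδ j).mul (hδ k)).const_mul (c2 l j k)).const_mul (1 / 2)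
    have t₃ := (hs.mul (HasOrder.sum fun j => HasOrder.sum fun k =>
      (hP2 l j k).mul ((hδ j).mul (hδ k)))).const_mul (1 / 2)
    have t₄ := (HasOrder.sum fun j => HasOrder.sum fun k => HasOrder.sum fun h =>
      ((hδ j).mul ((hδ k).mul (hδ h))).const_mul (c3 l j k h)).const_mul (1 / 6)
    have t := (((t₁.add t₂).add (t₃.mono ha (by norm_num))).add (t₄.mono ha (by norm_num))).add
      ((hE l).mono ha (by norm_num))
    refine IsBigO.congr_left t fun x => ?_
    simp only [hu]
    linear_combination -heq l x
  have hdd : ∀ j k x, δ j x * δ k x - (a x * P j x) * (a x * P k x) =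
      u j x * δ k x + (a x * P j x) * u k x := fun j k x => by simp only [hu]; ring
  -- the third-order remainder
  set v : ι → α → ℝ := fun l x => u l x - a x ^ 2 * Q l x with hv
  have hv3 : ∀ l, HasOrder F a 3 (v l) := fun l => by
    have t₁ := hs.mul (HasOrder.sum fun j => (hP1 l j).mul (hu2 j))
    have t₂ := (HasOrder.sum fun j => HasOrder.sum fun k =>
      (((hu2 j).mul (hδ k)).add ((haP j).mul (hu2 k))).const_mul (c2 l j k)).const_mul (1 / 2)
    have t₃ := (hs.mul (HasOrder.sum fun j => HasOrder.sum fun k =>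
      (hP2 l j k).mul ((hδ j).mul (hδ k)))).const_mul (1 / 2)
    have t₄ := (HasOrder.sum fun j => HasOrder.sum fun k => HasOrder.sum fun h =>
      ((hδ j).mul ((hδ k).mul (hδ h))).const_mul (c3 l j k h)).const_mul (1 / 6)
    have t := (((t₁.add t₂).add t₃).add t₄).add ((hE l).mono ha (by norm_num))
    refine IsBigO.congr_left t fun x => ?_
    simp only [← hdd]
    simp only [hv, hu, mul_sub, Finset.sum_sub_distrib]
    have e₁ : ∑ j, P1 l j x * (a x * P j x) = a x * ∑ j, P1 l j x * P j x := by
      rw [Finset.mul_sum]; exact Finset.sum_congr rfl fun j _ => by ring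
    have e₂ : ∑ j, ∑ k, c2 l j k * (a x * P j x * (a x * P k x)) =
        a x ^ 2 * ∑ j, ∑ k, c2 l j k * P j x * P k x := by
      simp only [Finset.mul_sum]
      exact Finset.sum_congr rfl fun j _ => Finset.sum_congr rfl fun k _ => by ring
    rw [e₁, e₂]
    linear_combination -heq l x + a x ^ 2 * hQ l x
  have hddd : ∀ j k h x, δ j x * (δ k x * δ h x) - (a x * P j x) * ((a x * P k x) * (a x * P h x)) =
      u j x * (δ k x * δ h x) + (a x * P j x) * (u k x * δ h x + (a x * P k x) * u h x) :=
    fun j k h x => by simp only [hu]; ring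
  -- The product of two increments, expanded one order further: u has order two and v order three,
  -- so the right-hand side has order four.
  have hdd' : ∀ j k x, δ j x * δ k x - (a x * P j x) * (a x * P k x)
      - a x ^ 3 * (Q j x * P k x + P j x * Q k x) =
      u j x * u k x + ((a x * P j x) * v k x + v j x * (a x * P k x)) := fun j k x => by
    simp only [hv, hu]; ring
  have t₁ := hs.mul (HasOrder.sum fun j => (hP1 l j).mul (hv3 j))
  have t₂ := (HasOrder.sum fun j => HasOrder.sum fun k => (((hu2 j).mul (hu2 k)).add
    (((haP j).mul (hv3 k)).add ((hv3 j).mul (haP k)))).const_mul (c2 l j k)).const_mul (1 / 2)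
  have t₃ := (hs.mul (HasOrder.sum fun j => HasOrder.sum fun k =>
      (hP2 l j k).mul (((hu2 j).mul (hδ k)).add ((haP j).mul (hu2 k))))).const_mul (1 / 2)
  have t₄ := (HasOrder.sum fun j => HasOrder.sum fun k => HasOrder.sum fun h =>
    (((hu2 j).mul ((hδ k).mul (hδ h))).add ((haP j).mul
      (((hu2 k).mul (hδ h)).add ((haP k).mul (hu2 h))))).const_mul (c3 l j k h)).const_mul (1 / 6)
  have t := (((t₁.add t₂).add t₃).add t₄).add (hE l)
  refine IsBigO.congr_left t fun x => ?_
  simp only [← hdd', ← hddd]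
  simp only [← hdd]
  simp only [hv, hu, mul_sub, Finset.sum_sub_distrib]
  have e₁ : ∑ j, P1 l j x * (a x * P j x) = a x * ∑ j, P1 l j x * P j x := by
    rw [Finset.mul_sum]; exact Finset.sum_congr rfl fun j _ => by ring
  have e₁' : ∑ j, P1 l j x * (a x ^ 2 * Q j x) = a x ^ 2 * ∑ j, P1 l j x * Q j x := by
    rw [Finset.mul_sum]; exact Finset.sum_congr rfl fun j _ => by ring
  have e₂ : ∑ j, ∑ k, c2 l j k * (a x * P j x * (a x * P k x)) =
      a x ^ 2 * ∑ j, ∑ k, c2 l j k * P j x * P k x := by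
    simp only [Finset.mul_sum]
    exact Finset.sum_congr rfl fun j _ => Finset.sum_congr rfl fun k _ => by ring
  -- Symmetry of the second-order coefficients merges the two mixed sums; the resulting 2 cancels
  -- the factor 1/2 in the equation.
  have e₂' : ∑ j, ∑ k, c2 l j k * (a x ^ 3 * (Q j x * P k x + P j x * Q k x)) =
      2 * a x ^ 3 * ∑ j, ∑ k, c2 l j k * Q j x * P k x := by
    have h1 : ∑ j, ∑ k, c2 l j k * (P j x * Q k x) = ∑ j, ∑ k, c2 l j k * (Q j x * P k x) := by
      rw [Finset.sum_comm]
      exact Finset.sum_congr rfl fun j _ => Finset.sum_congr rfl fun k _ => by rw [hc2]; ring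
    have h2 : ∀ j k, c2 l j k * (a x ^ 3 * (Q j x * P k x + P j x * Q k x)) =
        a x ^ 3 * (c2 l j k * (Q j x * P k x)) + a x ^ 3 * (c2 l j k * (P j x * Q k x)) :=
      fun j k => by ring
    simp only [h2, Finset.sum_add_distrib, ← Finset.mul_sum, h1, mul_assoc]
    ring
  have e₃ : ∑ j, ∑ k, P2 l j k x * (a x * P j x * (a x * P k x)) =
      a x ^ 2 * ∑ j, ∑ k, P2 l j k x * P j x * P k x := by
    simp only [Finset.mul_sum]
    exact Finset.sum_congr rfl fun j _ => Finset.sum_congr rfl fun k _ => by ring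
  have e₄ : ∑ j, ∑ k, ∑ h, c3 l j k h * (a x * P j x * (a x * P k x * (a x * P h x))) =
      a x ^ 3 * ∑ j, ∑ k, ∑ h, c3 l j k h * P j x * P k x * P h x := by
    simp only [Finset.mul_sum]
    exact Finset.sum_congr rfl fun j _ => Finset.sum_congr rfl fun k _ =>
      Finset.sum_congr rfl fun h _ => by ring
  rw [e₁, e₁', e₂, e₂', e₃, e₄]
  linear_combination -heq l x + a x ^ 2 * hQ l x + a x ^ 3 * hR l x

end Iterate

end ETEL

namespace ETEL

/-! ### The sample moment equation as a fixed-point equation -/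

section FixedPoint

variable {Ω 𝒳 ι : Type*} [MeasurableSpace Ω] [Fintype ι] [DecidableEq ι]
  (μ : Measure Ω) (X : ℕ → Ω → 𝒳) (φ : 𝒳 → (ι → ℝ) → ι → ℝ) (βs : ι → ℝ)

/-- The normalized sums of the centred third derivatives. -/
noncomputable def PhiBar3 (n : ℕ) (ω : Ω) (l j k h : ι) : ℝ :=
  nsum X n (fun x => d3 φ βs l j k h x - Phi3 μ X φ βs l j k h) ω

/-- The remainder of the third-order Taylor expansion of `φ x (βs + δ) l` in `δ`. -/
noncomputable def taylorRem (l : ι) (δ : ι → ℝ) (x : 𝒳) : ℝ :=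
  φ x (βs + δ) l - (φ x βs l + ∑ j, δ j * d1 φ βs l j x
    + 1 / 2 * quadForm (fun j k => d2 φ βs l j k x) δ
    + 1 / 6 * cubicForm (fun j k h => d3 φ βs l j k h x) δ)

/-- The error of the quadratic and cubic approximation of the sample moment condition. -/
noncomputable def momentRem (n : ℕ) (ω : Ω) (δ : ι → ℝ) (l : ι) : ℝ :=
  1 / 6 * ((√(n : ℝ))⁻¹ * cubicForm (PhiBar3 μ X φ βs n ω l) δ)
    + (n : ℝ)⁻¹ * ∑ i ∈ Finset.range n, taylorRem φ βs l δ (X i ω)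

variable {μ X φ βs} {n : ℕ} {ω : Ω} {β : ι → ℝ}

theorem average_eq (hn : 1 ≤ n) (f : 𝒳 → ℝ) (c : ℝ) :
    (n : ℝ)⁻¹ * ∑ i ∈ Finset.range n, f (X i ω) =
      c + (√(n : ℝ))⁻¹ * nsum X n (fun x => f x - c) ω := by
  have h0 : (n : ℝ) ≠ 0 := Nat.cast_ne_zero.2 (by omega)
  simp only [nsum, Finset.sum_sub_distrib, Finset.sum_const, Finset.card_range, nsmul_eq_mul]
  rw [← mul_assoc, ← sq, inv_sqrt_sq]
  field_simp
  ring

/-- Taylor's formula is inserted in the sample equation and each average of derivatives is split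
into its mean and n^{-1/2} times a normalized sum. Isolating the mean Jacobian times δ and inverting
gives the equation. The centred third derivatives go into the error, since n^{-1/2} ‖δ‖³ is already
of fourth order. -/
theorem fixedPoint_eq (hn : 1 ≤ n) (hU : IsUnit (Phi1 μ X φ βs))
    (hsol : ∀ l, (n : ℝ)⁻¹ * ∑ i ∈ Finset.range n, φ (X i ω) β l = 0) (l : ι) :
    (β - βs) l = (√(n : ℝ))⁻¹ * PsiBar μ X φ βs n ω l
      + (√(n : ℝ))⁻¹ * ∑ j, PsiBar1 μ X φ βs n ω l j * (β - βs) j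
      + 1 / 2 * ∑ j, ∑ k, Psi2 μ X φ βs l j k * ((β - βs) j * (β - βs) k)
      + 1 / 2 * ((√(n : ℝ))⁻¹ * ∑ j, ∑ k, PsiBar2 μ X φ βs n ω l j k * ((β - βs) j * (β - βs) k))
      + 1 / 6 * ∑ j, ∑ k, ∑ h, Psi3 μ X φ βs l j k h * ((β - βs) j * ((β - βs) k * (β - βs) h))
      + -((Phi1 μ X φ βs)⁻¹ *ᵥ momentRem μ X φ βs n ω (β - βs)) l := by
  set δ := β - βs with hδ
  have hβ : βs + δ = β := add_sub_cancel βs β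
  set a := (√(n : ℝ))⁻¹
  set A := (Phi1 μ X φ βs)⁻¹
  have e1 : ∑ j, PsiBar1 μ X φ βs n ω l j * δ j =
      -(A *ᵥ fun h => ∑ j, δ j * PhiBar1 μ X φ βs n ω h j) l := sum_neg_sum_mul _ _ _ _
  have e2 : ∑ j, ∑ k, Psi2 μ X φ βs l j k * (δ j * δ k) =
      -(A *ᵥ fun h => quadForm (Phi2 μ X φ βs h) δ) l := by
    simp only [← mul_assoc]
    exact sum_Psi2_mul_mul δ δ l
  have e3 : ∑ j, ∑ k, PsiBar2 μ X φ βs n ω l j k * (δ j * δ k) =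
      -(A *ᵥ fun h => quadForm (PhiBar2 μ X φ βs n ω h) δ) l := by
    have := sum_neg_sum_mul (κ := ι × ι) A
      (fun h i => PhiBar2 μ X φ βs n ω h i.1 i.2) (fun i => δ i.1 * δ i.2) l
    simp only [Fintype.sum_prod_type] at this
    exact this
  have e4 : ∑ j, ∑ k, ∑ h, Psi3 μ X φ βs l j k h * (δ j * (δ k * δ h)) =
      -(A *ᵥ fun h => cubicForm (Phi3 μ X φ βs h) δ) l := by
    simp only [← mul_assoc]
    exact sum_Psi3_mul_mul_mul δ l
  have key : ∀ h, (Phi1 μ X φ βs *ᵥ δ) h = -(a * PhiBar X φ βs n ω h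
      + a * ∑ j, δ j * PhiBar1 μ X φ βs n ω h j + 1 / 2 * quadForm (Phi2 μ X φ βs h) δ
      + 1 / 2 * (a * quadForm (PhiBar2 μ X φ βs n ω h) δ)
      + 1 / 6 * cubicForm (Phi3 μ X φ βs h) δ + momentRem μ X φ βs n ω δ h) := fun h => by
    have hs := hsol h
    have e : ∀ x, φ x β h = φ x βs h + ∑ j, δ j * d1 φ βs h j x
        + 1 / 2 * quadForm (fun j k => d2 φ βs h j k x) δ
        + 1 / 6 * cubicForm (fun j k i => d3 φ βs h j k i x) δ + taylorRem φ βs h δ x := fun x => by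
      rw [taylorRem, hβ]; ring
    simp only [e, Finset.sum_add_distrib, mul_add, ← Finset.mul_sum] at hs
    have f0 : (n : ℝ)⁻¹ * ∑ i ∈ Finset.range n, φ (X i ω) βs h = a * PhiBar X φ βs n ω h := by
      rw [average_eq hn (fun x => φ x βs h) 0]
      simp only [sub_zero, zero_add]
      rfl
    have f1 : (n : ℝ)⁻¹ * ∑ i ∈ Finset.range n, ∑ j, δ j * d1 φ βs h j (X i ω) =
        (Phi1 μ X φ βs *ᵥ δ) h + a * ∑ j, δ j * PhiBar1 μ X φ βs n ω h j := by
      rw [Finset.sum_comm, Finset.mul_sum, mulVec, dotProduct, Finset.mul_sum,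
        ← Finset.sum_add_distrib]
      refine Finset.sum_congr rfl fun j _ => ?_
      rw [← Finset.mul_sum, mul_left_comm, average_eq hn (d1 φ βs h j) (Phi1 μ X φ βs h j)]
      simp only [PhiBar1]
      ring
    have f2 : (n : ℝ)⁻¹ * ∑ i ∈ Finset.range n, quadForm (fun j k => d2 φ βs h j k (X i ω)) δ =
        quadForm (Phi2 μ X φ βs h) δ + a * quadForm (PhiBar2 μ X φ βs n ω h) δ := by
      simp only [quadForm]
      rw [Finset.sum_comm, Finset.mul_sum, Finset.mul_sum, ← Finset.sum_add_distrib]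
      refine Finset.sum_congr rfl fun j _ => ?_
      rw [Finset.sum_comm, Finset.mul_sum, Finset.mul_sum, ← Finset.sum_add_distrib]
      refine Finset.sum_congr rfl fun k _ => ?_
      rw [← Finset.mul_sum, mul_left_comm, average_eq hn (d2 φ βs h j k) (Phi2 μ X φ βs h j k)]
      simp only [PhiBar2]
      ring
    have f3 : (n : ℝ)⁻¹ * ∑ i ∈ Finset.range n, cubicForm (fun j k q => d3 φ βs h j k q (X i ω)) δ =
        cubicForm (Phi3 μ X φ βs h) δ + a * cubicForm (PhiBar3 μ X φ βs n ω h) δ := by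
      simp only [cubicForm]
      rw [Finset.sum_comm, Finset.mul_sum, Finset.mul_sum, ← Finset.sum_add_distrib]
      refine Finset.sum_congr rfl fun j _ => ?_
      rw [Finset.sum_comm, Finset.mul_sum, Finset.mul_sum, ← Finset.sum_add_distrib]
      refine Finset.sum_congr rfl fun k _ => ?_
      rw [Finset.sum_comm, Finset.mul_sum, Finset.mul_sum, ← Finset.sum_add_distrib]
      refine Finset.sum_congr rfl fun q _ => ?_
      rw [← Finset.mul_sum, mul_left_comm, average_eq hn (d3 φ βs h j k q) (Phi3 μ X φ βs h j k q)]
      simp only [PhiBar3]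
      ring
    rw [mul_left_comm _ (1 / 2 : ℝ), mul_left_comm _ (1 / 6 : ℝ), f0, f1, f2, f3] at hs
    rw [momentRem]
    linear_combination hs
  have hA : δ = A *ᵥ (Phi1 μ X φ βs *ᵥ δ) := by
    rw [mulVec_mulVec, nonsing_inv_mul _ ((isUnit_iff_isUnit_det _).1 hU), one_mulVec]
  have hT : Phi1 μ X φ βs *ᵥ δ = -(a • PhiBar X φ βs n ω
      + a • (fun h => ∑ j, δ j * PhiBar1 μ X φ βs n ω h j)
      + (1 / 2 : ℝ) • (fun h => quadForm (Phi2 μ X φ βs h) δ)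
      + (1 / 2 : ℝ) • (a • fun h => quadForm (PhiBar2 μ X φ βs n ω h) δ)
      + (1 / 6 : ℝ) • (fun h => cubicForm (Phi3 μ X φ βs h) δ) + momentRem μ X φ βs n ω δ) :=
    funext key
  rw [e1, e2, e3, e4, PsiBar_eq]
  conv_lhs => rw [hA, hT]
  simp only [mulVec_neg, mulVec_add, mulVec_smul, Pi.neg_apply, Pi.add_apply, Pi.smul_apply,
    smul_eq_mul]
  ring

end FixedPoint

section Tight

variable {Ω : Type*} [MeasurableSpace Ω] {μ : Measure Ω} [IsProbabilityMeasure μ]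

/-- Markov's inequality, with a threshold not depending on n. -/
theorem exists_measure_lt_le {G : ℕ → Ω → ℝ} {C : ℝ} (hG : ∀ n, Integrable (G n) μ)
    (h0 : ∀ n ω, 0 ≤ G n ω) (hC : ∀ n, ∫ ω, G n ω ∂μ ≤ C) {ε : ℝ} (hε : 0 < ε) :
    ∃ K : ℝ, 0 < K ∧ ∀ n, μ {ω | K < G n ω} ≤ ENNReal.ofReal ε := by
  refine ⟨(|C| + 1) / ε, by positivity, fun n => ?_⟩
  have h := mul_meas_ge_le_integral_of_nonneg (Eventually.of_forall (h0 n)) (hG n) ((|C| + 1) / ε)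
  have h1 : μ.real {ω | (|C| + 1) / ε ≤ G n ω} ≤ ε := by
    have hK : 0 < (|C| + 1) / ε := by positivity
    refine le_of_mul_le_mul_left ((h.trans ((hC n).trans ?_)) : _ ≤ (|C| + 1) / ε * ε) hK
    rw [div_mul_cancel₀ _ hε.ne']
    linarith [le_abs_self C]
  have hsub : {ω | (|C| + 1) / ε < G n ω} ⊆ {ω | (|C| + 1) / ε ≤ G n ω} :=
    Set.ofPred_subset_ofPred.2 fun ω hω => hω.le
  refine (measure_mono hsub).trans ?_
  rw [← ofReal_measureReal]
  exact ENNReal.ofReal_le_ofReal h1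

end Tight

/-! ### Tightness of the random coefficients -/

section Main

variable {Ω 𝒳 ι : Type*} [MeasurableSpace Ω] [MeasurableSpace 𝒳] [Fintype ι] [DecidableEq ι]
  {μ : Measure Ω} [IsProbabilityMeasure μ] {X : ℕ → Ω → 𝒳} {φ : 𝒳 → (ι → ℝ) → ι → ℝ} {βs : ι → ℝ}
  {b : 𝒳 → ℝ}

variable (μ X φ βs b) in
/-- The sum of the squares of the normalized sums in the expansion and of the average of
`(1 + b)^5`. -/
noncomputable def controlSum (n : ℕ) (ω : Ω) : ℝ :=
  ∑ l, PhiBar X φ βs n ω l ^ 2 + ∑ l, ∑ j, PhiBar1 μ X φ βs n ω l j ^ 2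
    + ∑ l, ∑ j, ∑ k, PhiBar2 μ X φ βs n ω l j k ^ 2
    + ∑ l, ∑ j, ∑ k, ∑ h, PhiBar3 μ X φ βs n ω l j k h ^ 2
    + (n : ℝ)⁻¹ * ∑ i ∈ Finset.range n, (1 + b (X i ω)) ^ 5

theorem le_controlSum (hb : ∀ x, 0 ≤ b x) (n : ℕ) (ω : Ω) :
    (∀ l, PhiBar X φ βs n ω l ^ 2 ≤ controlSum μ X φ βs b n ω) ∧
    (∀ l j, PhiBar1 μ X φ βs n ω l j ^ 2 ≤ controlSum μ X φ βs b n ω) ∧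
    (∀ l j k, PhiBar2 μ X φ βs n ω l j k ^ 2 ≤ controlSum μ X φ βs b n ω) ∧
    (∀ l j k h, PhiBar3 μ X φ βs n ω l j k h ^ 2 ≤ controlSum μ X φ βs b n ω) ∧
    (n : ℝ)⁻¹ * ∑ i ∈ Finset.range n, (1 + b (X i ω)) ^ 5 ≤ controlSum μ X φ βs b n ω := by
  have p0 : ∀ l, 0 ≤ PhiBar X φ βs n ω l ^ 2 := fun l => sq_nonneg _
  have p1 : ∀ l j, 0 ≤ PhiBar1 μ X φ βs n ω l j ^ 2 := fun l j => sq_nonneg _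
  have p2 : ∀ l j k, 0 ≤ PhiBar2 μ X φ βs n ω l j k ^ 2 := fun l j k => sq_nonneg _
  have p3 : ∀ l j k h, 0 ≤ PhiBar3 μ X φ βs n ω l j k h ^ 2 := fun l j k h => sq_nonneg _
  have p4 : 0 ≤ (n : ℝ)⁻¹ * ∑ i ∈ Finset.range n, (1 + b (X i ω)) ^ 5 :=
    mul_nonneg (by positivity) (Finset.sum_nonneg fun i _ => by have := hb (X i ω); positivity)
  have s1 : ∀ l, 0 ≤ ∑ j, PhiBar1 μ X φ βs n ω l j ^ 2 := fun l => Finset.sum_nonneg fun j _ => p1 l j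
  have s2 : ∀ l j, 0 ≤ ∑ k, PhiBar2 μ X φ βs n ω l j k ^ 2 := fun l j =>
    Finset.sum_nonneg fun k _ => p2 l j k
  have s2' : ∀ l, 0 ≤ ∑ j, ∑ k, PhiBar2 μ X φ βs n ω l j k ^ 2 := fun l =>
    Finset.sum_nonneg fun j _ => s2 l j
  have s3 : ∀ l j k, 0 ≤ ∑ h, PhiBar3 μ X φ βs n ω l j k h ^ 2 := fun l j k =>
    Finset.sum_nonneg fun h _ => p3 l j k h
  have s3' : ∀ l j, 0 ≤ ∑ k, ∑ h, PhiBar3 μ X φ βs n ω l j k h ^ 2 := fun l j =>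
    Finset.sum_nonneg fun k _ => s3 l j k
  have s3'' : ∀ l, 0 ≤ ∑ j, ∑ k, ∑ h, PhiBar3 μ X φ βs n ω l j k h ^ 2 := fun l =>
    Finset.sum_nonneg fun j _ => s3' l j
  have t0 := Finset.sum_nonneg fun l (_ : l ∈ Finset.univ) => p0 l
  have t1 := Finset.sum_nonneg fun l (_ : l ∈ Finset.univ) => s1 l
  have t2 := Finset.sum_nonneg fun l (_ : l ∈ Finset.univ) => s2' l
  have t3 := Finset.sum_nonneg fun l (_ : l ∈ Finset.univ) => s3'' l
  have single : ∀ {f : ι → ℝ}, (∀ i, 0 ≤ f i) → ∀ i, f i ≤ ∑ i, f i := fun hf i =>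
    Finset.single_le_sum (fun j _ => hf j) (Finset.mem_univ i)
  unfold controlSum
  refine ⟨fun l => ?_, fun l j => ?_, fun l j k => ?_, fun l j k h => ?_, by linarith⟩
  · linarith [single p0 l]
  · linarith [single (p1 l) j, single s1 l]
  · linarith [single (p2 l j) k, single (s2 l) j, single s2' l]
  · linarith [single (p3 l j k) h, single (s3 l j) k, single (s3' l) j, single s3'' l]

theorem integrable_average {f : 𝒳 → ℝ} (hX : ∀ i, Measurable (X i))
    (hid : ∀ i, IdentDistrib (X i) (X 0) μ μ) (hf : Integrable f (μ.map (X 0))) (h0 : ∀ x, 0 ≤ f x)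
    (n : ℕ) :
    Integrable (fun ω => (n : ℝ)⁻¹ * ∑ i ∈ Finset.range n, f (X i ω)) μ ∧
      ∫ ω, (n : ℝ)⁻¹ * ∑ i ∈ Finset.range n, f (X i ω) ∂μ ≤ ∫ x, f x ∂(μ.map (X 0)) := by
  have hi : ∀ i, Integrable (fun ω => f (X i ω)) μ := fun i => by
    rw [← (hid i).map_eq] at hf
    exact hf.comp_measurable (hX i)
  have he : ∀ i, ∫ ω, f (X i ω) ∂μ = ∫ x, f x ∂(μ.map (X 0)) := fun i => by
    rw [← (hid i).map_eq] at hf ⊢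
    exact (integral_map (hX i).aemeasurable hf.1).symm
  refine ⟨(integrable_finsetSum _ fun i _ => hi i).const_mul _, ?_⟩
  rw [integral_const_mul, integral_finsetSum _ fun i _ => hi i]
  simp only [he, Finset.sum_const, Finset.card_range, nsmul_eq_mul]
  rw [← mul_assoc]
  refine mul_le_of_le_one_left (integral_nonneg h0) ?_
  rcases eq_or_ne (n : ℝ) 0 with h | h
  · rw [h, mul_zero]; exact zero_le_one
  · rw [inv_mul_cancel₀ h]

/-- The centred third derivatives have degree four, so their squares need eight moments of the
envelope; the other squares and the fifth power need fewer. -/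
theorem controlSum_bounded (hX : ∀ i, Measurable (X i)) (hi : iIndepFun X μ)
    (hid : ∀ i, IdentDistrib (X i) (X 0) μ μ) (hφ : HasEnvelope φ βs b)
    (h0 : ∀ l, mean μ X (fun x => φ x βs l) = 0) (h8 : MemLp b (8 : ℕ) (μ.map (X 0))) :
    (∀ n, Integrable (controlSum μ X φ βs b n) μ) ∧
      ∃ C, ∀ n, ∫ ω, controlSum μ X φ βs b n ω ∂μ ≤ C := by
  have := Measure.isProbabilityMeasure_map (μ := μ) (hX 0).aemeasurable
  have sq_mem : ∀ {d : ℕ} {F : ℕ → Ω → ℝ}, d ≤ 4 → F ∈ polySpan μ X b d →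
      (fun n ω => F n ω ^ 2) ∈ polySpan μ X b 8 := fun {d F} hd hF => by
    simp only [sq]
    exact polySpan_mono (by omega) (mul_fun_mem_polySpan hF hF)
  have m0 := fun l => sq_mem (by norm_num) (nsum_mem_polySpan (hφ.dom0 l) (h0 l))
  have m1 := fun l j => sq_mem (by norm_num)
    (Dom.centred_mem_polySpan hφ (hφ.dom1 l j) (hX 0) h8 (by norm_num))
  have m2 := fun l j k => sq_mem (by norm_num)
    (Dom.centred_mem_polySpan hφ (hφ.dom2 l j k) (hX 0) h8 (by norm_num))
  have m3 := fun l j k h => sq_mem (by norm_num)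
    (Dom.centred_mem_polySpan hφ (hφ.dom3 l j k h) (hX 0) h8 (by norm_num))
  have hmem : (fun n ω => ∑ l, PhiBar X φ βs n ω l ^ 2 + ∑ l, ∑ j, PhiBar1 μ X φ βs n ω l j ^ 2
      + ∑ l, ∑ j, ∑ k, PhiBar2 μ X φ βs n ω l j k ^ 2
      + ∑ l, ∑ j, ∑ k, ∑ h, PhiBar3 μ X φ βs n ω l j k h ^ 2) ∈ polySpan μ X b 8 :=
    add_fun_mem (add_fun_mem (add_fun_mem (sum_fun_mem m0)
      (sum_fun_mem fun l => sum_fun_mem (m1 l)))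
      (sum_fun_mem fun l => sum_fun_mem fun j => sum_fun_mem (m2 l j)))
      (sum_fun_mem fun l => sum_fun_mem fun j => sum_fun_mem fun k => sum_fun_mem (m3 l j k))
  obtain ⟨i1, C, hC⟩ := integrable_and_bounded_of_mem_polySpan hX hi hid h8 le_rfl hmem
  have hb5 : Integrable (fun x => (1 + b x) ^ 5) (μ.map (X 0)) := by
    have h1 : MemLp (fun x => 1 + b x) (8 : ℕ) (μ.map (X 0)) := (memLp_const (1 : ℝ)).add h8
    have h2 := (h1.mono_exponent (Nat.cast_le.2 (by norm_num : 5 ≤ 8))).integrable_norm_pow'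
    refine h2.congr (Eventually.of_forall fun x => ?_)
    have := hφ.b_nonneg x
    simp only [Real.norm_of_nonneg (by linarith : 0 ≤ 1 + b x)]
  have hav := integrable_average hX hid hb5 fun x => by have := hφ.b_nonneg x; positivity
  refine ⟨fun n => (i1 n).add (hav n).1, C + ∫ x, (1 + b x) ^ 5 ∂(μ.map (X 0)), fun n => ?_⟩
  simp only [controlSum]
  rw [integral_add (i1 n) (hav n).1]
  exact add_le_add ((le_abs_self _).trans (hC n)) (hav n).2

end Main

end ETEL

namespace ETEL

/-! ### Stochastic expansion with remainder O_p(n⁻²) -/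

section Expansion

variable {Ω 𝒳 ι : Type*} [MeasurableSpace Ω] [MeasurableSpace 𝒳] [Fintype ι] [DecidableEq ι]
  {μ : Measure Ω} [IsProbabilityMeasure μ] {X : ℕ → Ω → 𝒳} {φ : 𝒳 → (ι → ℝ) → ι → ℝ} {βs : ι → ℝ}
  {b : 𝒳 → ℝ}

/-- The Taylor bound is valid only if (1 + b(x_i))‖δ‖ ≤ r, and this must hold for all i ≤ n at once.
Each (1 + b(x_i))^5 is at most the full sum, hence at most nK, so the fifth power of the product is
at most K L^5 n^{-3/2}, which is eventually small. -/
theorem abs_average_taylorRem_le {r C K L : ℝ} (hr : 0 < r) (hC : 0 ≤ C) (hb : ∀ x, 0 ≤ b x)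
    (ht : ∀ x δ l, (1 + b x) * ‖δ‖ ≤ r → |taylorRem φ βs l δ x| ≤ C * (1 + b x) ^ 5 * ‖δ‖ ^ 4)
    {n : ℕ} {ω : Ω} {δ : ι → ℝ} (hn : 1 ≤ n) (hδ : ‖δ‖ ≤ L * (√(n : ℝ))⁻¹)
    (hK : (n : ℝ)⁻¹ * ∑ i ∈ Finset.range n, (1 + b (X i ω)) ^ 5 ≤ K)
    (hsmall : K * L ^ 5 * (√(n : ℝ))⁻¹ ^ 3 ≤ r ^ 5) (l : ι) :
    |(n : ℝ)⁻¹ * ∑ i ∈ Finset.range n, taylorRem φ βs l δ (X i ω)| ≤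
      C * K * L ^ 4 * (√(n : ℝ))⁻¹ ^ 4 := by
  have hn0 : (0 : ℝ) < n := by exact_mod_cast hn
  have hb5 : ∀ i, 0 ≤ (1 + b (X i ω)) ^ 5 := fun i => by have := hb (X i ω); positivity
  have hK0 : 0 ≤ K := (mul_nonneg (by positivity) (Finset.sum_nonneg fun i _ => hb5 i)).trans hK
  have hsum : ∑ i ∈ Finset.range n, (1 + b (X i ω)) ^ 5 ≤ n * K := by
    rwa [inv_mul_le_iff₀ hn0] at hK
  have hcond : ∀ i ∈ Finset.range n, (1 + b (X i ω)) * ‖δ‖ ≤ r := fun i hi => by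
    have h1 : (1 + b (X i ω)) ^ 5 ≤ n * K := (Finset.single_le_sum (fun j _ => hb5 j) hi).trans hsum
    have h2 : ‖δ‖ ^ 5 ≤ (L * (√(n : ℝ))⁻¹) ^ 5 := pow_le_pow_left₀ (norm_nonneg _) hδ 5
    have h3 : ((1 + b (X i ω)) * ‖δ‖) ^ 5 ≤ r ^ 5 := by
      rw [mul_pow]
      refine (mul_le_mul h1 h2 (by positivity) (by positivity)).trans (le_trans (le_of_eq ?_) hsmall)
      have e : (n : ℝ) * (√(n : ℝ))⁻¹ ^ 2 = 1 := by rw [inv_sqrt_sq, mul_inv_cancel₀ hn0.ne']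
      calc (n : ℝ) * K * (L * (√(n : ℝ))⁻¹) ^ 5
          = (n * (√(n : ℝ))⁻¹ ^ 2) * (K * L ^ 5 * (√(n : ℝ))⁻¹ ^ 3) := by ring
        _ = _ := by rw [e, one_mul]
    exact le_of_pow_le_pow_left₀ (by norm_num) hr.le h3
  calc |(n : ℝ)⁻¹ * ∑ i ∈ Finset.range n, taylorRem φ βs l δ (X i ω)|
      ≤ (n : ℝ)⁻¹ * ∑ i ∈ Finset.range n, C * (1 + b (X i ω)) ^ 5 * ‖δ‖ ^ 4 := by
        rw [abs_mul, abs_of_nonneg (by positivity)]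
        refine mul_le_mul_of_nonneg_left ((Finset.abs_sum_le_sum_abs _ _).trans
          (Finset.sum_le_sum fun i hi => ht _ δ l (hcond i hi))) (by positivity)
    _ = C * ((n : ℝ)⁻¹ * ∑ i ∈ Finset.range n, (1 + b (X i ω)) ^ 5) * ‖δ‖ ^ 4 := by
        rw [← Finset.sum_mul, ← Finset.mul_sum]; ring
    _ ≤ C * K * (L * (√(n : ℝ))⁻¹) ^ 4 :=
        mul_le_mul (mul_le_mul_of_nonneg_left hK hC) (pow_le_pow_left₀ (norm_nonneg _) hδ 4)
          (by positivity) (by positivity)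
    _ = _ := by ring

/-- The expansion holds uniformly where the sample quantities are controlled. -/
theorem exists_abs_remainder_le (hφ : HasEnvelope φ βs b) (hU : IsUnit (Phi1 μ X φ βs))
    (βh : ℕ → Ω → ι → ℝ) {K L : ℝ} :
    ∃ n₀ : ℕ, ∀ l, ∃ c : ℝ, ∀ n ≥ n₀, ∀ ω, controlSum μ X φ βs b n ω ≤ K →
      ‖βh n ω - βs‖ ≤ L * (√(n : ℝ))⁻¹ →
      (∀ l, (n : ℝ)⁻¹ * ∑ i ∈ Finset.range n, φ (X i ω) (βh n ω) l = 0) →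
      |remainder μ X φ βs βh n ω l| ≤ c * ((n : ℝ) ^ 2)⁻¹ := by
  obtain ⟨r, hr, C, hC, ht⟩ := hφ.taylor
  have ha0 : Tendsto (fun n : ℕ => (√(n : ℝ))⁻¹) atTop (𝓝 0) :=
    tendsto_inv_atTop_zero.comp (Real.tendsto_sqrt_atTop.comp tendsto_natCast_atTop_atTop)
  have hsm : ∀ᶠ n : ℕ in atTop, K * L ^ 5 * (√(n : ℝ))⁻¹ ^ 3 ≤ r ^ 5 := by
    have h := (ha0.pow 3).const_mul (K * L ^ 5)
    rw [zero_pow (by norm_num), mul_zero] at h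
    exact h.eventually_le_const (by positivity)
  obtain ⟨n₀, hn₀⟩ := eventually_atTop.1 (hsm.and (eventually_ge_atTop 1))
  refine ⟨n₀, fun l => ?_⟩
  -- The iteration is run over all controlled pairs (n, ω) with the filter ⊤: big-O along ⊤ is a
  -- bound with one constant, uniform in both n and ω.
  let A : Set (ℕ × Ω) := {x | n₀ ≤ x.1 ∧ controlSum μ X φ βs b x.1 x.2 ≤ K ∧
      ‖βh x.1 x.2 - βs‖ ≤ L * (√(x.1 : ℝ))⁻¹ ∧
      ∀ l, (x.1 : ℝ)⁻¹ * ∑ i ∈ Finset.range x.1, φ (X i x.2) (βh x.1 x.2) l = 0}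
  let a : A → ℝ := fun x => (√(x.1.1 : ℝ))⁻¹
  have a_nonneg : ∀ x, 0 ≤ a x := fun x => by positivity
  have ha : a =O[⊤] fun _ => (1 : ℝ) := IsBigO.of_bound 1 (Eventually.of_forall fun x => by
    have h1 : (1 : ℝ) ≤ x.1.1 := by exact_mod_cast (hn₀ _ x.2.1).2
    rw [Real.norm_of_nonneg (a_nonneg x), norm_one, mul_one]
    exact inv_le_one_of_one_le₀ (by rwa [Real.one_le_sqrt]))
  have of_sq : ∀ {f : A → ℝ}, (∀ x, f x ^ 2 ≤ K) → HasOrder ⊤ a 0 f := fun {f} hf =>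
    IsBigO.of_bound (√K) (Eventually.of_forall fun x => by
      rw [pow_zero, norm_one, mul_one, Real.norm_eq_abs]
      exact Real.abs_le_sqrt (hf x))
  have ctl := fun x : A => le_controlSum (μ := μ) (X := X) (φ := φ) (βs := βs) hφ.b_nonneg x.1.1 x.1.2
  have o0 : ∀ l, HasOrder ⊤ a 0 (fun x : A => PhiBar X φ βs x.1.1 x.1.2 l) := fun l =>
    of_sq fun x => ((ctl x).1 l).trans x.2.2.1
  have o1 : ∀ l j, HasOrder ⊤ a 0 (fun x : A => PhiBar1 μ X φ βs x.1.1 x.1.2 l j) := fun l j =>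
    of_sq fun x => ((ctl x).2.1 l j).trans x.2.2.1
  have o2 : ∀ l j k, HasOrder ⊤ a 0 (fun x : A => PhiBar2 μ X φ βs x.1.1 x.1.2 l j k) :=
    fun l j k => of_sq fun x => ((ctl x).2.2.1 l j k).trans x.2.2.1
  have o3 : ∀ l j k h, HasOrder ⊤ a 0 (fun x : A => PhiBar3 μ X φ βs x.1.1 x.1.2 l j k h) :=
    fun l j k h => of_sq fun x => ((ctl x).2.2.2.1 l j k h).trans x.2.2.1
  have negsum : ∀ {i : ℕ} {f : ι → A → ℝ} (c : ι → ℝ), (∀ h, HasOrder ⊤ a i (f h)) →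
      HasOrder ⊤ a i (fun x => -∑ h, c h * f h x) := fun c hf =>
    IsBigO.neg_left (HasOrder.sum fun h => (hf h).const_mul (c h))
  have oδ : ∀ l, HasOrder ⊤ a 1 (fun x : A => (βh x.1.1 x.1.2 - βs) l) := fun l =>
    IsBigO.of_bound L (Eventually.of_forall fun x => by
      rw [pow_one, Real.norm_of_nonneg (a_nonneg x)]
      exact (norm_le_pi_norm _ l).trans x.2.2.2.1)
  have oE : ∀ l, HasOrder ⊤ a 4 (fun x : A => -((Phi1 μ X φ βs)⁻¹ *ᵥ
      momentRem μ X φ βs x.1.1 x.1.2 (βh x.1.1 x.1.2 - βs)) l) := fun l => by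
    refine negsum _ fun h => ?_
    have t₁ := ((HasOrder.self (F := ⊤) (a := a)).mul (HasOrder.sum fun j => HasOrder.sum fun k =>
      HasOrder.sum fun i => (((oδ j).mul (oδ k)).mul (oδ i)).mul (o3 h j k i))).const_mul (1 / 6)
    refine HasOrder.add t₁ (IsBigO.of_bound (C * K * L ^ 4) (Eventually.of_forall fun x => ?_))
    rw [Real.norm_eq_abs, norm_pow, Real.norm_of_nonneg (a_nonneg x)]
    exact abs_average_taylorRem_le hr hC hφ.b_nonneg ht (hn₀ _ x.2.1).2 x.2.2.2.1
      ((ctl x).2.2.2.2.trans x.2.2.1) (hn₀ _ x.2.1).1 h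
  have psym : ∀ l j k, Psi2 μ X φ βs l j k = Psi2 μ X φ βs l k j := fun l j k => by
    have : ∀ h, Phi2 μ X φ βs h j k = Phi2 μ X φ βs h k j := fun h =>
      congrArg (mean μ X) (funext fun x => d2_comm (hφ.contDiffAt x h) j k)
    simp only [Psi2, this]
  have main := hasOrder_four_of_fixedPoint (F := ⊤) (a := a) ha psym oδ
    (fun l => negsum _ o0) (fun l j => negsum _ fun h => o1 h j)
    (fun l j k => negsum _ fun h => o2 h j k) oE
    (c3 := Psi3 μ X φ βs)
    (fun l x => fixedPoint_eq (hn₀ _ x.2.1).2 hU x.2.2.2.2 l)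
    (Q := fun l x => QBar μ X φ βs x.1.1 x.1.2 l) (R := fun l x => RBar μ X φ βs x.1.1 x.1.2 l)
    (fun l x => rfl) (fun l x => rfl) l
  obtain ⟨c, hc⟩ := isBigO_top.1 main
  refine ⟨c, fun n hn ω h1 h2 h3 => ?_⟩
  have h := hc ⟨(n, ω), hn, h1, h2, h3⟩
  have e : ((n : ℝ) ^ 2)⁻¹ = (√(n : ℝ))⁻¹ ^ 4 := by rw [← inv_pow, ← inv_sqrt_sq]; ring
  rw [Real.norm_eq_abs, norm_pow, Real.norm_of_nonneg (a_nonneg _)] at h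
  rw [e]
  refine (le_of_eq (congrArg abs ?_)).trans h
  simp only [remainder, expansion, ← inv_sqrt_sq, a, PsiBar, Pi.sub_apply]
  ring

/-- Off three events of probability at most ε/3 each (large random coefficients, β̂ too far from β*,
moment equation not solved), the deterministic bound applies. -/
theorem isBigOp_remainder (hX : ∀ i, Measurable (X i)) (hi : iIndepFun X μ)
    (hid : ∀ i, IdentDistrib (X i) (X 0) μ μ) (hφ : HasEnvelope φ βs b)
    (h0 : ∀ l, mean μ X (fun x => φ x βs l) = 0) (h8 : MemLp b (8 : ℕ) (μ.map (X 0)))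
    (hU : IsUnit (Phi1 μ X φ βs)) {βh : ℕ → Ω → ι → ℝ} (hβ : IsMomentEstimator μ X φ βs βh) :
    IsBigOp μ (remainder μ X φ βs βh) fun n => ((n : ℝ) ^ 2)⁻¹ := by
  intro ε hε
  obtain ⟨hI, C, hC⟩ := controlSum_bounded hX hi hid hφ h0 h8
  have hnn : ∀ n ω, 0 ≤ controlSum μ X φ βs b n ω := fun n ω => by
    refine le_trans ?_ (le_controlSum hφ.b_nonneg n ω).2.2.2.2
    exact mul_nonneg (by positivity) (Finset.sum_nonneg fun i _ => by
      have := hφ.b_nonneg (X i ω); positivity)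
  have hε3 : 0 < ε / 3 := by positivity
  obtain ⟨K, -, hG⟩ := exists_measure_lt_le hI hnn hC hε3
  obtain ⟨L, n₁, hroot⟩ := hβ.rootn (ε / 3) hε3
  obtain ⟨n₂, hsol⟩ := eventually_atTop.1
    (ENNReal.tendsto_nhds_zero.1 hβ.solves (ENNReal.ofReal (ε / 3)) (ENNReal.ofReal_pos.2 hε3))
  obtain ⟨n₀, hrem⟩ := exists_abs_remainder_le hφ hU βh (K := K) (L := |L|)
  choose c hc using hrem
  refine ⟨∑ l, |c l|, max n₀ (max n₁ n₂), fun n hn => ?_⟩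
  have hsub : {ω | (∑ l, |c l|) * ((n : ℝ) ^ 2)⁻¹ < ‖remainder μ X φ βs βh n ω‖} ⊆
      {ω | K < controlSum μ X φ βs b n ω} ∪ ({ω | L * (√(n : ℝ))⁻¹ < ‖βh n ω - βs‖} ∪
        {ω | ¬ ∀ l, (n : ℝ)⁻¹ * ∑ i ∈ Finset.range n, φ (X i ω) (βh n ω) l = 0}) := by
    intro ω hω
    by_contra hcon
    simp only [Set.mem_union, Set.mem_ofPred_eq, not_or, not_lt, not_not] at hcon
    obtain ⟨g1, g2, g3⟩ := hcon
    have g2' : ‖βh n ω - βs‖ ≤ |L| * (√(n : ℝ))⁻¹ :=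
      g2.trans (mul_le_mul_of_nonneg_right (le_abs_self L) (by positivity))
    refine absurd hω (not_lt.2 ((pi_norm_le_iff_of_nonneg (by positivity)).2 fun l => ?_))
    refine (hc l n (le_of_max_le_left hn) ω g1 g2' g3).trans
      (mul_le_mul_of_nonneg_right ((le_abs_self _).trans ?_) (by positivity))
    exact Finset.single_le_sum (f := fun l => |c l|) (fun j _ => abs_nonneg _) (Finset.mem_univ l)
  refine (measure_mono hsub).trans ((measure_union_le _ _).trans
    ((add_le_add le_rfl (measure_union_le _ _)).trans ?_))
  refine (add_le_add (hG n) (add_le_add (hroot n ?_) (hsol n ?_))).trans (le_of_eq ?_)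
  · exact (le_max_left _ _).trans ((le_max_right _ _).trans hn)
  · exact (le_max_right _ _).trans ((le_max_right _ _).trans hn)
  · rw [← ENNReal.ofReal_add hε3.le hε3.le, ← ENNReal.ofReal_add hε3.le (by positivity)]
    congr 1
    ring

end Expansion

end ETEL

namespace ETEL

/-! ### A model in which the third-order terms differ -/

namespace LocationModel

/-- The support `±(2, 1), ±(-1, 2)` of the observations. -/
def pt : Fin 4 → Fin 2 → ℝ := ![![2, 1], ![-2, -1], ![-1, 2], ![1, -2]]

/-- The uniform distribution on the four support points. -/
noncomputable def law : Measure (Fin 4) := (PMF.uniformOfFintype (Fin 4)).toMeasure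

instance : IsProbabilityMeasure law := inferInstanceAs
  (IsProbabilityMeasure (PMF.uniformOfFintype (Fin 4)).toMeasure)

/-- The law of an i.i.d. sequence of observations. -/
noncomputable def prob : Measure (ℕ → Fin 4) := Measure.infinitePi fun _ => law

instance : IsProbabilityMeasure prob := inferInstanceAs
  (IsProbabilityMeasure (Measure.infinitePi fun _ : ℕ => law))

/-- The coordinate process. -/
def obs (i : ℕ) (ω : ℕ → Fin 4) : Fin 4 := ω i

/-- The moment function `(x₁ - θ, x₂)`. -/
def mom (x : Fin 4) (θ : Fin 1 → ℝ) : Fin 2 → ℝ := ![pt x 0 - θ 0, pt x 1]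

theorem map_obs (i : ℕ) : prob.map (obs i) = law :=
  Measure.infinitePi_map_eval (fun _ : ℕ => law) i

theorem measurable_obs (i : ℕ) : Measurable (obs i) := measurable_pi_apply i

theorem mean_eq (f : Fin 4 → ℝ) : mean prob obs f = (f 0 + f 1 + f 2 + f 3) / 4 := by
  have h : mean prob obs f = ∫ x, f x ∂law := by
    rw [← map_obs 0, integral_map (measurable_obs 0).aemeasurable
      (measurable_of_finite f).aestronglyMeasurable]
    rfl
  rw [h, law, PMF.integral_eq_sum, Fin.sum_univ_four]
  simp only [PMF.uniformOfFintype_apply, Fintype.card_fin, smul_eq_mul]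
  norm_num
  ring

theorem contDiff_mom (x : Fin 4) : ContDiff ℝ 4 (mom x) := by
  rw [contDiff_pi]
  intro a
  fin_cases a <;> simp only [mom, Fin.zero_eta, Fin.mk_one, cons_val_zero, cons_val_one] <;> fun_prop

theorem jac_mom (x : Fin 4) (θ : Fin 1 → ℝ) : jac mom x θ = !![-1; 0] := by
  have h0 : HasLineDerivAt ℝ (fun θ' : Fin 1 → ℝ => pt x 0 - θ' 0) (-1) θ (Pi.single 0 1) := by
    have := ((hasDerivAt_id (0 : ℝ)).const_add (θ 0)).const_sub (pt x 0)
    simpa [HasLineDerivAt] using this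
  ext a c
  fin_cases a <;> fin_cases c
  · simpa [jac, pd, mom] using h0.lineDeriv
  · simp [jac, pd, mom, lineDeriv]

theorem omegaMat_mom : OmegaMat mom prob obs 0 = (5 / 2 : ℝ) • (1 : Matrix (Fin 2) (Fin 2) ℝ) := by
  ext a c
  fin_cases a <;> fin_cases c <;> simp [OmegaMat, mean_eq, mom, pt] <;> norm_num

theorem gMat_mom : GMat mom prob obs 0 = !![-1; 0] := by
  ext a c
  simp only [GMat, jac_mom, mean_eq, of_apply]
  ring

theorem omegaMat_mom_inv :
    (OmegaMat mom prob obs 0)⁻¹ = (2 / 5 : ℝ) • (1 : Matrix (Fin 2) (Fin 2) ℝ) := by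
  rw [omegaMat_mom]
  refine inv_eq_right_inv ?_
  rw [smul_mul_smul_comm, mul_one]
  norm_num

theorem sigmaMat_mom : SigmaMat mom prob obs 0 = !![5 / 2] := by
  rw [SigmaMat, omegaMat_mom_inv, gMat_mom]
  refine inv_eq_right_inv ?_
  ext a c
  fin_cases a; fin_cases c
  simp [Matrix.mul_apply, Fin.sum_univ_two]

theorem hMat_mom : HMat mom prob obs 0 = !![-1, 0] := by
  rw [HMat, sigmaMat_mom, omegaMat_mom_inv, gMat_mom]
  ext a c
  fin_cases a; fin_cases c <;> simp [vecMul, dotProduct]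

theorem pMat_mom : PMat mom prob obs 0 = !![0, 0; 0, 2 / 5] := by
  rw [PMat, sigmaMat_mom, omegaMat_mom_inv, gMat_mom]
  ext a c
  fin_cases a <;> fin_cases c <;> simp [vecMul, dotProduct]

theorem exists_bound_iteratedFDeriv_mom (x : Fin 4) : ∃ C, ∀ θ ∈ Metric.ball (0 : Fin 1 → ℝ) 1,
    ∀ j ≤ 4, ‖iteratedFDeriv ℝ j (mom x) θ‖ ≤ C := by
  have h : ∀ j : Fin 5, ∃ C, ∀ θ ∈ Metric.closedBall (0 : Fin 1 → ℝ) 1,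
      ‖iteratedFDeriv ℝ j (mom x) θ‖ ≤ C := fun j =>
    (isCompact_closedBall _ _).exists_bound_of_continuousOn
      ((contDiff_mom x).continuous_iteratedFDeriv (by exact_mod_cast Nat.lt_succ_iff.1 j.2)).continuousOn
  choose C hC using h
  obtain ⟨K, hK⟩ := Finite.bddAbove_range C
  exact ⟨K, fun θ hθ j hj => (hC ⟨j, Nat.lt_succ_iff.2 hj⟩ θ (Metric.ball_subset_closedBall hθ)).trans
    (hK ⟨_, rfl⟩)⟩

theorem exists_isRegularModel : ∃ b, IsRegularModel prob obs mom 0 (Metric.ball 0 1) b := by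
  choose b hb using exists_bound_iteratedFDeriv_mom
  refine ⟨b, ?_⟩
  have := Measure.isProbabilityMeasure_map (μ := prob) (measurable_obs 0).aemeasurable
  exact
  { measurable_X := measurable_obs
    indep := iIndepFun_infinitePi (fun _ => measurable_id)
    ident := fun i => ⟨(measurable_obs i).aemeasurable, (measurable_obs 0).aemeasurable,
      by rw [map_obs, map_obs]⟩
    isOpen_N := Metric.isOpen_ball
    mem_N := Metric.mem_ball_self one_pos
    measurable_g := fun θ _ => measurable_of_finite _
    smooth := fun x => (contDiff_mom x).contDiffOn
    bound := hb
    moment_b := by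
      obtain ⟨K, hK⟩ := Finite.bddAbove_range fun x => ‖b x‖
      exact MemLp.of_bound (measurable_of_finite b).aestronglyMeasurable K
        (ae_of_all _ fun x => hK ⟨x, rfl⟩)
    mean_zero := fun a => by fin_cases a <;> simp [mean_eq, mom, pt]
    omega_nonsingular := by
      rw [omegaMat_mom]
      rw [isUnit_iff_isUnit_det]
      norm_num [det_fin_two]
    full_rank := by
      have h : (!![-1; 0] : Matrix (Fin 2) (Fin 1) ℝ)ᵀ * (!![-1; 0] : Matrix (Fin 2) (Fin 1) ℝ) = 1 := by
        ext a c
        fin_cases a; fin_cases c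
        simp [Matrix.mul_apply, Fin.sum_univ_two]
      rw [gMat_mom, ← rank_transpose_mul_self, h, rank_one, Fintype.card_fin] }

/-- The support is symmetric about the origin, so third moments vanish and the λ- and κ-parts of Q̄
agree; only the cubic term is left. The coordinates are uncorrelated but E[x₁ x₂³] = -3, which with
H = (-1, 0) and the factor 1/2 gives 3/2. -/
theorem RBar_sub_eq (n : ℕ) (ω : ℕ → Fin 4) :
    RBar prob obs (phiETEL mom) (betaStar 0) n ω (iθ 0)
      - RBar prob obs (phiEL mom) (betaStar 0) n ω (iθ 0)
      = 3 / 2 * (-(2 / 5 * gBar mom obs 0 n ω 1)) ^ 3 := by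
  obtain ⟨b, hM⟩ := exists_isRegularModel
  have hκ : ∀ x, blockDot mom 0 iκ (psiVec mom prob obs 0 n ω) x
      = -(2 / 5 * gBar mom obs 0 n ω 1) * pt x 1 := fun x => by
    simp [blockDot, psiVec, ETEL.mk, pMat_mom, Fin.sum_univ_two, mom, dotProduct]
  have hQ : ∀ x, blockDot mom 0 iΛ (QBar prob obs (phiETEL mom) (betaStar 0) n ω) x
      - blockDot mom 0 iκ (QBar prob obs (phiETEL mom) (betaStar 0) n ω) x = 0 := fun x => by
    rw [blockDot, blockDot, ← Finset.sum_sub_distrib]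
    refine Finset.sum_eq_zero fun a _ => ?_
    rw [← sub_mul, hM.QBar_Λ_sub_κ]
    simp only [hκ, omegaMat_mom_inv, mean_eq]
    refine mul_eq_zero_of_left (mul_eq_zero_of_right _ (congrFun
      ((congrArg _ (funext fun a => ?_)).trans (mulVec_zero _)) a)) _
    fin_cases a <;> simp [mom, pt]
  rw [hM.RBar_sub, hMat_mom]
  simp only [hκ, hQ, mean_eq]
  simp [mom, pt, mulVec, dotProduct, Fin.sum_univ_two]
  ring

/-- All n observations equal the first support point with positive probability; then ḡ₂ = √n and the
explicit difference is nonzero. -/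
theorem prob_RBar_ne_pos {n : ℕ} (hn : 1 ≤ n) :
    0 < prob {ω | RBar prob obs (phiETEL mom) (betaStar 0) n ω (iθ 0) ≠
      RBar prob obs (phiEL mom) (betaStar 0) n ω (iθ 0)} := by
  have hpos : 0 < prob (Set.pi (Finset.range n) fun _ => {0}) := by
    rw [prob, Measure.infinitePi_pi _ fun _ _ => measurableSet_singleton 0]
    refine pos_iff_ne_zero.2 (Finset.prod_ne_zero_iff.2 fun i _ => ?_)
    rw [law, PMF.toMeasure_apply_singleton _ _ (measurableSet_singleton _)]
    simp
  refine hpos.trans_le (measure_mono fun ω hω => ?_)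
  have hg : gBar mom obs 0 n ω 1 = (√(n : ℝ))⁻¹ * n := by
    have : ∀ i ∈ Finset.range n, mom (obs i ω) 0 1 = 1 := fun i hi => by
      have h0 : obs i ω = 0 := hω i hi
      simp [h0, mom, pt]
    rw [gBar, nsum, Finset.sum_congr rfl this]
    simp
  have hn' : (0 : ℝ) < n := by exact_mod_cast hn
  refine fun h => ?_
  have := RBar_sub_eq n ω
  rw [h, sub_self, hg] at this
  have h3 : 0 < (√(n : ℝ))⁻¹ * n := by positivity
  have h4 := pow_pos h3 3
  nlinarith

end LocationModel

theorem exists_RBar_ne : ∃ (Ω 𝒳 : Type) (_ : MeasurableSpace Ω) (_ : MeasurableSpace 𝒳) (m p : ℕ)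
      (μ : Measure Ω) (_ : IsProbabilityMeasure μ) (X : ℕ → Ω → 𝒳)
      (g : 𝒳 → (Fin p → ℝ) → Fin m → ℝ) (θs : Fin p → ℝ) (N : Set (Fin p → ℝ)) (b : 𝒳 → ℝ),
      IsRegularModel μ X g θs N b ∧
      ∃ l : Fin p, ∀ n : ℕ, 1 ≤ n →
        0 < μ {ω | RBar μ X (phiETEL g) (betaStar θs) n ω (iθ l) ≠
          RBar μ X (phiEL g) (betaStar θs) n ω (iθ l)} := by
  obtain ⟨b, hM⟩ := LocationModel.exists_isRegularModel
  exact ⟨_, _, _, _, 2, 1, LocationModel.prob, inferInstance, LocationModel.obs, LocationModel.mom, 0,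
    _, b, hM, 0, fun _ hn => LocationModel.prob_RBar_ne_pos hn⟩

end ETEL

/-! ### Assembly of the theorem -/

theorem mainTheorem1 :
    -- in every regular model
    (∀ {Ω 𝒳 : Type*} [MeasurableSpace Ω] [MeasurableSpace 𝒳] {m p : ℕ}
      (μ : Measure Ω) [IsProbabilityMeasure μ] (X : ℕ → Ω → 𝒳)
      (g : 𝒳 → (Fin p → ℝ) → Fin m → ℝ) (θs : Fin p → ℝ) (N : Set (Fin p → ℝ)) (b : 𝒳 → ℝ),
      IsRegularModel μ X g θs N b →
      ∀ (φE φL : 𝒳 → (Idx m p → ℝ) → Idx m p → ℝ) (βs : Idx m p → ℝ),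
      φE = phiETEL g → φL = phiEL g → βs = betaStar θs →
      -- identical first-order terms
      (∀ n ω, PsiBar μ X φE βs n ω = PsiBar μ X φL βs n ω ∧
        PsiBar μ X φL βs n ω =
          mk 0 (-(PMat g μ X θs *ᵥ gBar g X θs n ω)) (-(PMat g μ X θs *ᵥ gBar g X θs n ω))
            (-(HMat g μ X θs *ᵥ gBar g X θs n ω))) ∧
      -- identical second-order terms
      (∀ n ω, QBar μ X φE βs n ω = QBar μ X φL βs n ω) ∧
      -- the difference of the third-order terms for `θ` is asymptotically uncorrelated with `Ψ̄_θ`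
      (∀ l c : Fin p,
        (∀ n, Integrable (fun ω => (RBar μ X φE βs n ω (iθ l) - RBar μ X φL βs n ω (iθ l)) *
          PsiBar μ X φL βs n ω (iθ c)) μ) ∧
        ((fun n : ℕ => ∫ ω, (RBar μ X φE βs n ω (iθ l) - RBar μ X φL βs n ω (iθ l)) *
          PsiBar μ X φL βs n ω (iθ c) ∂μ) =O[atTop] fun n : ℕ => (n : ℝ)⁻¹) ∧
        ((fun n : ℕ => ((n : ℝ) ^ 2)⁻¹ *
          ∫ ω, (RBar μ X φE βs n ω (iθ l) - RBar μ X φL βs n ω (iθ l)) *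
            PsiBar μ X φL βs n ω (iθ c) ∂μ) =o[atTop] fun n : ℕ => ((n : ℝ) ^ 2)⁻¹)) ∧
      -- the four terms of this difference
      (∀ n ω (l : Fin p),
        ∑ j, (PsiBar1 μ X φE βs n ω (iθ l) j - PsiBar1 μ X φL βs n ω (iθ l) j) *
            QBar μ X φL βs n ω j =
          1 / 2 * (HMat g μ X θs *ᵥ gBar g X θs n ω) l *
            (gBar g X θs n ω ⬝ᵥ PMat g μ X θs *ᵥ gBar g X θs n ω)) ∧
      (∃ Ξ₇ : ℕ → Ω → Fin p → ℝ,
        (∀ n ω (l : Fin p),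
          ∑ j, ∑ k, (Psi2 μ X φE βs (iθ l) j k - Psi2 μ X φL βs (iθ l) j k) *
              PsiBar μ X φL βs n ω k * QBar μ X φL βs n ω j =
            -(1 / 2 * (HMat g μ X θs *ᵥ gBar g X θs n ω) l *
              (gBar g X θs n ω ⬝ᵥ PMat g μ X θs *ᵥ gBar g X θs n ω)) - Ξ₇ n ω l) ∧
        ∀ l c : Fin p,
          (∀ n, Integrable (fun ω => Ξ₇ n ω l * PsiBar μ X φL βs n ω (iθ c)) μ) ∧
          (fun n : ℕ => ((n : ℝ) ^ 2)⁻¹ * ∫ ω, Ξ₇ n ω l * PsiBar μ X φL βs n ω (iθ c) ∂μ)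
            =o[atTop] fun n : ℕ => ((n : ℝ) ^ 2)⁻¹) ∧
      (∀ n ω (l : Idx m p),
        ∑ j, ∑ k, (PsiBar2 μ X φE βs n ω l j k - PsiBar2 μ X φL βs n ω l j k) *
          PsiBar μ X φL βs n ω j * PsiBar μ X φL βs n ω k = 0) ∧
      (∃ Ξ₈ : ℕ → Ω → Fin p → ℝ,
        (∀ n ω (l : Fin p),
          ∑ j, ∑ k, ∑ h, (Psi3 μ X φE βs (iθ l) j k h - Psi3 μ X φL βs (iθ l) j k h) *
            PsiBar μ X φL βs n ω j * PsiBar μ X φL βs n ω k * PsiBar μ X φL βs n ω h =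
          Ξ₈ n ω l) ∧
        ∀ l c : Fin p,
          (∀ n, Integrable (fun ω => Ξ₈ n ω l * PsiBar μ X φL βs n ω (iθ c)) μ) ∧
          (fun n : ℕ => ((n : ℝ) ^ 2)⁻¹ * ∫ ω, Ξ₈ n ω l * PsiBar μ X φL βs n ω (iθ c) ∂μ)
            =o[atTop] fun n : ℕ => ((n : ℝ) ^ 2)⁻¹) ∧
      -- the variances of the expansions for `θ` agree up to order `n^{-2}`
      (∀ l c : Fin p,
        (fun n : ℕ => secondOrderVar μ X φE βs n (iθ l) (iθ c) -
          secondOrderVar μ X φL βs n (iθ l) (iθ c)) =o[atTop] fun n : ℕ => ((n : ℝ) ^ 2)⁻¹) ∧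
      (MemLp b 12 (μ.map (X 0)) →
        (∀ φ ∈ ({φE, φL} : Set (𝒳 → (Idx m p → ℝ) → Idx m p → ℝ)), ∀ l j : Idx m p,
          (∀ n, MemLp (fun ω => expansion μ X φ βs n ω l) 2 μ) ∧
          (fun n : ℕ => cov[fun ω => expansion μ X φ βs n ω l,
              fun ω => expansion μ X φ βs n ω j; μ] - secondOrderVar μ X φ βs n l j)
            =o[atTop] fun n : ℕ => ((n : ℝ) ^ 2)⁻¹) ∧
        ∀ l c : Fin p,
          (fun n : ℕ =>
            cov[fun ω => expansion μ X φE βs n ω (iθ l),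
              fun ω => expansion μ X φE βs n ω (iθ c); μ] -
            cov[fun ω => expansion μ X φL βs n ω (iθ l),
              fun ω => expansion μ X φL βs n ω (iθ c); μ])
            =o[atTop] fun n : ℕ => ((n : ℝ) ^ 2)⁻¹) ∧
      -- the estimators
      (∀ βE βL : ℕ → Ω → Idx m p → ℝ,
        IsMomentEstimator μ X φE βs βE → IsMomentEstimator μ X φL βs βL →
        (MemLp b 8 (μ.map (X 0)) →
          IsBigOp μ (remainder μ X φE βs βE) (fun n => ((n : ℝ) ^ 2)⁻¹) ∧
          IsBigOp μ (remainder μ X φL βs βL) (fun n => ((n : ℝ) ^ 2)⁻¹)) ∧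
        (MemLp b 12 (μ.map (X 0)) →
          (∀ c : Fin p,
            (∀ᶠ n in atTop, MemLp (fun ω => remainder μ X φE βs βE n ω (iθ c)) 2 μ ∧
              MemLp (fun ω => remainder μ X φL βs βL n ω (iθ c)) 2 μ) ∧
            ((fun n : ℕ => ∫ ω, (remainder μ X φE βs βE n ω (iθ c)) ^ 2 ∂μ)
              =o[atTop] fun n : ℕ => ((n : ℝ) ^ 3)⁻¹) ∧
            ((fun n : ℕ => ∫ ω, (remainder μ X φL βs βL n ω (iθ c)) ^ 2 ∂μ)
              =o[atTop] fun n : ℕ => ((n : ℝ) ^ 3)⁻¹)) →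
          ∀ l c : Fin p,
            (fun n : ℕ =>
              cov[fun ω => βE n ω (iθ l), fun ω => βE n ω (iθ c); μ] -
              cov[fun ω => βL n ω (iθ l), fun ω => βL n ω (iθ c); μ])
              =o[atTop] fun n : ℕ => ((n : ℝ) ^ 2)⁻¹))) ∧
    -- the third-order terms differ in general
    (∃ (Ω 𝒳 : Type) (_ : MeasurableSpace Ω) (_ : MeasurableSpace 𝒳) (m p : ℕ)
      (μ : Measure Ω) (_ : IsProbabilityMeasure μ) (X : ℕ → Ω → 𝒳)
      (g : 𝒳 → (Fin p → ℝ) → Fin m → ℝ) (θs : Fin p → ℝ) (N : Set (Fin p → ℝ)) (b : 𝒳 → ℝ),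
      IsRegularModel μ X g θs N b ∧
      ∃ l : Fin p, ∀ n : ℕ, 1 ≤ n →
        0 < μ {ω | RBar μ X (phiETEL g) (betaStar θs) n ω (iθ l) ≠
          RBar μ X (phiEL g) (betaStar θs) n ω (iθ l)}) := by
  refine ⟨?_, exists_RBar_ne⟩
  intro Ω 𝒳 _ _ m p μ _ X g θs N b hM φE φL βs hφE hφL hβs
  subst hφE hφL hβs
  have h0E := hM.mean_phi_betaStar (phiETEL_betaStar (g := g) (θs := θs))
  have h0L := hM.mean_phi_betaStar (phiEL_betaStar (g := g) (θs := θs))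
  have hUE := hM.isUnit_Phi1_and_inv_mulVec.1
  have hUL : IsUnit (Phi1 μ X (phiEL g) (betaStar θs)) := by rw [hM.Phi1_phiEL]; exact hUE
  have h12 : MemLp b 12 (μ.map (X 0)) → MemLp b (12 : ℕ) (μ.map (X 0)) := fun h => by
    exact_mod_cast h
  have hvar : MemLp b 12 (μ.map (X 0)) → ∀ l c : Fin p,
      (fun n : ℕ =>
        cov[fun ω => expansion μ X (phiETEL g) (betaStar θs) n ω (iθ l),
          fun ω => expansion μ X (phiETEL g) (betaStar θs) n ω (iθ c); μ] -
        cov[fun ω => expansion μ X (phiEL g) (betaStar θs) n ω (iθ l),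
          fun ω => expansion μ X (phiEL g) (betaStar θs) n ω (iθ c); μ])
        =o[atTop] fun n : ℕ => ((n : ℝ) ^ 2)⁻¹ := fun hb l c => by
    have hE := covariance_expansion_sub hM.measurable_X hM.indep hM.ident (h12 hb)
      hM.hasEnvelope_phiETEL h0E (by norm_num) (iθ l) (iθ c)
    have hL := covariance_expansion_sub hM.measurable_X hM.indep hM.ident (h12 hb)
      hM.hasEnvelope_phiEL h0L (by norm_num) (iθ l) (iθ c)
    refine ((hE.sub hL).add (hM.secondOrderVar_sub_isLittleO l c)).congr_left fun n => ?_
    ring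
  refine ⟨fun n ω => ⟨by rw [hM.PsiBar_phiETEL, hM.PsiBar_phiEL], hM.PsiBar_phiEL n ω⟩,
    fun n ω => (hM.QBar_phiEL n ω).symm, fun l c => ?_, fun n ω l => ?_, ?_, fun n ω l => ?_, ?_,
    hM.secondOrderVar_sub_isLittleO, fun hb => ⟨?_, hvar hb⟩, fun βE βL hβE hβL => ⟨fun h8 => ?_, ?_⟩⟩
  · simp only [hM.PsiBar_phiEL]
    obtain ⟨hi, C, hC⟩ := hM.integral_mul_psiVec_of_mem_cubicSpan (hM.RBar_sub_mem_cubicSpan l) c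
    exact ⟨hi, isBigO_inv_of_abs_le hC, isLittleO_mul_of_abs_le hC⟩
  · rw [hM.sum_PsiBar1_sub_mul, hM.QBar_phiEL, hM.QBar_τ]
    ring
  -- Ξ₇ is what remains of the second-derivative contraction after the term in Q̄_τ is split off; it
  -- lies in the cubic span.
  · refine ⟨fun n ω l => (HMat g μ X θs *ᵥ fun a => mean μ X fun x => g x θs a *
      (blockDot g θs iκ (psiVec g μ X θs n ω) x *
        (blockDot g θs iΛ (QBar μ X (phiETEL g) (betaStar θs) n ω) x
          - blockDot g θs iκ (QBar μ X (phiETEL g) (betaStar θs) n ω) x))) l,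
      fun n ω l => ?_, fun l c => ?_⟩
    · rw [hM.PsiBar_phiEL, hM.sum_Psi2_sub_mul_mul, hM.QBar_phiEL, hM.QBar_τ]
      ring
    · simp only [hM.PsiBar_phiEL]
      obtain ⟨hi, C, hC⟩ :=
        hM.integral_mul_psiVec_of_mem_cubicSpan (hM.mixed_term_mem_cubicSpan l) c
      exact ⟨hi, isLittleO_mul_of_abs_le hC⟩
  · rw [hM.PsiBar_phiEL]
    exact hM.sum_PsiBar2_sub_mul_mul n ω l
  -- Ξ₈ is the whole third-derivative contraction, a multiple of the cubic term.
  · refine ⟨fun n ω l => 3 * (HMat g μ X θs *ᵥ fun a => mean μ X fun x => g x θs a *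
        blockDot g θs iκ (psiVec g μ X θs n ω) x ^ 3) l, fun n ω l => ?_, fun l c => ?_⟩
    · rw [hM.PsiBar_phiEL]
      exact hM.sum_Psi3_sub_mul_mul_mul n ω l
    · simp only [hM.PsiBar_phiEL]
      obtain ⟨hi, C, hC⟩ := hM.integral_mul_psiVec_of_mem_cubicSpan
        (const_mul_fun_mem 3 (hM.cubic_term_mem_cubicSpan l)) c
      exact ⟨hi, isLittleO_mul_of_abs_le hC⟩
  · rintro φ (rfl | rfl) l j
    · exact ⟨memLp_expansion hM.measurable_X hM.indep hM.ident (h12 hb) hM.hasEnvelope_phiETEL h0E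
        (by norm_num) l, covariance_expansion_sub hM.measurable_X hM.indep hM.ident (h12 hb)
        hM.hasEnvelope_phiETEL h0E (by norm_num) l j⟩
    · exact ⟨memLp_expansion hM.measurable_X hM.indep hM.ident (h12 hb) hM.hasEnvelope_phiEL h0L
        (by norm_num) l, covariance_expansion_sub hM.measurable_X hM.indep hM.ident (h12 hb)
        hM.hasEnvelope_phiEL h0L (by norm_num) l j⟩
  · have h8' : MemLp b (8 : ℕ) (μ.map (X 0)) := by exact_mod_cast h8
    exact ⟨isBigOp_remainder hM.measurable_X hM.indep hM.ident hM.hasEnvelope_phiETEL h0E h8' hUE hβE,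
      isBigOp_remainder hM.measurable_X hM.indep hM.ident hM.hasEnvelope_phiEL h0L h8' hUL hβL⟩
  · intro hb hrem l c
    have hE := covariance_estimator_sub hM.measurable_X hM.indep hM.ident (h12 hb)
      hM.hasEnvelope_phiETEL h0E (by norm_num) ((hrem l).1.mono fun _ h => h.1)
      ((hrem c).1.mono fun _ h => h.1) (hrem l).2.1 (hrem c).2.1
    have hL := covariance_estimator_sub hM.measurable_X hM.indep hM.ident (h12 hb)
      hM.hasEnvelope_phiEL h0L (by norm_num) ((hrem l).1.mono fun _ h => h.2)
      ((hrem c).1.mono fun _ h => h.2) (hrem l).2.2 (hrem c).2.2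
    refine ((hE.sub hL).add (hvar hb l c)).congr_left fun n => ?_
    ring
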